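/- Let $k$ be an algebraically closed field of characteristic different from $2$, let $F\subset\mathbb{P}^3_k$ be a smooth cubic surface with equation $f=0$, and let $T$ be a tritangent plane of $F$, cutting $F$ along three distinct lines $\ell_1,\ell_2,\ell_3$ that form a triangle (i.e. do not pass through one common point). For planes $\Pi_1,\Pi_2,\Pi_3\neq T$ with $\ell_i\subset \Pi_i$, write $\Pi_i\cap F=\ell_i+K_i$ with residual conic $K_i$, and let $G(\Pi_1,\Pi_2,\Pi_3)$ be the quadric that cuts out $K_1+K_2+K_3$ on $F$ (Cremona's family of quadrics). Let the Steinerian surface $S$ be the Zariski closure of the set of singular points of all quadrics $G(\Pi_1,\Pi_2,\Pi_3)$. A conjugate triad is a set $\{A_1,A_2,A_3\}$ of tritangent planes of $F$ for which there are tritangent planes $B_1,B_2,B_3$ such that the nine intersections $A_i\cap B_j$ are nine distinct lines on $F$. Then $S$ is an irreducible quartic surface. It has exactly $12$ singular points, and all of them are nodes (ordinary double points). There are exactly $16$ conjugate triads $\{T,A,B\}$ containing $T$; the intersections $A\cap B$ are $16$ distinct lines, and all of them lie on $S$. The $12$ nodes and these $16$ lines form a configuration $(12_4,16_3)$: each of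 the nodes lies on exactly four of the lines, and each of the lines contains exactly three of the nodes. -/

import Mathlib

/-!
In suitable coordinates `T` is the plane `x₃ = 0`, the lines `ℓᵢ` are its coordinate lines
`xᵢ = x₃ = 0`, and `f = 2 x₀ x₁ x₂ + x₃ q` for a quadratic form `q` with symmetric matrix `A`. The
planes of the pencils are `xᵢ + tᵢ x₃ = 0`, and writing `f = 2 ∏ (xᵢ + tᵢ x₃) + x₃ qₜ` exhibits
`qₜ = 0` as the quadric of Cremona's family with parameters `t`. With the half partial derivatives
`fᵢ = (∂f / ∂xᵢ) / 2` for `i < 3`, the Steinerian surface is given by the quartic `G` with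
`x₃² G = 4 f₀ f₁ f₂ - f²`. The expression of `G` in `x` and `A x` keeps its shape when `q` is
replaced by `qₜ` and the coordinates by `xᵢ + tᵢ x₃` and `x₃`, so `G` vanishes wherever some `qₜ` is
singular. Conversely a zero of `G` with `f ≠ 0` is a singular point of some `qₜ`.

The singular points of `G` are the singular points of the residual conics of the planes
`xᵢ + s x₃ = 0`. For each `i` the discriminant of these conics is a quartic polynomial in `s`, and
smoothness of the cubic makes its roots simple; this gives `3 · 4 = 12` nodes. A reducible surface
would be singular with Hessian of rank at most two where its components meet, so `G` is irreducible.

A conjugate triad through `T` is the same as a member `qₜ = α β` that splits into two planes: then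
`f = 2 ∏ (xᵢ + tᵢ x₃) + x₃ α β` displays a Steiner trihedral pair, and the line `α = β = 0`, along
which `qₜ` is singular, lies on the Steinerian surface. Any two of the parameters `tᵢ` of a split
member may be chosen freely among the four roots of their discriminants, and they determine the
third one, so there are `4 · 4 = 16` lines. The node of the `i`-th pencil with parameter `s` lies on
the line of `t` exactly when `tᵢ = s`.
-/

open scoped LinearAlgebra.Projectivization

namespace CremonaQuartic

variable {k : Type*} [Field k]

/-- Homogeneous coordinate space of projective 3-space. -/
abbrev V4 (k : Type*) [Field k] : Type _ := Fin 4 → k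

/-- The projective space of dimension three. -/
abbrev P3 (k : Type*) [Field k] : Type _ := ℙ k (V4 k)

/-- Polynomials in the four homogeneous coordinates. -/
abbrev Form (k : Type*) [Field k] : Type _ := MvPolynomial (Fin 4) k

/-- The points of the projective linear subspace attached to the linear subspace `W`;
lines and planes are linear subspaces of dimension two and three. -/
def pts (W : Submodule k (V4 k)) : Set (P3 k) := {p | p.submodule ≤ W}

/-- Zero locus in projective 3-space (used only for homogeneous polynomials, for which the value
of `g` being zero does not depend on the representative). -/
def zeroLocus (g : Form k) : Set (P3 k) := {p | MvPolynomial.eval p.rep g = 0}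

/-- Singular points of the surface `g = 0`: the form and all its partial derivatives vanish. -/
def singularPoints (g : Form k) : Set (P3 k) :=
  {p | MvPolynomial.eval p.rep g = 0 ∧
    ∀ i, MvPolynomial.eval p.rep (MvPolynomial.pderiv i g) = 0}

/-- The Hessian matrix of `g` at (a representative of) `p`. -/
noncomputable def hessianAt (g : Form k) (p : P3 k) : Matrix (Fin 4) (Fin 4) k :=
  Matrix.of fun i j =>
    MvPolynomial.eval p.rep (MvPolynomial.pderiv i (MvPolynomial.pderiv j g))

/-- A node (ordinary double point, characteristic not two): a singular point at which the tangent
cone is a nondegenerate quadratic cone. At a singular point the vector of coordinates of `p` lies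
in the kernel of the homogeneous Hessian, and the induced form on the quotient by it is the
Hessian form in local coordinates, so nondegeneracy means that the rank is three. -/
def IsNode (g : Form k) (p : P3 k) : Prop :=
  p ∈ singularPoints g ∧ (hessianAt g p).rank = 3

/-- Zariski closure of a set of points of projective 3-space. -/
def zariskiClosure (A : Set (P3 k)) : Set (P3 k) :=
  {p | ∀ (d : ℕ) (g : Form k), g.IsHomogeneous d → A ⊆ zeroLocus g → p ∈ zeroLocus g}

/-- `f` is the equation of a smooth cubic surface (`k` will be algebraically closed). -/
def IsSmoothCubic (f : Form k) : Prop :=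
  f.IsHomogeneous 3 ∧ singularPoints f = ∅

/-- The plane `T` cuts the cubic surface `f = 0` along the three distinct lines `l 0, l 1, l 2`. -/
def IsTritangentWith (f : Form k) (T : Submodule k (V4 k)) (l : Fin 3 → Submodule k (V4 k)) :
    Prop :=
  Module.finrank k T = 3 ∧ (∀ i, Module.finrank k (l i) = 2) ∧ Function.Injective l ∧
    pts T ∩ zeroLocus f = ⋃ i, pts (l i)

/-- `T` is a tritangent plane of the cubic surface `f = 0`. -/
def IsTritangentPlane (f : Form k) (T : Submodule k (V4 k)) : Prop :=
  ∃ l, IsTritangentWith f T l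

/-- The linear form `a` is an equation of the plane `W`. -/
def IsEquationOf (a : Form k) (W : Submodule k (V4 k)) : Prop :=
  a.IsHomogeneous 1 ∧ zeroLocus a = pts W

/-- Let `F` be the cubic surface `f = 0`, let `T` cut `F` along the lines `l 0 + l 1 + l 2`, and
let the plane `P i ≠ T` belong to the pencil of planes through `l i`. It cuts `F` along `l i + K i`,
where `K i` is the residual conic. This says that the quadric `Q = 0` cuts out
`K 0 + K 1 + K 2` on `F`. As divisors on `F`, the sum of the `K i` is
`(P 0 + P 1 + P 2) ∩ F` minus `T ∩ F`, so the condition is that the cubic forms `w * Q` and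
`π 0 * π 1 * π 2`, where `w` and `π i` are equations of `T` and `P i`, cut out the same
subscheme (divisor) of `F`. -/
def CutsOutResidualConics (f : Form k) (T : Submodule k (V4 k))
    (l P : Fin 3 → Submodule k (V4 k)) (Q : Form k) : Prop :=
  (∀ i, Module.finrank k (P i) = 3 ∧ l i ≤ P i ∧ P i ≠ T) ∧
  Q.IsHomogeneous 2 ∧
  ∃ (w : Form k) (π : Fin 3 → Form k), IsEquationOf w T ∧ (∀ i, IsEquationOf (π i) (P i)) ∧
    Ideal.span {f, w * Q} = Ideal.span {f, ∏ i, π i}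

/-- The Steinerian surface of Cremona's family of quadrics attached to the tritangent plane `T`
with lines `l i`: the Zariski closure of the locus of singular points of the quadrics of the
family. The planes of the pencils are different from `T`: when one of them is `T` the quadric is a
pair of planes, and the singular points of such pairs already sweep out the whole space. -/
def steinerian (f : Form k) (T : Submodule k (V4 k)) (l : Fin 3 → Submodule k (V4 k)) :
    Set (P3 k) :=
  zariskiClosure {p | ∃ P Q, CutsOutResidualConics f T l P Q ∧ p ∈ singularPoints Q}

/-- A conjugate triad of tritangent planes: a set `{A 0, A 1, A 2}` of tritangent planes for which
there are tritangent planes `B 0, B 1, B 2` such that the nine intersections `A i ∩ B j` are nine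
distinct lines on the cubic surface (one half of a Steiner trihedral pair). -/
def IsConjugateTriad (f : Form k) (τ : Set (Submodule k (V4 k))) : Prop :=
  ∃ A B : Fin 3 → Submodule k (V4 k),
    τ = Set.range A ∧
    (∀ i, IsTritangentPlane f (A i)) ∧ (∀ j, IsTritangentPlane f (B j)) ∧
    (∀ i j, Module.finrank k (A i ⊓ B j : Submodule k (V4 k)) = 2 ∧
      pts (A i ⊓ B j) ⊆ zeroLocus f) ∧
    Function.Injective fun ij : Fin 3 × Fin 3 => A ij.1 ⊓ B ij.2

/-- The conjugate triads that contain the given plane `T`. -/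
def triadsThrough (f : Form k) (T : Submodule k (V4 k)) : Set (Set (Submodule k (V4 k))) :=
  {τ | IsConjugateTriad f τ ∧ T ∈ τ}

/-- The intersection of the planes of the triad `τ` other than `T`. -/
def triadLine (T : Submodule k (V4 k)) (τ : Set (Submodule k (V4 k))) : Submodule k (V4 k) :=
  sInf (τ \ {T})

/-- Two sets `A`, `B` and a relation form an abstract configuration of type `(a_c, b_d)`. -/
def IsConfiguration {α β : Type*} (A : Set α) (B : Set β) (R : α → β → Prop) (a c b d : ℕ) :
    Prop :=
  A.ncard = a ∧ B.ncard = b ∧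
    (∀ x ∈ A, {y ∈ B | R x y}.ncard = c) ∧ (∀ y ∈ B, {x ∈ A | R x y}.ncard = d)

open MvPolynomial

section Derivatives

variable {σ R : Type*} [CommRing R]

/-- The directional derivative `∑ i, u i * ∂ i` of polynomials along the vector `u`. -/
noncomputable def dirDeriv :
    (σ → R) →ₗ[R] Derivation R (MvPolynomial σ R) (MvPolynomial σ R) :=
  (mkDerivationEquiv R).toLinearMap ∘ₗ (Algebra.linearMap R (MvPolynomial σ R)).compLeft σ

@[simp]
theorem dirDeriv_X (u : σ → R) (i : σ) : dirDeriv u (X i) = C (u i) :=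
  mkDerivation_X R _ i

theorem dirDeriv_toMvPolynomial {ι : Type*} [Fintype σ] (M : Matrix ι σ R) (u : σ → R) (i : ι) :
    dirDeriv u (M.toMvPolynomial i) = C ((M.mulVec u) i) := by
  simp [Matrix.toMvPolynomial, ← C_mul_X_eq_monomial, Matrix.mulVec, dotProduct]

theorem dirDeriv_single [DecidableEq σ] (i : σ) : dirDeriv (Pi.single i (1 : R)) = pderiv i :=
  derivation_ext fun j => by simp [pderiv_X, Pi.single_apply, apply_ite C]

theorem dirDeriv_comm (u u' : σ → R) (g : MvPolynomial σ R) :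
    dirDeriv u (dirDeriv u' g) = dirDeriv u' (dirDeriv u g) := by
  have h : ⁅dirDeriv u, dirDeriv u'⁆ = 0 :=
    derivation_ext fun i => by simp [Derivation.commutator_apply]
  exact sub_eq_zero.1 (DFunLike.congr_fun h g)

theorem dirDeriv_apply [Fintype σ] (u : σ → R) (g : MvPolynomial σ R) :
    dirDeriv u g = ∑ i, u i • pderiv i g := by
  classical
  induction g using MvPolynomial.induction_on with
  | C a => simp
  | add p q hp hq => simp [hp, hq, Finset.sum_add_distrib]
  | mul_X p i hp =>
    simp [hp, pderiv_X, Pi.single_apply, Finset.sum_add_distrib, Finset.mul_sum, smul_eq_C_mul,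
      mul_comm, mul_left_comm]

theorem isHomogeneous_dirDeriv [Finite σ] {g : MvPolynomial σ R} {d : ℕ} (hg : g.IsHomogeneous d)
    (u : σ → R) : (dirDeriv u g).IsHomogeneous (d - 1) := by
  cases nonempty_fintype σ
  rw [dirDeriv_apply]
  exact IsHomogeneous.sum _ _ _ fun i _ => by
    rw [smul_eq_C_mul]
    exact hg.pderiv.C_mul _

theorem eval_dirDeriv_self [Finite σ] {g : MvPolynomial σ R} {d : ℕ} (hg : g.IsHomogeneous d)
    (v : σ → R) : eval v (dirDeriv v g) = d * eval v g := by
  cases nonempty_fintype σ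
  simpa [dirDeriv_apply] using congrArg (eval v) hg.sum_X_mul_pderiv

theorem forall_eval_dirDeriv_eq_zero_iff [Finite σ] (g : MvPolynomial σ R) (v : σ → R) :
    (∀ u, eval v (dirDeriv u g) = 0) ↔ ∀ i, eval v (pderiv i g) = 0 := by
  classical
  cases nonempty_fintype σ
  refine ⟨fun h i => ?_, fun h u => by simp [dirDeriv_apply, h]⟩
  rw [← dirDeriv_single]
  exact h _

theorem eval_smul_of_isHomogeneous {g : MvPolynomial σ R} {d : ℕ} (hg : g.IsHomogeneous d)
    (c : R) (v : σ → R) : eval (c • v) g = c ^ d * eval v g := by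
  rw [eval_eq, eval_eq, Finset.mul_sum]
  refine Finset.sum_congr rfl fun m hm => ?_
  simp only [Pi.smul_apply, smul_eq_mul, mul_pow, Finset.prod_mul_distrib,
    Finset.prod_pow_eq_pow_sum, ← hg.degree_eq_sum_deg_support hm]
  ring

/-- The surface `g = 0` is singular at `v`: `g` and its differential vanish there. -/
def IsSingularAt (g : MvPolynomial σ R) (v : σ → R) : Prop :=
  eval v g = 0 ∧ ∀ u, eval v (dirDeriv u g) = 0

/-- The vector `v` represents a node of `g = 0`: the kernel of the Hessian form of `g` at the
singular point `v` is spanned by `v`. -/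
def IsNodeAt (g : MvPolynomial σ R) (v : σ → R) : Prop :=
  IsSingularAt g v ∧
    ∀ u, (∀ u', eval v (dirDeriv u' (dirDeriv u g)) = 0) → u ∈ Submodule.span R {v}

end Derivatives

section Points

theorem exists_rep_mk_eq_smul (v : V4 k) (hv : v ≠ 0) :
    ∃ a : k, a ≠ 0 ∧ (Projectivization.mk k v hv).rep = a • v := by
  obtain ⟨a, ha⟩ := Projectivization.exists_smul_eq_mk_rep k v hv
  exact ⟨a, a.ne_zero, ha.symm⟩

theorem mk_mem_pts {W : Submodule k (V4 k)} {v : V4 k} (hv : v ≠ 0) :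
    Projectivization.mk k v hv ∈ pts W ↔ v ∈ W := by
  simp [pts, Projectivization.submodule_mk]

theorem mk_mem_zeroLocus {g : Form k} {d : ℕ} (hg : g.IsHomogeneous d) {v : V4 k} (hv : v ≠ 0) :
    Projectivization.mk k v hv ∈ zeroLocus g ↔ eval v g = 0 := by
  obtain ⟨a, ha, h⟩ := exists_rep_mk_eq_smul v hv
  simp [zeroLocus, h, eval_smul_of_isHomogeneous hg, ha]

theorem mk_mem_singularPoints {g : Form k} {d : ℕ} (hg : g.IsHomogeneous d) {v : V4 k}
    (hv : v ≠ 0) : Projectivization.mk k v hv ∈ singularPoints g ↔ IsSingularAt g v := by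
  obtain ⟨a, ha, h⟩ := exists_rep_mk_eq_smul v hv
  simp [singularPoints, IsSingularAt, forall_eval_dirDeriv_eq_zero_iff, h,
    eval_smul_of_isHomogeneous hg, fun i => eval_smul_of_isHomogeneous (hg.pderiv (i := i)), ha]

theorem pts_subset_pts {W W' : Submodule k (V4 k)} : pts W ⊆ pts W' ↔ W ≤ W' := by
  refine ⟨fun h v hv => ?_, fun h p hp => le_trans hp h⟩
  by_cases h0 : v = 0
  · simp [h0]
  · exact (mk_mem_pts h0).1 (h ((mk_mem_pts h0).2 hv))

theorem pts_subset_zeroLocus {W : Submodule k (V4 k)} {g : Form k} {d : ℕ}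
    (hg : g.IsHomogeneous d) (h : ∀ v ∈ W, eval v g = 0) : pts W ⊆ zeroLocus g := by
  intro p hp
  induction p using Projectivization.ind with
  | h v hv => exact (mk_mem_zeroLocus hg hv).2 (h v ((mk_mem_pts hv).1 hp))

/-- The matrix of second partial derivatives of `g` at the vector `v`. -/
noncomputable def hessian (g : Form k) (v : V4 k) : Matrix (Fin 4) (Fin 4) k :=
  Matrix.of fun i j => eval v (pderiv i (pderiv j g))

theorem rank_hessianAt_mk {g : Form k} {d : ℕ} (hg : g.IsHomogeneous d) {v : V4 k}
    (hv : v ≠ 0) : (hessianAt g (Projectivization.mk k v hv)).rank = (hessian g v).rank := by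
  obtain ⟨a, ha, h⟩ := exists_rep_mk_eq_smul v hv
  have : hessianAt g (Projectivization.mk k v hv) = a ^ (d - 1 - 1) • hessian g v := by
    ext i j
    simp [hessianAt, hessian, h, eval_smul_of_isHomogeneous ((hg.pderiv (i := j)).pderiv (i := i))]
  rw [this, Matrix.rank_smul_of_mem_nonZeroDivisors]
  simpa using pow_ne_zero _ ha

theorem mem_ker_hessian (g : Form k) (v u : V4 k) :
    u ∈ LinearMap.ker (hessian g v).mulVecLin ↔
      ∀ u', eval v (dirDeriv u' (dirDeriv u g)) = 0 := by
  rw [forall_eval_dirDeriv_eq_zero_iff, LinearMap.mem_ker, Matrix.mulVecLin_apply, funext_iff]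
  refine forall_congr' fun i => ?_
  simp [hessian, Matrix.mulVec, dotProduct, dirDeriv_apply, smul_eval, mul_comm]

/-- By Euler's identity the vector itself lies in the kernel of the Hessian. -/
theorem IsSingularAt.mem_ker_hessian {g : Form k} {d : ℕ} (hg : g.IsHomogeneous d) {v : V4 k}
    (h : IsSingularAt g v) : v ∈ LinearMap.ker (hessian g v).mulVecLin :=
  (CremonaQuartic.mem_ker_hessian g v v).2 fun u => by
    rw [dirDeriv_comm, eval_dirDeriv_self (isHomogeneous_dirDeriv hg u), h.2, mul_zero]

theorem isNode_mk {g : Form k} {d : ℕ} (hg : g.IsHomogeneous d) {v : V4 k} (hv : v ≠ 0) :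
    IsNode g (Projectivization.mk k v hv) ↔ IsNodeAt g v := by
  rw [IsNode, mk_mem_singularPoints hg, rank_hessianAt_mk hg, IsNodeAt]
  refine and_congr_right fun h => ?_
  have hrank := (hessian g v).mulVecLin.finrank_range_add_finrank_ker
  rw [Module.finrank_fin_fun] at hrank
  have hspan : k ∙ v ≤ LinearMap.ker (hessian g v).mulVecLin :=
    (Submodule.span_singleton_le_iff_mem _ _).2 (h.mem_ker_hessian hg)
  simp only [← mem_ker_hessian]
  change _ ↔ LinearMap.ker (hessian g v).mulVecLin ≤ k ∙ v
  rw [Matrix.rank]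
  constructor
  · intro h3
    rw [h3] at hrank
    refine (Submodule.eq_of_le_of_finrank_eq hspan ?_).ge
    rw [finrank_span_singleton hv]
    exact (Nat.add_left_cancel hrank).symm
  · intro hle
    rw [le_antisymm hle hspan, finrank_span_singleton hv] at hrank
    omega

end Points

section Pullback

variable {σ R : Type*} [CommRing R] [Fintype σ] [DecidableEq σ]

/-- Composition of polynomial functions with the linear map `φ`. -/
noncomputable def pullback (φ : (σ → R) →ₗ[R] (σ → R)) : MvPolynomial σ R →ₐ[R] MvPolynomial σ R :=
  aeval φ.toMatrix'.toMvPolynomial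

theorem eval_pullback (φ : (σ → R) →ₗ[R] (σ → R)) (g : MvPolynomial σ R) (v : σ → R) :
    eval v (pullback φ g) = eval (φ v) g := by
  have h : (aeval v).comp (pullback φ) = aeval (φ v) := algHom_ext fun i => by
    simp [pullback, aeval_eq_eval, Matrix.toMvPolynomial_eval_eq_apply]
  exact DFunLike.congr_fun h g

theorem isHomogeneous_pullback (φ : (σ → R) →ₗ[R] (σ → R)) {g : MvPolynomial σ R} {d : ℕ}
    (hg : g.IsHomogeneous d) : (pullback φ g).IsHomogeneous d := by
  simpa [pullback] using hg.aeval _ fun i => Matrix.toMvPolynomial_isHomogeneous φ.toMatrix' i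

theorem dirDeriv_pullback (φ : (σ → R) →ₗ[R] (σ → R)) (u : σ → R) (g : MvPolynomial σ R) :
    dirDeriv u (pullback φ g) = pullback φ (dirDeriv (φ u) g) := by
  induction g using MvPolynomial.induction_on with
  | C a => simp [pullback]
  | add p q hp hq => simp [hp, hq]
  | mul_X p i hp =>
    have hX : dirDeriv u (pullback φ (X i)) = pullback φ (dirDeriv (φ u) (X i)) := by
      simp [pullback, dirDeriv_toMvPolynomial]
    simp only [map_mul, Derivation.leibniz, map_add, smul_eq_mul, hp, hX]

variable (φ : (σ → R) ≃ₗ[R] (σ → R))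

theorem isSingularAt_pullback_iff {g : MvPolynomial σ R} {v : σ → R} :
    IsSingularAt (pullback φ g) v ↔ IsSingularAt g (φ v) := by
  simp only [IsSingularAt, dirDeriv_pullback, eval_pullback]
  refine and_congr_right' ?_
  conv_rhs => rw [φ.surjective.forall]
  rfl

theorem isNodeAt_pullback_iff {g : MvPolynomial σ R} {v : σ → R} :
    IsNodeAt (pullback φ g) v ↔ IsNodeAt g (φ v) := by
  have hspan (u : σ → R) : u ∈ Submodule.span R {v} ↔ φ u ∈ Submodule.span R {φ v} := by
    simp only [Submodule.mem_span_singleton, ← map_smul, φ.injective.eq_iff]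
  simp only [IsNodeAt, isSingularAt_pullback_iff, dirDeriv_pullback, eval_pullback, hspan,
    LinearEquiv.coe_coe]
  refine and_congr_right' ?_
  conv_rhs =>
    rw [φ.surjective.forall]
    enter [u, 1]
    rw [φ.surjective.forall]

end Pullback

section Transport

theorem pullback_pullback {σ R : Type*} [CommRing R] [Fintype σ] [DecidableEq σ]
    (φ ψ : (σ → R) →ₗ[R] (σ → R)) (g : MvPolynomial σ R) :
    pullback ψ (pullback φ g) = pullback (φ ∘ₗ ψ) g := by
  refine DFunLike.congr_fun (f := (pullback ψ).comp (pullback φ)) (algHom_ext fun i => ?_) g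
  simp [pullback, LinearMap.toMatrix'_comp, Matrix.toMvPolynomial_mul]

theorem pullback_id {σ R : Type*} [CommRing R] [Fintype σ] [DecidableEq σ]
    (g : MvPolynomial σ R) : pullback LinearMap.id g = g :=
  DFunLike.congr_fun (g := AlgHom.id R _) (algHom_ext fun i => by simp [pullback]) g

variable (φ : V4 k ≃ₗ[k] V4 k)

theorem pullback_symm_pullback (g : Form k) :
    pullback (φ.symm : V4 k →ₗ[k] V4 k) (pullback φ g) = g := by
  simp [pullback_pullback, pullback_id]

theorem pullback_pullback_symm (g : Form k) :
    pullback (φ : V4 k →ₗ[k] V4 k) (pullback φ.symm g) = g :=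
  pullback_symm_pullback φ.symm g

theorem irreducible_pullback {g : Form k} (hg : Irreducible g) : Irreducible (pullback φ g) :=
  (MulEquiv.irreducible_iff (AlgEquiv.ofAlgHom (pullback (φ : V4 k →ₗ[k] V4 k))
    (pullback φ.symm) (AlgHom.ext (pullback_pullback_symm φ))
    (AlgHom.ext (pullback_symm_pullback φ)))).2 hg

/-- The preimage of a linear subspace under a linear automorphism. -/
abbrev preimage : Submodule k (V4 k) → Submodule k (V4 k) :=
  Submodule.comap φ.toLinearMap

theorem zeroLocus_pullback {g : Form k} {d : ℕ} (hg : g.IsHomogeneous d) :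
    zeroLocus (pullback φ g) = (φ • ·) ⁻¹' zeroLocus g := by
  ext p
  induction p using Projectivization.ind with
  | h v hv =>
    rw [mk_mem_zeroLocus (isHomogeneous_pullback _ hg), Set.mem_preimage,
      Projectivization.smul_mk, mk_mem_zeroLocus hg, eval_pullback]
    rfl

theorem pts_preimage (W : Submodule k (V4 k)) :
    pts (preimage φ W) = (φ • ·) ⁻¹' pts W := by
  ext p
  induction p using Projectivization.ind with
  | h v hv => rw [mk_mem_pts, Set.mem_preimage, Projectivization.smul_mk, mk_mem_pts]; rfl

theorem singularPoints_pullback {g : Form k} {d : ℕ} (hg : g.IsHomogeneous d) :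
    singularPoints (pullback φ g) = (φ • ·) ⁻¹' singularPoints g := by
  ext p
  induction p using Projectivization.ind with
  | h v hv =>
    rw [mk_mem_singularPoints (isHomogeneous_pullback _ hg), Set.mem_preimage,
      Projectivization.smul_mk, mk_mem_singularPoints hg, isSingularAt_pullback_iff]
    rfl

theorem isNode_pullback {g : Form k} {d : ℕ} (hg : g.IsHomogeneous d) (p : P3 k) :
    IsNode (pullback φ g) p ↔ IsNode g (φ • p) := by
  induction p using Projectivization.ind with
  | h v hv =>
    rw [isNode_mk (isHomogeneous_pullback _ hg), Projectivization.smul_mk, isNode_mk hg,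
      isNodeAt_pullback_iff]
    rfl

theorem preimage_injective : Function.Injective (preimage φ) :=
  Submodule.comap_injective_of_surjective φ.surjective

theorem preimage_symm_preimage (W : Submodule k (V4 k)) :
    preimage φ.symm (preimage φ W) = W := by
  ext v
  simp

theorem finrank_preimage (W : Submodule k (V4 k)) :
    Module.finrank k (preimage φ W) = Module.finrank k W :=
  (φ.ofSubmodule' W).finrank_eq

theorem IsEquationOf.pullback {a : Form k} {W : Submodule k (V4 k)} (h : IsEquationOf a W) :
    IsEquationOf (pullback φ a) (preimage φ W) :=
  ⟨isHomogeneous_pullback _ h.1, by rw [zeroLocus_pullback φ h.1, h.2, pts_preimage]⟩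

theorem IsTritangentPlane.pullback {f : Form k} (hf : f.IsHomogeneous 3)
    {T : Submodule k (V4 k)} (h : IsTritangentPlane f T) :
    IsTritangentPlane (pullback φ f) (preimage φ T) := by
  obtain ⟨l, hT, hl, hinj, hcut⟩ := h
  refine ⟨fun i => preimage φ (l i), by rw [finrank_preimage, hT],
    fun i => by rw [finrank_preimage, hl], (preimage_injective φ).comp hinj, ?_⟩
  rw [zeroLocus_pullback φ hf, pts_preimage, ← Set.preimage_inter, hcut, Set.preimage_iUnion]
  exact Set.iUnion_congr fun i => (pts_preimage φ (l i)).symm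

theorem IsConjugateTriad.pullback {f : Form k} (hf : f.IsHomogeneous 3)
    {τ : Set (Submodule k (V4 k))} (h : IsConjugateTriad f τ) :
    IsConjugateTriad (pullback φ f) (preimage φ '' τ) := by
  obtain ⟨A, B, rfl, hA, hB, hline, hinj⟩ := h
  refine ⟨fun i => preimage φ (A i), fun i => preimage φ (B i), (Set.range_comp _ _).symm,
    fun i => (hA i).pullback φ hf, fun i => (hB i).pullback φ hf, fun i j => ?_, ?_⟩
  · rw [← Submodule.comap_inf, finrank_preimage, pts_preimage, zeroLocus_pullback φ hf]
    exact ⟨(hline i j).1, Set.preimage_mono (hline i j).2⟩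
  · exact (preimage_injective φ).comp hinj

theorem triadsThrough_pullback {f : Form k} (hf : f.IsHomogeneous 3) (T : Submodule k (V4 k)) :
    triadsThrough (pullback φ f) (preimage φ T) =
      Set.image (preimage φ) '' triadsThrough f T := by
  ext τ
  constructor
  · rintro ⟨hτ, hT⟩
    have h := hτ.pullback φ.symm (isHomogeneous_pullback _ hf)
    rw [pullback_symm_pullback] at h
    refine ⟨_, ⟨h, _, hT, preimage_symm_preimage φ T⟩, ?_⟩
    rw [Set.image_image]
    exact (Set.image_congr fun W _ => preimage_symm_preimage φ.symm W).trans (Set.image_id' τ)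
  · rintro ⟨τ, ⟨hτ, hT⟩, rfl⟩
    exact ⟨hτ.pullback φ hf, _, hT, rfl⟩

theorem triadLine_preimage (T : Submodule k (V4 k)) (τ : Set (Submodule k (V4 k))) :
    triadLine (preimage φ T) (preimage φ '' τ) =
      preimage φ (triadLine T τ) := by
  rw [triadLine, triadLine, ← Set.image_singleton, ← Set.image_sdiff (preimage_injective φ)]
  ext v
  simp only [Submodule.mem_sInf, Submodule.mem_comap, Set.forall_mem_image]

theorem image_triadLine_pullback {f : Form k} (hf : f.IsHomogeneous 3)
    (T : Submodule k (V4 k)) :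
    triadLine (preimage φ T) ''
        triadsThrough (pullback φ f) (preimage φ T) =
      preimage φ '' (triadLine T '' triadsThrough f T) := by
  rw [triadsThrough_pullback φ hf, Set.image_image, Set.image_image]
  exact Set.image_congr fun τ _ => triadLine_preimage φ T τ

theorem CutsOutResidualConics.pullback {f : Form k} {T : Submodule k (V4 k)}
    {l P : Fin 3 → Submodule k (V4 k)} {Q : Form k} (h : CutsOutResidualConics f T l P Q) :
    CutsOutResidualConics (pullback φ f) (preimage φ T)
      (fun i => preimage φ (l i)) (fun i => preimage φ (P i))
      (pullback φ Q) := by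
  obtain ⟨hP, hQ, w, π, hw, hπ, hspan⟩ := h
  refine ⟨fun i => ⟨by rw [finrank_preimage, (hP i).1], Submodule.comap_mono (hP i).2.1,
    (preimage_injective φ).ne (hP i).2.2⟩, isHomogeneous_pullback _ hQ, _, _, hw.pullback φ,
    fun i => (hπ i).pullback φ, ?_⟩
  simpa [Ideal.map_span, Set.image_pair] using
    congrArg (Ideal.map (CremonaQuartic.pullback (φ : V4 k →ₗ[k] V4 k))) hspan

theorem zariskiClosure_preimage_subset (S : Set (P3 k)) :
    zariskiClosure ((φ • ·) ⁻¹' S) ⊆ (φ • ·) ⁻¹' zariskiClosure S := by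
  intro p hp d g hg hS
  have h := hp d _ (isHomogeneous_pullback φ.toLinearMap hg)
    (by rw [zeroLocus_pullback φ hg]; exact Set.preimage_mono hS)
  rwa [zeroLocus_pullback φ hg] at h

theorem zariskiClosure_preimage (S : Set (P3 k)) :
    zariskiClosure ((φ • ·) ⁻¹' S) = (φ • ·) ⁻¹' zariskiClosure S := by
  refine (zariskiClosure_preimage_subset φ S).antisymm fun p hp => ?_
  have hS : S = (φ.symm • ·) ⁻¹' ((φ • ·) ⁻¹' S) := by
    ext q
    exact (congrArg (· ∈ S) (smul_inv_smul φ q)).symm.to_iff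
  rw [Set.mem_preimage, hS] at hp
  have h := zariskiClosure_preimage_subset φ.symm _ hp
  exact (congrArg (· ∈ zariskiClosure ((φ • ·) ⁻¹' S)) (inv_smul_smul φ p)).to_iff.1 h

theorem steinerian_pullback (f : Form k) (T : Submodule k (V4 k))
    (l : Fin 3 → Submodule k (V4 k)) :
    steinerian (pullback φ f) (preimage φ T)
        (fun i => preimage φ (l i)) =
      (φ • ·) ⁻¹' steinerian f T l := by
  rw [steinerian, steinerian, ← zariskiClosure_preimage]
  congr 1
  ext p
  constructor
  · rintro ⟨P, Q, h, hp⟩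
    have h' := h.pullback φ.symm
    simp only [pullback_symm_pullback, preimage_symm_preimage] at h'
    refine ⟨_, _, h', ?_⟩
    rw [← Set.mem_preimage (f := (φ • ·)), ← singularPoints_pullback φ h'.2.1,
      pullback_pullback_symm]
    exact hp
  · rintro ⟨P, Q, h, hp⟩
    refine ⟨_, _, h.pullback φ, ?_⟩
    rwa [singularPoints_pullback φ h.2.1]

theorem IsSmoothCubic.pullback {f : Form k} (hf : IsSmoothCubic f) :
    IsSmoothCubic (pullback φ f) :=
  ⟨isHomogeneous_pullback _ hf.1, by rw [singularPoints_pullback φ hf.1, hf.2, Set.preimage_empty]⟩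

end Transport

section NodalQuartic

theorem ncard_sep_image {α β : Type*} {S : Set α} {u : α → β} (hu : Set.InjOn u S)
    {P : α → Prop} {P' : β → Prop} (h : ∀ x ∈ S, P' (u x) ↔ P x) :
    {y ∈ u '' S | P' y}.ncard = {x ∈ S | P x}.ncard := by
  rw [← (hu.mono (Set.sep_subset _ _)).ncard_image]
  congr 1
  ext y
  constructor
  · rintro ⟨⟨x, hx, rfl⟩, hy⟩
    exact ⟨x, ⟨hx, (h x hx).1 hy⟩, rfl⟩
  · rintro ⟨x, ⟨hx, hP⟩, rfl⟩
    exact ⟨⟨x, hx, rfl⟩, (h x hx).2 hP⟩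

theorem IsConfiguration.image {α β α' β' : Type*} {A : Set α} {B : Set β}
    {R : α → β → Prop} {R' : α' → β' → Prop} {u : α → α'} {v : β → β'}
    (hu : Set.InjOn u A) (hv : Set.InjOn v B) (hR : ∀ x ∈ A, ∀ y ∈ B, R' (u x) (v y) ↔ R x y)
    {a c b d : ℕ} (h : IsConfiguration A B R a c b d) :
    IsConfiguration (u '' A) (v '' B) R' a c b d := by
  obtain ⟨hA, hB, hAB, hBA⟩ := h
  refine ⟨by rw [hu.ncard_image, hA], by rw [hv.ncard_image, hB], ?_, ?_⟩
  · rintro _ ⟨x, hx, rfl⟩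
    rw [ncard_sep_image hv (hR x hx), hAB x hx]
  · rintro _ ⟨y, hy, rfl⟩
    rw [ncard_sep_image hu fun x hx => hR x hx y hy, hBA y hy]

/-- The Steinerian surface attached to `T` and the lines `l i` is the irreducible nodal quartic
`G = 0`, and its nodes form a configuration `(12₄, 16₃)` with the lines of the conjugate triads
through `T`. -/
structure IsNodalSteinerian (f : Form k) (T : Submodule k (V4 k))
    (l : Fin 3 → Submodule k (V4 k)) (G : Form k) : Prop where
  isHomogeneous : G.IsHomogeneous 4
  irreducible : Irreducible G
  steinerian_eq : steinerian f T l = zeroLocus G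
  isNode : ∀ p ∈ singularPoints G, IsNode G p
  ncard_triads : (triadsThrough f T).ncard = 16
  injOn_triadLine : Set.InjOn (triadLine T) (triadsThrough f T)
  triadLine_subset : ∀ L ∈ triadLine T '' triadsThrough f T,
    Module.finrank k L = 2 ∧ pts L ⊆ steinerian f T l
  isConfiguration : IsConfiguration (singularPoints G) (triadLine T '' triadsThrough f T)
    (fun p L => p ∈ pts L) 12 4 16 3

theorem IsNodalSteinerian.pullback (φ : V4 k ≃ₗ[k] V4 k) {f : Form k} (hf : f.IsHomogeneous 3)
    {T : Submodule k (V4 k)} {l : Fin 3 → Submodule k (V4 k)} {G : Form k}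
    (h : IsNodalSteinerian f T l G) :
    IsNodalSteinerian (pullback φ f) (preimage φ T) (fun i => preimage φ (l i))
      (pullback φ G) where
  isHomogeneous := isHomogeneous_pullback _ h.isHomogeneous
  irreducible := irreducible_pullback φ h.irreducible
  steinerian_eq := by
    rw [steinerian_pullback, h.steinerian_eq, zeroLocus_pullback φ h.isHomogeneous]
  isNode p hp := by
    rw [singularPoints_pullback φ h.isHomogeneous] at hp
    exact (isNode_pullback φ h.isHomogeneous p).2 (h.isNode _ hp)
  ncard_triads := by
    rw [triadsThrough_pullback φ hf,
      Set.ncard_image_of_injective _ (preimage_injective φ).image_injective, h.ncard_triads]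
  injOn_triadLine := by
    rw [triadsThrough_pullback φ hf]
    rintro _ ⟨τ, hτ, rfl⟩ _ ⟨τ', hτ', rfl⟩ he
    rw [triadLine_preimage, triadLine_preimage] at he
    rw [h.injOn_triadLine hτ hτ' (preimage_injective φ he)]
  triadLine_subset := by
    rw [image_triadLine_pullback φ hf]
    rintro _ ⟨L, hL, rfl⟩
    rw [finrank_preimage, pts_preimage, steinerian_pullback]
    exact ⟨(h.triadLine_subset L hL).1, Set.preimage_mono (h.triadLine_subset L hL).2⟩
  isConfiguration := by
    rw [image_triadLine_pullback φ hf, singularPoints_pullback φ h.isHomogeneous,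
      Set.preimage_smul, ← Set.image_smul]
    refine h.isConfiguration.image (MulAction.injective _).injOn (preimage_injective φ).injOn
      fun p _ L _ => ?_
    rw [pts_preimage, Set.mem_preimage, smul_inv_smul]

end NodalQuartic

section QuarticExpr

variable {R : Type*} [CommRing R]

/-- Cremona's quartic as an expression in the coordinates `x` of a point and the coordinates `p` of
its polar plane with respect to the quadric part of the cubic. -/
def quarticExpr (x p : Fin 4 → R) : R :=
  4 * (x 3 * (p 0 * p 1 * p 2) +
      (x 0 * x 1 * (p 0 * p 1) + x 1 * x 2 * (p 1 * p 2) + x 2 * x 0 * (p 2 * p 0)) -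
      x 0 * x 1 * x 2 * p 3) - (x ⬝ᵥ p) ^ 2

/-- The coordinates of a point after the change of variables `x_i ↦ x_i + t_i x_3`, which turns
the planes of the three pencils with parameters `t_i` into coordinate planes. -/
def shift (t : Fin 3 → R) (x : Fin 4 → R) : Fin 4 → R :=
  ![x 0 + t 0 * x 3, x 1 + t 1 * x 3, x 2 + t 2 * x 3, x 3]

/-- The change of variables on dual coordinates contragredient to `shift`. -/
def coshift (t : Fin 3 → R) (p : Fin 4 → R) : Fin 4 → R :=
  ![p 0, p 1, p 2, p 3 - ∑ i, t i * p i.castSucc]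

/-- The matrix of the quadratic form `(2 ∏ (x_i + t_i x_3) - 2 x_0 x_1 x_2) / x_3`. -/
def productMatrix (t : Fin 3 → R) : Matrix (Fin 4) (Fin 4) R :=
  !![0, t 2, t 1, t 1 * t 2;
    t 2, 0, t 0, t 2 * t 0;
    t 1, t 0, 0, t 0 * t 1;
    t 1 * t 2, t 2 * t 0, t 0 * t 1, 2 * (t 0 * t 1 * t 2)]

variable (t : Fin 3 → R) (x p : Fin 4 → R) (i : Fin 3)

@[simp]
theorem shift_castSucc : shift t x i.castSucc = x i.castSucc + t i * x 3 := by
  fin_cases i <;> rfl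

@[simp]
theorem shift_three : shift t x 3 = x 3 := rfl

@[simp]
theorem coshift_castSucc : coshift t p i.castSucc = p i.castSucc := by
  fin_cases i <;> rfl

@[simp]
theorem coshift_three : coshift t p 3 = p 3 - ∑ i, t i * p i.castSucc := rfl

theorem single_castSucc_three (c : R) : (Pi.single i.castSucc c : Fin 4 → R) 3 = 0 := by
  fin_cases i <;> simp

theorem shift_shift_neg : shift t (shift (-t) x) = x := by
  ext j
  fin_cases j <;> simp [shift]

theorem fin_add_one_add_one (i : Fin 3) : i + 1 + 1 = i + 2 := by fin_cases i <;> rfl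

theorem fin_add_one_add_two (i : Fin 3) : i + 1 + 2 = i := by fin_cases i <;> rfl

theorem fin_add_two_add_one (i : Fin 3) : i + 2 + 1 = i := by fin_cases i <;> rfl

theorem fin_add_two_add_two (i : Fin 3) : i + 2 + 2 = i + 1 := by fin_cases i <;> rfl

theorem eq_add_one_or_eq_add_two {i j : Fin 3} (h : j ≠ i) : j = i + 1 ∨ j = i + 2 := by
  decide +revert

theorem sum_rotate (F : Fin 3 → R) : ∑ j, F j = F i + F (i + 1) + F (i + 2) := by
  rw [Fin.sum_univ_three]
  fin_cases i <;> simp <;> ring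

theorem prod_rotate (F : Fin 3 → R) : ∏ j, F j = F i * F (i + 1) * F (i + 2) := by
  rw [Fin.prod_univ_three]
  fin_cases i <;> simp <;> ring

theorem dotProduct_rotate : x ⬝ᵥ p =
    x i.castSucc * p i.castSucc + x (i + 1).castSucc * p (i + 1).castSucc +
      x (i + 2).castSucc * p (i + 2).castSucc + x 3 * p 3 := by
  rw [dotProduct, Fin.sum_univ_castSucc, sum_rotate i]
  rfl

theorem quarticExpr_rotate : quarticExpr x p =
    4 * (x 3 * (p i.castSucc * p (i + 1).castSucc * p (i + 2).castSucc) +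
      (x i.castSucc * x (i + 1).castSucc * (p i.castSucc * p (i + 1).castSucc) +
        x (i + 1).castSucc * x (i + 2).castSucc * (p (i + 1).castSucc * p (i + 2).castSucc) +
        x (i + 2).castSucc * x i.castSucc * (p (i + 2).castSucc * p i.castSucc)) -
      x i.castSucc * x (i + 1).castSucc * x (i + 2).castSucc * p 3) - (x ⬝ᵥ p) ^ 2 := by
  rw [quarticExpr]
  fin_cases i <;> simp <;> ring

theorem sq_mul_quarticExpr : x 3 ^ 2 * quarticExpr x p =
    4 * ∏ i : Fin 3, (x (i + 1).castSucc * x (i + 2).castSucc + x 3 * p i.castSucc) -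
      (2 * ∏ i : Fin 3, x i.castSucc + x 3 * (x ⬝ᵥ p)) ^ 2 := by
  simp [quarticExpr, dotProduct, Fin.sum_univ_four, Fin.prod_univ_three]
  ring

theorem map_quarticExpr {S : Type*} [CommRing S] (φ : R →+* S) :
    φ (quarticExpr x p) = quarticExpr (φ ∘ x) (φ ∘ p) := by
  simp [quarticExpr, dotProduct, map_ofNat φ 4]

theorem shift_dotProduct_coshift : shift t x ⬝ᵥ coshift t p = x ⬝ᵥ p := by
  simp [shift, coshift, dotProduct, Fin.sum_univ_four, Fin.sum_univ_three]
  ring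

theorem productMatrix_mulVec_castSucc : (productMatrix t).mulVec x i.castSucc =
    t (i + 1) * x (i + 2).castSucc + t (i + 2) * x (i + 1).castSucc +
      t (i + 1) * t (i + 2) * x 3 := by
  fin_cases i <;> simp [productMatrix, Matrix.mulVec, dotProduct, Fin.sum_univ_four] <;> ring

theorem quarticExpr_shift :
    quarticExpr (shift t x) (coshift t (p - (productMatrix t).mulVec x)) = quarticExpr x p := by
  rw [quarticExpr, shift_dotProduct_coshift, quarticExpr]
  simp [shift, coshift, productMatrix, dotProduct, Fin.sum_univ_four, Fin.sum_univ_three]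
  ring

theorem isSymm_productMatrix : (productMatrix t).IsSymm := by
  ext i j
  fin_cases i <;> fin_cases j <;> rfl

theorem two_mul_prod_shift : 2 * ∏ i : Fin 3, shift t x i.castSucc =
    2 * ∏ i : Fin 3, x i.castSucc + x 3 * (x ⬝ᵥ (productMatrix t).mulVec x) := by
  simp [productMatrix, Matrix.mulVec, dotProduct, Fin.sum_univ_four, Fin.prod_univ_three]
  ring

theorem shift_mul_shift : shift t x (i + 1).castSucc * shift t x (i + 2).castSucc =
    x (i + 1).castSucc * x (i + 2).castSucc +
      x 3 * (productMatrix t).mulVec x i.castSucc := by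
  simp only [shift_castSucc, productMatrix_mulVec_castSucc]
  ring

end QuarticExpr

section CubicOfMatrix

variable {R : Type*} [CommRing R] (A : Matrix (Fin 4) (Fin 4) R)

/-- The cubic `2 x_0 x_1 x_2 + x_3 q`, where `q` is the quadratic form with matrix `A`: the normal
form of a cubic surface that meets the plane `x_3 = 0` in a triangle. -/
noncomputable def cubic : MvPolynomial (Fin 4) R :=
  2 * ∏ i : Fin 3, X i.castSucc + X 3 * (X ⬝ᵥ A.toMvPolynomial)

/-- The equation of the Steinerian surface attached to the plane `x_3 = 0` and `cubic A`. -/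
noncomputable def quartic : MvPolynomial (Fin 4) R :=
  quarticExpr X A.toMvPolynomial

/-- The polar plane of `v` with respect to the quadric of Cremona's family with parameters `t`,
in the coordinates given by `shift t`. -/
def polar (t : Fin 3 → R) (v : Fin 4 → R) : Fin 4 → R :=
  coshift t ((A - productMatrix t).mulVec v)

/-- Half of the partial derivative of `cubic A` with respect to `x_i`. -/
def halfPartial (v : Fin 4 → R) (i : Fin 3) : R :=
  v (i + 1).castSucc * v (i + 2).castSucc + v 3 * A.mulVec v i.castSucc

variable {A} (t : Fin 3 → R) (v u u' : Fin 4 → R) (i : Fin 3)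

theorem toMvPolynomial_eq_map_mulVec : A.toMvPolynomial = (A.map C).mulVec X := by
  funext j
  simp [Matrix.toMvPolynomial, ← C_mul_X_eq_monomial, Matrix.mulVec, dotProduct]

theorem map_productMatrix {S : Type*} [CommRing S] (φ : R →+* S) :
    (productMatrix t).map φ = productMatrix (φ ∘ t) := by
  ext i j
  fin_cases i <;> fin_cases j <;> simp [productMatrix, map_ofNat φ 2]

/-- The linear forms `shift t`. -/
noncomputable def shiftForm : Fin 4 → MvPolynomial (Fin 4) R :=
  shift (C ∘ t) X

variable (A) in
/-- The linear forms `polar A t`. -/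
noncomputable def polarForm : Fin 4 → MvPolynomial (Fin 4) R :=
  coshift (C ∘ t) (A - productMatrix t).toMvPolynomial

theorem eval_comp_shiftForm : eval v ∘ shiftForm t = shift t v := by
  funext j
  fin_cases j <;> simp [shiftForm, shift]

theorem dirDeriv_shiftForm (j : Fin 4) : dirDeriv u (shiftForm t j) = C (shift t u j) := by
  fin_cases j <;> simp [shiftForm, shift]

theorem eval_comp_polarForm : eval v ∘ polarForm A t = polar A t v := by
  funext j
  fin_cases j <;> simp [polarForm, polar, coshift, Matrix.toMvPolynomial_eval_eq_apply]

theorem dirDeriv_polarForm (j : Fin 4) : dirDeriv u (polarForm A t j) = C (polar A t u j) := by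
  fin_cases j <;> simp [polarForm, polar, coshift, dirDeriv_toMvPolynomial]

theorem quartic_eq_quarticExpr_forms : quartic A = quarticExpr (shiftForm t) (polarForm A t) := by
  rw [quartic, ← quarticExpr_shift (C ∘ t), shiftForm, polarForm]
  congr 2
  simp only [toMvPolynomial_eq_map_mulVec, Matrix.map_sub C (map_sub C), map_productMatrix,
    Matrix.sub_mulVec]

theorem eval_quartic : eval v (quartic A) = quarticExpr (shift t v) (polar A t v) := by
  rw [quartic_eq_quarticExpr_forms t, map_quarticExpr, eval_comp_shiftForm, eval_comp_polarForm]

theorem eval_shiftForm (j : Fin 4) : eval v (shiftForm t j) = shift t v j :=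
  congrFun (eval_comp_shiftForm t v) j

theorem eval_polarForm (j : Fin 4) : eval v (polarForm A t j) = polar A t v j :=
  congrFun (eval_comp_polarForm t v) j

theorem eval_dirDeriv_quartic_of_polar_eq_zero (h : polar A t v = 0) :
    eval v (dirDeriv u (quartic A)) =
      -4 * ((∏ i : Fin 3, shift t v i.castSucc) * polar A t u 3) := by
  rw [quartic_eq_quarticExpr_forms t]
  simp [-shift_castSucc, quarticExpr, dotProduct, Fin.sum_univ_four, Derivation.leibniz,
    Derivation.leibniz_pow, dirDeriv_shiftForm, dirDeriv_polarForm, eval_shiftForm, eval_polarForm,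
    h, Fin.prod_univ_three]

theorem eval_dirDeriv_quartic_of_tangent (hx : shift t v i.castSucc = 0)
    (hp₁ : polar A t v (i + 1).castSucc = 0) (hp₂ : polar A t v (i + 2).castSucc = 0)
    (hp₃ : v 3 * polar A t v 3 = 0) :
    eval v (dirDeriv u (quartic A)) = -4 * (shift t u i.castSucc *
      (shift t v (i + 1).castSucc * shift t v (i + 2).castSucc * polar A t v 3)) := by
  rw [quartic_eq_quarticExpr_forms t, quarticExpr_rotate _ _ i, dotProduct_rotate _ _ i]
  simp [-shift_castSucc, Derivation.leibniz, Derivation.leibniz_pow, dirDeriv_shiftForm,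
    dirDeriv_polarForm, eval_shiftForm, eval_polarForm, hx, hp₁, hp₂, hp₃]
  ring

theorem halfPartial_eq : halfPartial A v i =
    shift t v (i + 1).castSucc * shift t v (i + 2).castSucc + v 3 * polar A t v i.castSucc := by
  rw [shift_mul_shift, polar, coshift_castSucc, Matrix.sub_mulVec, Pi.sub_apply, halfPartial]
  ring

theorem shift_dotProduct_polar_comm (hA : A.IsSymm) :
    shift t v ⬝ᵥ polar A t u = shift t u ⬝ᵥ polar A t v := by
  have hsymm : (A - productMatrix t).IsSymm := hA.sub (isSymm_productMatrix t)
  rw [polar, polar, shift_dotProduct_coshift, shift_dotProduct_coshift, Matrix.dotProduct_mulVec,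
    ← Matrix.mulVec_transpose, hsymm.eq, dotProduct_comm]

theorem polar_eq_of_forall (hA : A.IsSymm) {p : Fin 4 → R}
    (h : ∀ u, shift t v ⬝ᵥ polar A t u = shift t u ⬝ᵥ p) : polar A t v = p :=
  dotProduct_eq _ _ fun x => by
    have hx := h (shift (-t) x)
    rw [shift_dotProduct_polar_comm t v _ hA, shift_shift_neg] at hx
    rw [dotProduct_comm, hx, dotProduct_comm]

theorem eval_dirDeriv_dirDeriv_quartic_of_vertex (hA : A.IsSymm) (hx : shift t v i.castSucc = 0)
    (hp₁ : polar A t v (i + 1).castSucc = 0) (hp₂ : polar A t v (i + 2).castSucc = 0)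
    (hp₃ : polar A t v 3 = 0) :
    eval v (dirDeriv u' (dirDeriv u (quartic A))) = 4 * halfPartial A v i *
      (polar A t u (i + 1).castSucc * polar A t u' (i + 2).castSucc +
        polar A t u (i + 2).castSucc * polar A t u' (i + 1).castSucc -
        shift t u i.castSucc * polar A t u' 3 - shift t u' i.castSucc * polar A t u 3) := by
  have hsymm (u) := shift_dotProduct_polar_comm t v u hA
  simp only [dotProduct_rotate _ _ i, shift_three, hx, hp₁, hp₂, hp₃] at hsymm
  rw [halfPartial_eq t]
  rw [quartic_eq_quarticExpr_forms t, quarticExpr_rotate _ _ i, dotProduct_rotate _ _ i]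
  simp [-shift_castSucc, Derivation.leibniz, Derivation.leibniz_pow, dirDeriv_shiftForm,
    dirDeriv_polarForm, eval_shiftForm, eval_polarForm, hx, hp₁, hp₂, hp₃]
  linear_combination
    (-2 * (shift t v (i + 1).castSucc * polar A t u' (i + 1).castSucc +
      shift t v (i + 2).castSucc * polar A t u' (i + 2).castSucc + v 3 * polar A t u' 3 -
      shift t u' i.castSucc * polar A t v i.castSucc)) * hsymm u

theorem cubic_eq_forms : cubic A = 2 * ∏ i : Fin 3, shiftForm t i.castSucc +
    X 3 * (shiftForm t ⬝ᵥ polarForm A t) := by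
  rw [shiftForm, polarForm, shift_dotProduct_coshift, two_mul_prod_shift, cubic, add_assoc,
    ← mul_add, ← dotProduct_add, ← map_productMatrix]
  simp only [toMvPolynomial_eq_map_mulVec, Matrix.map_sub C (map_sub C), Matrix.sub_mulVec,
    add_sub_cancel]

theorem eval_cubic : eval v (cubic A) = 2 * ∏ i : Fin 3, shift t v i.castSucc +
    v 3 * (shift t v ⬝ᵥ polar A t v) := by
  rw [cubic_eq_forms t]
  simp [-shift_castSucc, eval_shiftForm, eval_polarForm, dotProduct, map_ofNat]

theorem eval_dirDeriv_cubic (hA : A.IsSymm) : eval v (dirDeriv u (cubic A)) =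
    2 * ∑ i : Fin 3, shift t u i.castSucc * halfPartial A v i +
      u 3 * (shift t v ⬝ᵥ polar A t v + 2 * (v 3 * polar A t v 3)) := by
  have hsymm := shift_dotProduct_polar_comm t v u hA
  have h2 : dirDeriv u (2 : MvPolynomial (Fin 4) R) = 0 := (dirDeriv u).map_natCast 2
  simp only [dotProduct, Fin.sum_univ_four, shift_three] at hsymm ⊢
  simp only [halfPartial_eq t]
  rw [cubic_eq_forms t]
  simp [-shift_castSucc, h2, Derivation.leibniz, dirDeriv_shiftForm, dirDeriv_polarForm,
    eval_shiftForm, eval_polarForm, Fin.prod_univ_three, Fin.sum_univ_three, dotProduct,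
    Fin.sum_univ_four]
  linear_combination v 3 * hsymm

/-- The quadratic forms with values `halfPartial A`. -/
noncomputable def halfPartialForm (A : Matrix (Fin 4) (Fin 4) R) (i : Fin 3) :
    MvPolynomial (Fin 4) R :=
  X (i + 1).castSucc * X (i + 2).castSucc + X 3 * A.toMvPolynomial i.castSucc

theorem eval_halfPartialForm : eval v (halfPartialForm A i) = halfPartial A v i := by
  simp [halfPartialForm, halfPartial, Matrix.toMvPolynomial_eval_eq_apply]

theorem X_sq_mul_quartic :
    X 3 ^ 2 * quartic A = 4 * ∏ i, halfPartialForm A i - cubic A ^ 2 :=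
  sq_mul_quarticExpr _ _

theorem sq_mul_eval_quartic :
    v 3 ^ 2 * eval v (quartic A) = 4 * ∏ i, halfPartial A v i - eval v (cubic A) ^ 2 := by
  simpa [eval_halfPartialForm, map_ofNat] using congrArg (eval v) (X_sq_mul_quartic (A := A))

end CubicOfMatrix

section SmoothMatrix

/-- The matrix `A` is symmetric and the cubic surface `cubic A = 0` is smooth. -/
structure IsSmoothMatrix (A : Matrix (Fin 4) (Fin 4) k) : Prop where
  isSymm : A.IsSymm
  eq_zero_of_isSingularAt : ∀ v, IsSingularAt (cubic A) v → v = 0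

theorem eq_zero_of_castSucc {p : Fin 4 → k} (h : ∀ i : Fin 3, p i.castSucc = 0) (h3 : p 3 = 0) :
    p = 0 :=
  funext (Fin.lastCases h3 h)

theorem forall_of_rotate {P : Fin 3 → Prop} (i : Fin 3) (h₀ : P i) (h₁ : P (i + 1))
    (h₂ : P (i + 2)) (j : Fin 3) : P j := by
  fin_cases i <;> fin_cases j <;> assumption

theorem dotProduct_eq_sum_castSucc (x p : Fin 4 → k) :
    x ⬝ᵥ p = ∑ i : Fin 3, x i.castSucc * p i.castSucc + x 3 * p 3 :=
  Fin.sum_univ_castSucc _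

variable {A : Matrix (Fin 4) (Fin 4) k} {t : Fin 3 → k} {v : Fin 4 → k}

theorem polar_castSucc (i : Fin 3) : polar A t v i.castSucc = A.mulVec v i.castSucc -
    (t (i + 1) * v (i + 2).castSucc + t (i + 2) * v (i + 1).castSucc +
      t (i + 1) * t (i + 2) * v 3) := by
  rw [polar, coshift_castSucc, Matrix.sub_mulVec, Pi.sub_apply, productMatrix_mulVec_castSucc]

theorem polar_eq_zero_iff : polar A t v = 0 ↔ (A - productMatrix t).mulVec v = 0 := by
  refine ⟨fun h => ?_, fun h => ?_⟩
  · have hi (i : Fin 3) : (A - productMatrix t).mulVec v i.castSucc = 0 := by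
      simpa using (coshift_castSucc t _ i).symm.trans (congrFun h _)
    have h3 := congrFun h 3
    rw [polar, coshift_three, Finset.sum_eq_zero fun i _ => by rw [hi, mul_zero], sub_zero] at h3
    exact eq_zero_of_castSucc hi h3
  · rw [polar, h]
    exact eq_zero_of_castSucc (fun i => by simp) (by simp)

theorem four_ne_zero' [NeZero (2 : k)] : (4 : k) ≠ 0 := by
  rw [← two_add_two_eq_four, ← two_mul]
  exact mul_ne_zero two_ne_zero two_ne_zero

namespace IsSmoothMatrix

variable [NeZero (2 : k)] (hA : IsSmoothMatrix A)

include hA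

theorem eq_zero (hf : eval v (cubic A) = 0) (hp : ∀ i, halfPartial A v i = 0)
    (hq : shift t v ⬝ᵥ polar A t v = 0) : v = 0 := by
  have hprod : ∏ i : Fin 3, shift t v i.castSucc = 0 := by
    rw [eval_cubic t, hq, mul_zero, add_zero] at hf
    exact (mul_eq_zero_iff_left two_ne_zero).1 hf
  have hXp (i : Fin 3) : v 3 * (shift t v i.castSucc * polar A t v i.castSucc) = 0 := by
    have hpi := hp i
    rw [halfPartial_eq t] at hpi
    rw [prod_rotate i] at hprod
    linear_combination shift t v i.castSucc * hpi - hprod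
  have h3 : v 3 * polar A t v 3 = 0 := by
    rw [dotProduct_eq_sum_castSucc, shift_three] at hq
    refine pow_eq_zero_iff two_ne_zero |>.1 ?_
    have hsum := Finset.sum_eq_zero fun i (_ : i ∈ Finset.univ) => hXp i
    rw [← Finset.mul_sum] at hsum
    linear_combination (v 3 * polar A t v 3) * hq - polar A t v 3 * hsum
  refine hA.eq_zero_of_isSingularAt v ⟨hf, fun u => ?_⟩
  rw [eval_dirDeriv_cubic t v u hA.isSymm, hq, h3]
  simp [hp]

theorem diag_ne_zero (i : Fin 3) : A i.castSucc i.castSucc ≠ 0 := by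
  intro h
  set v : Fin 4 → k := Pi.single i.castSucc 1 with hv
  have hv₁ : v (i + 1).castSucc = 0 := by fin_cases i <;> simp [hv]
  have hv₂ : v (i + 2).castSucc = 0 := by fin_cases i <;> simp [hv]
  have hv₃ : v 3 = 0 := single_castSucc_three i 1
  refine (by simp [hv] : v ≠ 0) (hA.eq_zero (t := 0) ?_ ?_ ?_)
  · rw [eval_cubic 0, prod_rotate i]
    simp [hv₁, hv₃]
  · refine forall_of_rotate i ?_ ?_ ?_
    · simp [halfPartial, hv₁, hv₃]
    · simp only [halfPartial, hv₃, zero_mul, add_zero, add_assoc i, mul_eq_zero]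
      exact .inl hv₂
    · simp only [halfPartial, hv₃, zero_mul, add_zero, add_assoc i, mul_eq_zero]
      exact .inr hv₁
  · rw [dotProduct_rotate _ _ i, polar_castSucc i]
    simp [hv₁, hv₂, hv₃]
    simp [hv, h]

theorem not_isSingularAt_quartic (hf : eval v (cubic A) ≠ 0) (hp : polar A t v = 0) :
    ¬ IsSingularAt (quartic A) v := by
  intro hv
  have hprod : ∏ i : Fin 3, shift t v i.castSucc ≠ 0 := by
    intro h
    rw [eval_cubic t, h, hp] at hf
    simp at hf
  have hpolar (u) : polar A t u 3 = 0 := by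
    have h := hv.2 u
    rw [eval_dirDeriv_quartic_of_polar_eq_zero t v u hp] at h
    exact (mul_eq_zero_iff_left hprod).1 ((mul_eq_zero_iff_left
      (neg_ne_zero.2 four_ne_zero')).1 h)
  -- The point where the three planes `x_i + t_i x_3 = 0` meet lies on the cubic surface.
  set e : Fin 4 → k := shift (-t) (Pi.single 3 1) with he
  have hshift : shift t e = Pi.single 3 1 := shift_shift_neg t _
  have hpe : polar A t e = 0 := polar_eq_of_forall t e hA.isSymm fun u => by
    rw [hshift, single_one_dotProduct, hpolar, dotProduct_zero]
  have he₀ : e = 0 := by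
    refine hA.eq_zero (t := t) ?_ (fun i => ?_) ?_
    · simp [-shift_castSucc, eval_cubic t, hshift, hpe, Fin.prod_univ_three]
    · fin_cases i <;> simp [-shift_castSucc, halfPartial_eq t, hshift, hpe]
    · simp [hpe]
  simpa [he] using congrFun he₀ 3

end IsSmoothMatrix

theorem exists_polar_eq_zero_of_three_ne_zero [NeZero (2 : k)] (hv : v 3 ≠ 0)
    (hf : eval v (cubic A) ≠ 0) (hG : eval v (quartic A) = 0) : ∃ t, polar A t v = 0 := by
  have hid : eval v (cubic A) ^ 2 = 4 * ∏ i, halfPartial A v i := by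
    linear_combination sq_mul_eval_quartic (A := A) v - v 3 ^ 2 * hG
  have hne (i : Fin 3) : halfPartial A v i ≠ 0 := fun h =>
    hf (by simpa [Finset.prod_eq_zero (Finset.mem_univ i) h] using hid)
  set t : Fin 3 → k := fun i => (eval v (cubic A) / (2 * halfPartial A v i) - v i.castSucc) / v 3
    with ht
  have hX (i : Fin 3) : shift t v i.castSucc = eval v (cubic A) / (2 * halfPartial A v i) := by
    simp [ht, hv]
  have hXX (i : Fin 3) : shift t v (i + 1).castSucc * shift t v (i + 2).castSucc =
      halfPartial A v i := by
    have := hne (i + 1)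
    have := hne (i + 2)
    have := two_ne_zero (α := k)
    rw [hX, hX, div_mul_div_comm, ← sq, hid, prod_rotate i]
    field_simp
    ring
  have hp (i : Fin 3) : polar A t v i.castSucc = 0 :=
    (mul_eq_zero_iff_left hv).1 (by linear_combination -hXX i - halfPartial_eq (A := A) t v i)
  have h2X : 2 * ∏ i : Fin 3, shift t v i.castSucc = eval v (cubic A) := by
    have := hne 0
    have := two_ne_zero (α := k)
    rw [prod_rotate 0, mul_assoc, hXX, hX]
    field_simp
  have hf' := eval_cubic (A := A) t v
  rw [h2X, dotProduct_eq_sum_castSucc, Finset.sum_eq_zero fun i _ => by rw [hp, mul_zero]] at hf'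
  refine ⟨t, eq_zero_of_castSucc hp ?_⟩
  simpa [hv] using hf'

theorem exists_polar_eq_zero_of_three_eq_zero [NeZero (2 : k)] (hv : v 3 = 0)
    (hf : eval v (cubic A) ≠ 0) (hG : eval v (quartic A) = 0) : ∃ t, polar A t v = 0 := by
  have hprod : ∏ i : Fin 3, v i.castSucc ≠ 0 := fun h => hf (by simp [cubic, hv, h])
  have hne (i : Fin 3) : v i.castSucc ≠ 0 := fun h =>
    hprod (Finset.prod_eq_zero (Finset.mem_univ i) h)
  set r : Fin 3 → k := fun i =>
    A.mulVec v i.castSucc / (v (i + 1).castSucc * v (i + 2).castSucc) with hr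
  set t : Fin 3 → k := fun i => v i.castSucc * ((r (i + 1) + r (i + 2) - r i) / 2) with ht
  have hp (i : Fin 3) : polar A t v i.castSucc = 0 := by
    have := hne (i + 1)
    have := hne (i + 2)
    have := two_ne_zero (α := k)
    have hri : r i * (v (i + 1).castSucc * v (i + 2).castSucc) = A.mulVec v i.castSucc := by
      simp only [hr]
      field_simp
    rw [polar_castSucc, hv, ← hri]
    simp only [ht, fin_add_one_add_one, fin_add_one_add_two, fin_add_two_add_one,
      fin_add_two_add_two]
    field_simp
    ring
  refine ⟨t, eq_zero_of_castSucc hp ?_⟩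
  have hX (j : Fin 3) : shift t v j.castSucc ≠ 0 := by simpa [hv] using hne j
  have h0 : polar A t v 0 = 0 := hp 0
  have h1 : polar A t v 1 = 0 := hp 1
  have h2 : polar A t v 2 = 0 := hp 2
  rw [eval_quartic t] at hG
  simpa [quarticExpr, dotProduct, Fin.sum_univ_four, h0, h1, h2, hv, four_ne_zero',
    show shift t v 0 ≠ 0 from hX 0, show shift t v 1 ≠ 0 from hX 1,
    show shift t v 2 ≠ 0 from hX 2] using hG

theorem exists_polar_eq_zero [NeZero (2 : k)] (hf : eval v (cubic A) ≠ 0)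
    (hG : eval v (quartic A) = 0) : ∃ t, polar A t v = 0 :=
  (eq_or_ne (v 3) 0).elim (exists_polar_eq_zero_of_three_eq_zero · hf hG)
    (exists_polar_eq_zero_of_three_ne_zero · hf hG)

end SmoothMatrix

section Vertex

/-- The vectors representing the singular points of the conic which, besides a line of the plane
`x_3 = 0`, is cut out on the surface `cubic A = 0` by the plane `x_i + s x_3 = 0`. -/
def vertexSpace (A : Matrix (Fin 4) (Fin 4) k) (i : Fin 3) (s : k) : Submodule k (V4 k) where
  carrier := {v | v i.castSucc + s * v 3 = 0 ∧
    A.mulVec v (i + 1).castSucc = s * v (i + 2).castSucc ∧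
    A.mulVec v (i + 2).castSucc = s * v (i + 1).castSucc ∧
    A.mulVec v 3 = s * A.mulVec v i.castSucc}
  add_mem' := by
    rintro u v ⟨h₀, h₁, h₂, h₃⟩ ⟨h₀', h₁', h₂', h₃'⟩
    simp only [Matrix.mulVec_add, Pi.add_apply, Set.mem_ofPred_eq, h₁, h₂, h₃, h₁', h₂', h₃',
      mul_add, and_self, and_true]
    linear_combination h₀ + h₀'
  zero_mem' := by simp
  smul_mem' := by
    rintro c v ⟨h₀, h₁, h₂, h₃⟩
    simp only [Matrix.mulVec_smul, Pi.smul_apply, Set.mem_ofPred_eq, h₁, h₂, h₃, smul_eq_mul,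
      mul_left_comm c, and_self, and_true]
    linear_combination c * h₀

variable {A : Matrix (Fin 4) (Fin 4) k} {t : Fin 3 → k} {v : Fin 4 → k} {i : Fin 3} {s : k}

theorem polar_three : polar A t v 3 = A.mulVec v 3 -
    (t i * A.mulVec v i.castSucc + t (i + 1) * A.mulVec v (i + 1).castSucc +
      t (i + 2) * A.mulVec v (i + 2).castSucc) +
    (t (i + 1) * t (i + 2) * v i.castSucc + t (i + 2) * t i * v (i + 1).castSucc +
      t i * t (i + 1) * v (i + 2).castSucc + t i * t (i + 1) * t (i + 2) * v 3) := by
  rw [polar, Matrix.sub_mulVec, coshift_three, sum_rotate i]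
  fin_cases i <;>
    simp [productMatrix, Fin.sum_univ_four, dotProduct] <;>
    ring

theorem mem_vertexSpace_iff : v ∈ vertexSpace A i (t i) ↔ shift t v i.castSucc = 0 ∧
    polar A t v (i + 1).castSucc = 0 ∧ polar A t v (i + 2).castSucc = 0 ∧ polar A t v 3 = 0 := by
  rw [polar_castSucc, polar_castSucc, polar_three (i := i), shift_castSucc]
  simp only [fin_add_one_add_one, fin_add_one_add_two, fin_add_two_add_one, fin_add_two_add_two]
  refine and_congr_right fun h₀ => ?_
  constructor
  · rintro ⟨h₁, h₂, h₃⟩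
    refine ⟨?_, ?_, ?_⟩
    · linear_combination h₁ - t (i + 2) * h₀
    · linear_combination h₂ - t (i + 1) * h₀
    · linear_combination h₃ - t (i + 1) * h₁ - t (i + 2) * h₂ + t (i + 1) * t (i + 2) * h₀
  · rintro ⟨h₁, h₂, h₃⟩
    have h₁' : A.mulVec v (i + 1).castSucc = t i * v (i + 2).castSucc := by
      linear_combination h₁ + t (i + 2) * h₀
    have h₂' : A.mulVec v (i + 2).castSucc = t i * v (i + 1).castSucc := by
      linear_combination h₂ + t (i + 1) * h₀
    refine ⟨h₁', h₂', ?_⟩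
    linear_combination h₃ + t (i + 1) * h₁' + t (i + 2) * h₂' - t (i + 1) * t (i + 2) * h₀

theorem mem_vertexSpace_of_polar_eq_zero (hX : shift t v i.castSucc = 0) (hp : polar A t v = 0) :
    v ∈ vertexSpace A i (t i) :=
  mem_vertexSpace_iff.2 ⟨hX, by simp [hp], by simp [hp], by simp [hp]⟩

theorem halfPartial_eq_zero_of_mem_vertexSpace (hv : v ∈ vertexSpace A i s) {j : Fin 3}
    (hj : j ≠ i) : halfPartial A v j = 0 := by
  obtain ⟨h₀, h₁, h₂, -⟩ := hv
  rcases eq_add_one_or_eq_add_two hj with rfl | rfl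
  · rw [halfPartial, fin_add_one_add_one, fin_add_one_add_two, h₁]
    linear_combination v (i + 2).castSucc * h₀
  · rw [halfPartial, fin_add_two_add_one, fin_add_two_add_two, h₂]
    linear_combination v (i + 1).castSucc * h₀

theorem shift_dotProduct_polar_of_mem_vertexSpace (hv : v ∈ vertexSpace A i (t i))
    (u : Fin 4 → k) : shift t u ⬝ᵥ polar A t v = shift t u i.castSucc * polar A t v i.castSucc := by
  obtain ⟨-, h₁, h₂, h₃⟩ := mem_vertexSpace_iff.1 hv
  simp [dotProduct_rotate _ _ i, h₁, h₂, h₃]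

theorem eval_cubic_of_mem_vertexSpace (hv : v ∈ vertexSpace A i s) : eval v (cubic A) = 0 := by
  obtain ⟨t, rfl⟩ : ∃ t : Fin 3 → k, s = t i := ⟨fun _ => s, rfl⟩
  rw [eval_cubic t, shift_dotProduct_polar_of_mem_vertexSpace hv, prod_rotate i,
    (mem_vertexSpace_iff.1 hv).1]
  simp

theorem isSingularAt_quartic_of_mem_vertexSpace (hv : v ∈ vertexSpace A i s) :
    IsSingularAt (quartic A) v := by
  obtain ⟨t, rfl⟩ : ∃ t : Fin 3 → k, s = t i := ⟨fun _ => s, rfl⟩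
  obtain ⟨h₀, h₁, h₂, h₃⟩ := mem_vertexSpace_iff.1 hv
  refine ⟨?_, fun u => ?_⟩
  · rw [eval_quartic t, quarticExpr_rotate _ _ i, shift_dotProduct_polar_of_mem_vertexSpace hv,
      h₀, h₁, h₂, h₃]
    ring
  · rw [eval_dirDeriv_quartic_of_tangent t v u i h₀ h₁ h₂ (by rw [h₃, mul_zero]), h₃]
    simp

section Smooth

variable [NeZero (2 : k)] (hA : IsSmoothMatrix A)

include hA

theorem IsSmoothMatrix.halfPartial_ne_zero (hv : v ∈ vertexSpace A i s) (hv₀ : v ≠ 0) :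
    halfPartial A v i ≠ 0 := by
  intro h
  obtain ⟨t, rfl⟩ : ∃ t : Fin 3 → k, s = t i := ⟨fun _ => s, rfl⟩
  refine hv₀ (hA.eq_zero (t := t) (eval_cubic_of_mem_vertexSpace hv) (fun j => ?_) ?_)
  · rcases eq_or_ne j i with rfl | hj
    exacts [h, halfPartial_eq_zero_of_mem_vertexSpace hv hj]
  · rw [shift_dotProduct_polar_of_mem_vertexSpace hv, (mem_vertexSpace_iff.1 hv).1, zero_mul]

theorem IsSmoothMatrix.eq_and_eq_of_mem_vertexSpace {j : Fin 3} {r : k}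
    (hv : v ∈ vertexSpace A i s) (hv' : v ∈ vertexSpace A j r) (hv₀ : v ≠ 0) : i = j ∧ s = r := by
  obtain rfl : i = j := of_not_not fun hij =>
    hA.halfPartial_ne_zero hv hv₀ (halfPartial_eq_zero_of_mem_vertexSpace hv' hij)
  refine ⟨rfl, of_not_not fun hsr => hv₀ ?_⟩
  obtain ⟨h₀, h₁, h₂, -⟩ := hv
  obtain ⟨h₀', h₁', h₂', -⟩ := hv'
  have hne := sub_ne_zero.2 hsr
  have hv₃ : v 3 = 0 := (mul_eq_zero_iff_left hne).1 (by linear_combination h₀ - h₀')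
  refine eq_zero_of_castSucc (forall_of_rotate i ?_ ?_ ?_) hv₃
  · simpa [hv₃] using h₀
  · exact (mul_eq_zero_iff_left hne).1 (by linear_combination h₂' - h₂)
  · exact (mul_eq_zero_iff_left hne).1 (by linear_combination h₁' - h₁)

theorem IsSmoothMatrix.mem_span_of_mem_vertexSpace [IsAlgClosed k] {u : Fin 4 → k}
    (hu : u ∈ vertexSpace A i s) (hv : v ∈ vertexSpace A i s) (hv₀ : v ≠ 0) :
    u ∈ Submodule.span k {v} := by
  obtain ⟨r, hr⟩ := IsAlgClosed.exists_eq_mul_self (discrim (halfPartial A v i)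
    (halfPartial A (u + v) i - halfPartial A u i - halfPartial A v i) (halfPartial A u i))
  obtain ⟨r, hr⟩ := exists_quadratic_eq_zero (hA.halfPartial_ne_zero hv hv₀) ⟨r, hr⟩
  have hzero : halfPartial A (u + r • v) i = 0 := by
    rw [← hr]
    simp only [halfPartial, Matrix.mulVec_add, Matrix.mulVec_smul, Pi.add_apply, Pi.smul_apply,
      smul_eq_mul]
    ring
  have huv : u + r • v = 0 := of_not_not fun hne => hA.halfPartial_ne_zero
    (add_mem hu (Submodule.smul_mem _ r hv)) hne hzero
  exact Submodule.mem_span_singleton.2 ⟨-r, by rw [neg_smul, eq_neg_of_add_eq_zero_left huv]⟩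

end Smooth

end Vertex

section SingularPoints

variable {A : Matrix (Fin 4) (Fin 4) k} {t : Fin 3 → k} {v : Fin 4 → k} {i : Fin 3} {s : k}

theorem mem_vertexSpace_of_halfPartial_eq_zero (hv₃ : v 3 ≠ 0) (hf : eval v (cubic A) = 0)
    (h₁ : halfPartial A v (i + 1) = 0) (h₂ : halfPartial A v (i + 2) = 0) :
    v ∈ vertexSpace A i (-(v i.castSucc / v 3)) := by
  obtain ⟨t, ht⟩ : ∃ t : Fin 3 → k, -(v i.castSucc / v 3) = t i := ⟨fun _ => _, rfl⟩
  have hX : shift t v i.castSucc = 0 := by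
    rw [shift_castSucc, ← ht]
    field_simp
    ring
  rw [halfPartial_eq t, fin_add_one_add_one, fin_add_one_add_two, hX, mul_zero, zero_add,
    mul_eq_zero_iff_left hv₃] at h₁
  rw [halfPartial_eq t, fin_add_two_add_one, fin_add_two_add_two, hX, zero_mul, zero_add,
    mul_eq_zero_iff_left hv₃] at h₂
  rw [eval_cubic t, prod_rotate i, dotProduct_rotate _ _ i, hX, h₁, h₂, shift_three] at hf
  rw [ht, mem_vertexSpace_iff]
  refine ⟨hX, h₁, h₂, ?_⟩
  simpa [hv₃] using hf

theorem mem_vertexSpace_of_polar_eq_single {c : k} (hX : shift t v i.castSucc = 0)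
    (hp : polar A t v = Pi.single i.castSucc c) : v ∈ vertexSpace A i (t i) := by
  refine mem_vertexSpace_iff.2 ⟨hX, ?_⟩
  rw [hp]
  clear hX hp
  fin_cases i <;> simp

theorem shift_smul (c : k) : shift t (c • v) = c • shift t v := by
  ext j
  fin_cases j <;> simp [shift, mul_add, mul_left_comm]

theorem polar_smul (c : k) : polar A t (c • v) = c • polar A t v := by
  rw [polar, Matrix.mulVec_smul, polar]
  ext j
  fin_cases j <;> simp [coshift, Fin.sum_univ_three]
  ring

theorem exists_mem_vertexSpace_of_hessian_eq_zero (hA : A.IsSymm) {u : Fin 4 → k}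
    (hu : ∀ u', polar A t u (i + 1).castSucc * polar A t u' (i + 2).castSucc +
      polar A t u (i + 2).castSucc * polar A t u' (i + 1).castSucc -
      shift t u i.castSucc * polar A t u' 3 - shift t u' i.castSucc * polar A t u 3 = 0) :
    ∃ y ∈ vertexSpace A i (t i), shift t y (i + 1).castSucc = polar A t u (i + 2).castSucc ∧
      shift t y (i + 2).castSucc = polar A t u (i + 1).castSucc ∧
      shift t y 3 = -shift t u i.castSucc ∧ polar A t y i.castSucc = polar A t u 3 := by
  let x : Fin 4 → k := Pi.single (i + 1).castSucc (polar A t u (i + 2).castSucc) +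
    Pi.single (i + 2).castSucc (polar A t u (i + 1).castSucc) -
    Pi.single 3 (shift t u i.castSucc)
  obtain ⟨hx, hx₁, hx₂, hx₃⟩ : x i.castSucc = 0 ∧
      x (i + 1).castSucc = polar A t u (i + 2).castSucc ∧
      x (i + 2).castSucc = polar A t u (i + 1).castSucc ∧ x 3 = -shift t u i.castSucc := by
    clear hu
    fin_cases i <;> simp [-shift_castSucc, x]
  have hy : shift t (shift (-t) x) = x := shift_shift_neg t x
  have hpy : polar A t (shift (-t) x) = Pi.single i.castSucc (polar A t u 3) :=
    polar_eq_of_forall t _ hA fun u' => by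
      rw [hy, dotProduct_single]
      simp only [x, sub_dotProduct, add_dotProduct, single_dotProduct]
      linear_combination hu u'
  refine ⟨shift (-t) x, mem_vertexSpace_of_polar_eq_single (by rwa [hy]) hpy, ?_⟩
  rw [hy, hpy, Pi.single_eq_same]
  exact ⟨hx₁, hx₂, hx₃, rfl⟩

theorem mulVec_of_support {v : Fin 4 → k} (h₁ : v (i + 1).castSucc = 0)
    (h₂ : v (i + 2).castSucc = 0) (h₃ : v 3 = 0) (j : Fin 4) :
    A.mulVec v j = A j i.castSucc * v i.castSucc := by
  rw [Matrix.mulVec, dotProduct_rotate _ _ i, h₁, h₂, h₃]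
  ring

theorem eval_dirDeriv_halfPartialForm_single :
    eval v (dirDeriv (Pi.single i.castSucc 1) (halfPartialForm A i)) =
      v 3 * A i.castSucc i.castSucc := by
  simp [halfPartialForm, Derivation.leibniz, dirDeriv_toMvPolynomial, single_castSucc_three]

namespace IsSmoothMatrix

variable [NeZero (2 : k)] (hA : IsSmoothMatrix A)

include hA

theorem eval_cubic_eq_zero_of_isSingularAt (hv : IsSingularAt (quartic A) v) :
    eval v (cubic A) = 0 := by
  by_contra hf
  obtain ⟨t, ht⟩ := exists_polar_eq_zero hf hv.1
  exact hA.not_isSingularAt_quartic hf ht hv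

theorem exists_mem_vertexSpace_of_three_ne_zero (hv : IsSingularAt (quartic A) v)
    (hv₃ : v 3 ≠ 0) : ∃ i s, v ∈ vertexSpace A i s := by
  have hf := hA.eval_cubic_eq_zero_of_isSingularAt hv
  have hprod : ∏ i, halfPartial A v i = 0 := by
    refine (mul_eq_zero_iff_left (four_ne_zero' (k := k))).1 ?_
    linear_combination v 3 ^ 2 * hv.1 - sq_mul_eval_quartic (A := A) v + eval v (cubic A) * hf
  obtain ⟨i, -, hi⟩ := Finset.prod_eq_zero_iff.1 hprod
  -- Otherwise `∏ halfPartial` vanishes to first order only, in the direction of `x_i`.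
  have hi' : halfPartial A v (i + 1) = 0 ∨ halfPartial A v (i + 2) = 0 := by
    have h := congrArg (fun g => eval v (dirDeriv (Pi.single i.castSucc 1) g))
      (X_sq_mul_quartic (A := A))
    simpa [Derivation.leibniz, Derivation.leibniz_pow, prod_rotate i, eval_halfPartialForm,
      eval_dirDeriv_halfPartialForm_single, hi, hf, hv.1, hv.2, hv₃, hA.diag_ne_zero,
      four_ne_zero', or_comm] using h
  rcases hi' with h | h
  · exact ⟨i + 2, _, mem_vertexSpace_of_halfPartial_eq_zero hv₃ hf
      (by rwa [fin_add_two_add_one]) (by rwa [fin_add_two_add_two])⟩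
  · exact ⟨i + 1, _, mem_vertexSpace_of_halfPartial_eq_zero hv₃ hf
      (by rwa [fin_add_one_add_one]) (by rwa [fin_add_one_add_two])⟩

theorem exists_mem_vertexSpace_of_three_eq_zero (hv : IsSingularAt (quartic A) v)
    (hv₀ : v ≠ 0) (hv₃ : v 3 = 0) : ∃ i s, v ∈ vertexSpace A i s := by
  have hf := hA.eval_cubic_eq_zero_of_isSingularAt hv
  obtain ⟨i, hi⟩ : ∃ i : Fin 3, v i.castSucc = 0 := by
    simpa [cubic, hv₃, Finset.prod_eq_zero_iff, two_ne_zero] using hf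
  have hq : v (i + 1).castSucc * A.mulVec v (i + 1).castSucc =
      v (i + 2).castSucc * A.mulVec v (i + 2).castSucc := by
    have hG := hv.1
    rw [eval_quartic 0, quarticExpr_rotate _ _ i, dotProduct_rotate _ _ i] at hG
    simp only [shift_castSucc, shift_three, polar_castSucc, Pi.zero_apply, hi, hv₃] at hG
    refine sub_eq_zero.1 (pow_eq_zero_iff two_ne_zero |>.1 ?_)
    linear_combination -hG
  have hdiag {j : Fin 3} (h₁ : v (j + 1).castSucc = 0) (h₂ : v (j + 2).castSucc = 0)
      (h : v j.castSucc * A.mulVec v j.castSucc = 0) : False := by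
    rw [mulVec_of_support h₁ h₂ hv₃] at h
    have hj : v j.castSucc = 0 := by simpa [hA.diag_ne_zero] using h
    exact hv₀ (eq_zero_of_castSucc (forall_of_rotate j hj h₁ h₂) hv₃)
  have hi₁ : v (i + 1).castSucc ≠ 0 := fun h => hdiag (j := i + 2)
    (by rwa [fin_add_two_add_one]) (by rwa [fin_add_two_add_two]) (by rw [← hq, h, zero_mul])
  have hi₂ : v (i + 2).castSucc ≠ 0 := fun h => hdiag (j := i + 1)
    (by rwa [fin_add_one_add_one]) (by rwa [fin_add_one_add_two]) (by rw [hq, h, zero_mul])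
  obtain ⟨t, ht⟩ : ∃ t : Fin 3 → k, t i = A.mulVec v (i + 1).castSucc / v (i + 2).castSucc :=
    ⟨fun _ => _, rfl⟩
  rw [eq_div_iff hi₂] at ht
  have hX : shift t v i.castSucc = 0 := by simp [hi, hv₃]
  have hp₁ : polar A t v (i + 1).castSucc = 0 := by
    rw [polar_castSucc, fin_add_one_add_one, fin_add_one_add_two, hi, hv₃]
    linear_combination -ht
  have hp₂ : polar A t v (i + 2).castSucc = 0 := by
    rw [polar_castSucc, fin_add_two_add_one, fin_add_two_add_two, hi, hv₃]
    refine (mul_eq_zero_iff_left hi₂).1 ?_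
    linear_combination -hq - v (i + 1).castSucc * ht
  refine ⟨i, t i, mem_vertexSpace_iff.2 ⟨hX, hp₁, hp₂, ?_⟩⟩
  have h := hv.2 (Pi.single i.castSucc 1)
  rw [eval_dirDeriv_quartic_of_tangent t v _ i hX hp₁ hp₂ (by rw [hv₃, zero_mul])] at h
  simpa [hv₃, hi₁, hi₂, four_ne_zero', single_castSucc_three] using h

theorem exists_mem_vertexSpace (hv : IsSingularAt (quartic A) v) (hv₀ : v ≠ 0) :
    ∃ i s, v ∈ vertexSpace A i s :=
  (eq_or_ne (v 3) 0).elim (hA.exists_mem_vertexSpace_of_three_eq_zero hv hv₀)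
    (hA.exists_mem_vertexSpace_of_three_ne_zero hv)

theorem mem_vertexSpace_of_hessian_eq_zero [IsAlgClosed k] (hv : v ∈ vertexSpace A i (t i))
    (hv₀ : v ≠ 0) {u : Fin 4 → k}
    (hu : ∀ u', polar A t u (i + 1).castSucc * polar A t u' (i + 2).castSucc +
      polar A t u (i + 2).castSucc * polar A t u' (i + 1).castSucc -
      shift t u i.castSucc * polar A t u' 3 - shift t u' i.castSucc * polar A t u 3 = 0) :
    u ∈ vertexSpace A i (t i) := by
  obtain ⟨y, hyv, hy₁, hy₂, hy₃, hpy⟩ :=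
    exists_mem_vertexSpace_of_hessian_eq_zero hA.isSymm hu
  obtain ⟨r, rfl⟩ := Submodule.mem_span_singleton.1 (hA.mem_span_of_mem_vertexSpace hyv hv hv₀)
  rw [polar_smul, Pi.smul_apply, smul_eq_mul] at hpy
  rw [shift_smul, Pi.smul_apply, smul_eq_mul] at hy₁ hy₂ hy₃
  obtain rfl : r = 0 := by
    have h := shift_dotProduct_polar_comm t v u hA.isSymm
    rw [shift_dotProduct_polar_of_mem_vertexSpace hv, dotProduct_rotate _ _ i,
      (mem_vertexSpace_iff.1 hv).1] at h
    refine (mul_eq_zero_iff_left (mul_ne_zero two_ne_zero (hA.halfPartial_ne_zero hv hv₀))).1 ?_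
    rw [halfPartial_eq t, ← shift_three t v]
    linear_combination h + shift t v (i + 1).castSucc * hy₂ + shift t v (i + 2).castSucc * hy₁ +
      shift t v 3 * hpy + polar A t v i.castSucc * hy₃
  rw [zero_mul] at hy₁ hy₂ hy₃ hpy
  exact mem_vertexSpace_iff.2 ⟨neg_eq_zero.1 hy₃.symm, hy₂.symm, hy₁.symm, hpy.symm⟩

theorem isNodeAt_quartic [IsAlgClosed k] (hv : v ∈ vertexSpace A i s) (hv₀ : v ≠ 0) :
    IsNodeAt (quartic A) v := by
  refine ⟨isSingularAt_quartic_of_mem_vertexSpace hv, fun u hu => ?_⟩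
  obtain ⟨t, rfl⟩ : ∃ t : Fin 3 → k, s = t i := ⟨fun _ => s, rfl⟩
  refine hA.mem_span_of_mem_vertexSpace
    (hA.mem_vertexSpace_of_hessian_eq_zero hv hv₀ fun u' => ?_) hv hv₀
  have h := hu u'
  obtain ⟨hX, hp₁, hp₂, hp₃⟩ := mem_vertexSpace_iff.1 hv
  rw [eval_dirDeriv_dirDeriv_quartic_of_vertex t v u u' i hA.isSymm hX hp₁ hp₂ hp₃] at h
  exact (mul_eq_zero_iff_left
    (mul_ne_zero four_ne_zero' (hA.halfPartial_ne_zero hv hv₀))).1 h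

end IsSmoothMatrix

end SingularPoints

section CommonZeros

variable {σ : Type*}

/-- The automorphism of the polynomial ring given by translation by `v`. -/
noncomputable def translate (v : σ → k) : MvPolynomial σ k ≃ₐ[k] MvPolynomial σ k :=
  AlgEquiv.ofAlgHom (aeval fun i => X i + C (v i)) (aeval fun i => X i - C (v i))
    (by ext i; simp) (by ext i; simp)

theorem aeval_translate (u v : σ → k) (g : MvPolynomial σ k) :
    aeval u (translate v g) = aeval (u + v) g := by
  have h : (aeval u).comp (translate v : MvPolynomial σ k →ₐ[k] MvPolynomial σ k) =
      aeval (u + v) := algHom_ext fun i => by simp [translate]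
  exact DFunLike.congr_fun h g

theorem height_vanishingIdeal_singleton_eq (u v : σ → k) :
    (vanishingIdeal k {u}).height = (vanishingIdeal k {v}).height := by
  rw [← RingEquiv.height_comap (translate (u - v)).toRingEquiv (vanishingIdeal k {v})]
  congr 1
  ext g
  rw [Ideal.mem_comap, mem_vanishingIdeal_singleton_iff, mem_vanishingIdeal_singleton_iff]
  change _ ↔ aeval v (translate (u - v) g) = 0
  rw [aeval_translate, add_sub_cancel]

variable [Finite σ] [IsAlgClosed k]

theorem card_le_height_vanishingIdeal_singleton (v : σ → k) :
    (Nat.card σ : ℕ∞) ≤ (vanishingIdeal k {v}).height := by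
  have hdim : ringKrullDim (MvPolynomial σ k) = Nat.card σ := by
    rw [ringKrullDim_of_isNoetherianRing, ringKrullDim_eq_zero_of_field, zero_add]
  have hle : ringKrullDim (MvPolynomial σ k) ≤ (vanishingIdeal k {v}).height := by
    rw [ringKrullDim_le_iff_isMaximal_height_le]
    intro m hm
    obtain ⟨u, rfl⟩ := (isMaximal_iff_eq_vanishingIdeal_singleton (K := k)).1 hm
    exact WithBot.coe_le_coe.2 (height_vanishingIdeal_singleton_eq u v).le
  rw [hdim] at hle
  exact_mod_cast hle

theorem exists_ne_forall_eval_eq_zero {S : Set (MvPolynomial σ k)} (hS : S.Finite)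
    (hcard : S.ncard < Nat.card σ) {v : σ → k} (hv : ∀ g ∈ S, eval v g = 0) :
    ∃ u ≠ v, ∀ g ∈ S, eval u g = 0 := by
  by_contra! h
  have hzero : MvPolynomial.zeroLocus k (Ideal.span S) = {v} := by
    ext u
    rw [zeroLocus_span, Set.mem_ofPred_eq, Set.mem_singleton_iff]
    refine ⟨fun hu => of_not_not fun hne => ?_, ?_⟩
    · obtain ⟨g, hg, hgu⟩ := h u hne
      exact hgu (hu g hg)
    · rintro rfl
      exact hv
  have hrad := vanishingIdeal_zeroLocus_eq_radical (k := k) (K := k) (Ideal.span S)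
  rw [hzero] at hrad
  have hmin : vanishingIdeal k {v} ∈ (Ideal.span S).minimalPrimes := by
    refine ⟨⟨inferInstance, hrad ▸ Ideal.le_radical⟩, fun P hP _ => ?_⟩
    rw [hrad]
    exact hP.1.radical_le_iff.2 hP.2
  have hheight := (card_le_height_vanishingIdeal_singleton v).trans
    (Ideal.height_le_card_of_mem_minimalPrimes_span hS hmin)
  exact hcard.not_ge (by exact_mod_cast hheight)

end CommonZeros

section Irreducible

variable {σ : Type*}

theorem isUnit_of_isHomogeneous_mul {p q : MvPolynomial σ k} {d : ℕ}
    (hpq : (p * q).IsHomogeneous d) (hne : p * q ≠ 0) (hp : constantCoeff p ≠ 0) : IsUnit p := by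
  have hp₀ : p ≠ 0 := left_ne_zero_of_mul hne
  have hq₀ : q ≠ 0 := right_ne_zero_of_mul hne
  have horder : (p : MvPowerSeries σ k).order = 0 :=
    of_not_not fun h => hp (MvPowerSeries.order_ne_zero_iff_constCoeff_eq_zero.1 h)
  have hd : (d : ℕ∞) ≤ (q : MvPowerSeries σ k).order := by
    have h := MvPowerSeries.order_mul (p : MvPowerSeries σ k) q
    rw [horder, zero_add, ← MvPolynomial.coe_mul] at h
    rw [← h]
    refine MvPowerSeries.le_order fun m hm => ?_
    rw [coeff_coe]
    exact hpq.coeff_eq_zero (by exact_mod_cast hm.ne)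
  obtain ⟨m, hm⟩ := exists_coeff_ne_zero hq₀
  have hdm : d ≤ q.totalDegree := by
    have h := hd.trans (MvPowerSeries.order_le (f := (q : MvPowerSeries σ k))
      (by rwa [coeff_coe]))
    exact (by exact_mod_cast h : d ≤ m.degree).trans
      (le_totalDegree (mem_support_iff.2 hm))
  have hdeg := hpq.totalDegree hne
  rw [totalDegree_mul_of_isDomain hp₀ hq₀] at hdeg
  rw [isUnit_iff_totalDegree_of_isReduced]
  exact ⟨hp.isUnit, by omega⟩

theorem card_le_three_of_isNodeAt_mul [Fintype σ] {p q : MvPolynomial σ k} {v : σ → k}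
    (hv : v ≠ 0) (hp : eval v p = 0) (hq : eval v q = 0) (hnode : IsNodeAt (p * q) v) :
    Fintype.card σ ≤ 3 := by
  let L : (σ → k) →ₗ[k] k × k :=
    { toFun := fun u => (eval v (dirDeriv u p), eval v (dirDeriv u q))
      map_add' := fun u u' => by simp
      map_smul' := fun c u => by simp [smul_eval] }
  have hle : LinearMap.ker L ≤ Submodule.span k {v} := fun u hu => hnode.2 u fun u' => by
    have hup : eval v (dirDeriv u p) = 0 := congrArg Prod.fst hu
    have huq : eval v (dirDeriv u q) = 0 := congrArg Prod.snd hu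
    simp [Derivation.leibniz, hp, hq, hup, huq]
  have hker := (Submodule.finrank_mono hle).trans (finrank_span_singleton hv).le
  have hrange := L.range.finrank_le
  have hsum := L.finrank_range_add_finrank_ker
  rw [Module.finrank_prod, Module.finrank_self] at hrange
  rw [Module.finrank_fintype_fun_eq_card] at hsum
  omega

theorem irreducible_of_isNodeAt [Fintype σ] [IsAlgClosed k] {g : MvPolynomial σ k} {d : ℕ}
    (hcard : 3 < Fintype.card σ) (hg : g.IsHomogeneous d) (hd : d ≠ 0) (hne : g ≠ 0)
    (hnode : ∀ v ≠ 0, IsSingularAt g v → IsNodeAt g v) : Irreducible g := by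
  have hconst : constantCoeff g = 0 := hg.coeff_eq_zero (by simpa using hd.symm)
  refine ⟨fun hu => not_isUnit_zero (hconst ▸ hu.map constantCoeff), ?_⟩
  rintro p q rfl
  by_contra! hpq
  have hp : constantCoeff p = 0 := of_not_not fun h =>
    hpq.1 (isUnit_of_isHomogeneous_mul hg hne h)
  have hq : constantCoeff q = 0 := of_not_not fun h =>
    hpq.2 (isUnit_of_isHomogeneous_mul (mul_comm p q ▸ hg) (mul_comm p q ▸ hne) h)
  obtain ⟨v, hv, h⟩ := exists_ne_forall_eval_eq_zero (S := {p, q}) (Set.toFinite _)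
    ((Set.ncard_insert_le _ _).trans_lt
      (by rw [Set.ncard_singleton, Nat.card_eq_fintype_card]; omega)) (v := 0) (by simp [hp, hq])
  have hvp : eval v p = 0 := h p (by simp)
  have hvq : eval v q = 0 := h q (by simp)
  exact hcard.not_ge (card_le_three_of_isNodeAt_mul hv hvp hvq
    (hnode v hv ⟨by simp [hvp], fun u => by simp [hvp, hvq]⟩))

end Irreducible

section LinearForms

theorem exists_dual_eval_eq {σ R : Type*} [CommRing R] [Finite σ] {g : MvPolynomial σ R}
    (hg : g.IsHomogeneous 1) : ∃ φ : Module.Dual R (σ → R), ∀ v, eval v g = φ v := by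
  refine ⟨IsLinearMap.mk' (fun u => coeff 0 (dirDeriv u g)) ⟨by simp, by simp⟩, fun v => ?_⟩
  have hconst : dirDeriv v g = C (coeff 0 (dirDeriv v g)) :=
    totalDegree_eq_zero_iff_eq_C.1
      ((totalDegree_zero_iff_isHomogeneous _).2 (isHomogeneous_dirDeriv hg v))
  have heuler := eval_dirDeriv_self hg v
  rw [hconst, eval_C, Nat.cast_one, one_mul] at heuler
  exact heuler.symm

theorem isEquationOf_iff {a : Form k} {W : Submodule k (V4 k)} :
    IsEquationOf a W ↔ a.IsHomogeneous 1 ∧ ∀ v, eval v a = 0 ↔ v ∈ W := by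
  refine and_congr_right fun ha => ⟨fun h v => ?_, fun h => Set.ext fun p => ?_⟩
  · obtain ⟨φ, hφ⟩ := exists_dual_eval_eq ha
    by_cases hv : v = 0
    · rw [hv, hφ, map_zero, eq_self_iff_true, true_iff]
      exact W.zero_mem
    · rw [← mk_mem_zeroLocus ha hv, ← mk_mem_pts hv, h]
  · induction p using Projectivization.ind with
    | h v hv => rw [mk_mem_zeroLocus ha, mk_mem_pts, h]

theorem IsEquationOf.exists_dual {a : Form k} {W : Submodule k (V4 k)} (h : IsEquationOf a W) :
    ∃ φ : Module.Dual k (V4 k), (∀ v, eval v a = φ v) ∧ LinearMap.ker φ = W := by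
  obtain ⟨ha, hW⟩ := isEquationOf_iff.1 h
  obtain ⟨φ, hφ⟩ := exists_dual_eval_eq ha
  exact ⟨φ, hφ, Submodule.ext fun v => by rw [LinearMap.mem_ker, ← hφ, hW]⟩

theorem finrank_ker_eq_three {φ : Module.Dual k (V4 k)} (h : φ ≠ 0) :
    Module.finrank k (LinearMap.ker φ) = 3 := by
  have := Module.Dual.finrank_ker_add_one_of_ne_zero h
  rw [Module.finrank_fin_fun] at this
  lia

theorem coeff_zero_mul_eq_homogeneousComponent {σ R : Type*} [CommRing R] {p : MvPolynomial σ R}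
    {n : ℕ} (hp : p.IsHomogeneous n) (q : MvPolynomial σ R) :
    C (coeff 0 q) * p = homogeneousComponent n (q * p) := by
  have hcomp (i : ℕ) : (homogeneousComponent i q * p).IsHomogeneous (i + n) :=
    (homogeneousComponent_isHomogeneous i q).mul hp
  conv_rhs => rw [← sum_homogeneousComponent q, Finset.sum_mul, map_sum]
  rw [Finset.sum_eq_single_of_mem 0 (by simp), homogeneousComponent_of_mem (hcomp 0),
    if_pos (zero_add n).symm, homogeneousComponent_zero]
  intro i _ hi
  rw [homogeneousComponent_of_mem (hcomp i), if_neg (by lia)]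

theorem exists_C_mul_add_C_mul_eq {σ R : Type*} [CommRing R] {p q r : MvPolynomial σ R} {n : ℕ}
    (hp : p.IsHomogeneous n) (hq : q.IsHomogeneous n) (hr : r.IsHomogeneous n)
    (h : r ∈ Ideal.span {p, q}) : ∃ a b, C a * p + C b * q = r := by
  obtain ⟨u, v, rfl⟩ := Ideal.mem_span_pair.1 h
  refine ⟨coeff 0 u, coeff 0 v, ?_⟩
  rw [coeff_zero_mul_eq_homogeneousComponent hp, coeff_zero_mul_eq_homogeneousComponent hq,
    ← map_add, homogeneousComponent_of_mem hr, if_pos rfl]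

theorem dvd_of_forall_eval_eq_zero {σ : Type*} [Finite σ] [IsAlgClosed k] {g h : MvPolynomial σ k}
    (hg : Irreducible g) (H : ∀ v, eval v g = 0 → eval v h = 0) : g ∣ h := by
  have hprime : (Ideal.span {g}).IsPrime :=
    (Ideal.span_singleton_prime hg.ne_zero).2 hg.prime
  rw [← Ideal.mem_span_singleton, ← IsPrime.vanishingIdeal_zeroLocus (K := k) (Ideal.span {g}),
    mem_vanishingIdeal_iff]
  intro v hv
  rw [zeroLocus_span] at hv
  simpa [aeval_eq_eval] using H v (by simpa [aeval_eq_eval] using hv g rfl)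

end LinearForms

section BaseTriangle

/-- The plane `x_3 = 0`. -/
def basePlane (k : Type*) [Field k] : Submodule k (V4 k) :=
  LinearMap.ker (LinearMap.proj (R := k) (φ := fun _ : Fin 4 => k) 3)

/-- The sides `x_i = x_3 = 0` of the coordinate triangle in the plane `x_3 = 0`. -/
def baseLine (k : Type*) [Field k] (i : Fin 3) : Submodule k (V4 k) :=
  LinearMap.ker (LinearMap.proj (R := k) (φ := fun _ : Fin 4 => k) i.castSucc) ⊓ basePlane k

/-- The equation `x_i + s x_3` of the planes through the line `baseLine k i`. -/
def pencilForm (i : Fin 3) (s : k) : Module.Dual k (V4 k) :=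
  LinearMap.proj i.castSucc + s • LinearMap.proj 3

variable {i : Fin 3} {s : k} {v : V4 k}

theorem mem_basePlane : v ∈ basePlane k ↔ v 3 = 0 := Iff.rfl

theorem finrank_basePlane : Module.finrank k (basePlane k) = 3 :=
  finrank_ker_eq_three fun h => by simpa using LinearMap.congr_fun h (Pi.single 3 1)

theorem mem_baseLine : v ∈ baseLine k i ↔ v i.castSucc = 0 ∧ v 3 = 0 := Iff.rfl

theorem pencilForm_apply : pencilForm i s v = v i.castSucc + s * v 3 := rfl

theorem baseLine_le_ker_pencilForm : baseLine k i ≤ LinearMap.ker (pencilForm i s) := by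
  intro v hv
  obtain ⟨hi, h3⟩ := mem_baseLine.1 hv
  rw [LinearMap.mem_ker, pencilForm_apply, hi, h3, mul_zero, add_zero]

theorem single_notMem_ker_pencilForm :
    Pi.single i.castSucc 1 ∉ LinearMap.ker (pencilForm i s) := by
  simp [pencilForm_apply, single_castSucc_three]

theorem pencilForm_ne_zero : pencilForm i s ≠ 0 := fun h =>
  single_notMem_ker_pencilForm (i := i) (s := s) (by simp [h])

theorem ker_pencilForm_ne_basePlane : LinearMap.ker (pencilForm i s) ≠ basePlane k := fun h =>
  single_notMem_ker_pencilForm (h ▸ mem_basePlane.2 (single_castSucc_three i 1))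

theorem exists_eq_smul_proj_of_basePlane_le {φ : Module.Dual k (V4 k)}
    (h : basePlane k ≤ LinearMap.ker φ) : ∃ c : k, φ = c • LinearMap.proj 3 := by
  refine ⟨φ (Pi.single 3 1), LinearMap.ext fun v => ?_⟩
  have hv : φ (v - v 3 • Pi.single 3 1) = 0 := h (mem_basePlane.2 (by simp))
  simp only [map_sub, map_smul, smul_eq_mul] at hv
  simp only [LinearMap.smul_apply, LinearMap.proj_apply, smul_eq_mul]
  linear_combination hv

theorem exists_eq_smul_pencilForm {φ : Module.Dual k (V4 k)} (hφ : φ ≠ 0)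
    (hle : baseLine k i ≤ LinearMap.ker φ) (hne : LinearMap.ker φ ≠ basePlane k) :
    ∃ c s : k, c ≠ 0 ∧ φ = c • pencilForm i s := by
  have hsum (v) : φ v = φ (Pi.single i.castSucc 1) * v i.castSucc + φ (Pi.single 3 1) * v 3 := by
    have hv : φ (v - v i.castSucc • Pi.single i.castSucc 1 - v 3 • Pi.single 3 1) = 0 :=
      hle (mem_baseLine.2 ⟨by fin_cases i <;> simp, by simp [single_castSucc_three]⟩)
    simp only [map_sub, map_smul, smul_eq_mul] at hv
    linear_combination hv
  have hc : φ (Pi.single i.castSucc 1) ≠ 0 := by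
    intro hc
    refine hne (Submodule.eq_of_le_of_finrank_eq (fun v hv => ?_) ?_).symm
    · rw [LinearMap.mem_ker, hsum, hc, mem_basePlane.1 hv]
      ring
    · rw [finrank_basePlane, finrank_ker_eq_three hφ]
  refine ⟨_, φ (Pi.single 3 1) / φ (Pi.single i.castSucc 1), hc, LinearMap.ext fun v => ?_⟩
  rw [hsum, LinearMap.smul_apply, pencilForm_apply, smul_eq_mul]
  field_simp

end BaseTriangle

section Quadric

variable {R : Type*} [CommRing R] (A : Matrix (Fin 4) (Fin 4) R) (t : Fin 3 → R)

theorem isHomogeneous_shiftForm (j : Fin 4) : (shiftForm t j).IsHomogeneous 1 := by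
  refine Fin.lastCases (isHomogeneous_X R 3) (fun i => ?_) j
  rw [shiftForm, shift_castSucc]
  exact (isHomogeneous_X R _).add (isHomogeneous_C_mul_X (t i) 3)

theorem isHomogeneous_polarForm (j : Fin 4) : (polarForm A t j).IsHomogeneous 1 := by
  have hp (j) := (A - productMatrix t).toMvPolynomial_isHomogeneous j
  refine Fin.lastCases ?_ (fun i => ?_) j
  · exact (hp 3).sub (IsHomogeneous.sum _ _ _ fun i _ => (hp i.castSucc).C_mul (t i))
  · rw [polarForm, coshift_castSucc]
    exact hp _

theorem isHomogeneous_dotProduct {σ ι : Type*} [Fintype ι] {x p : ι → MvPolynomial σ R} {m n : ℕ}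
    (hx : ∀ j, (x j).IsHomogeneous m) (hp : ∀ j, (p j).IsHomogeneous n) :
    (x ⬝ᵥ p).IsHomogeneous (m + n) :=
  IsHomogeneous.sum _ _ _ fun j _ => (hx j).mul (hp j)

theorem isHomogeneous_cubic : (cubic A).IsHomogeneous 3 :=
  .add (.C_mul (IsHomogeneous.prod _ _ (fun _ => 1) fun _ _ => isHomogeneous_X R _) 2)
    ((isHomogeneous_X R 3).mul
      (isHomogeneous_dotProduct (isHomogeneous_X R) A.toMvPolynomial_isHomogeneous))

theorem isHomogeneous_quarticExpr {σ : Type*} {x p : Fin 4 → MvPolynomial σ R}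
    (hx : ∀ j, (x j).IsHomogeneous 1) (hp : ∀ j, (p j).IsHomogeneous 1) :
    (quarticExpr x p).IsHomogeneous 4 := by
  have hmul {a b c d : MvPolynomial σ R} (ha : a.IsHomogeneous 1) (hb : b.IsHomogeneous 1)
      (hc : c.IsHomogeneous 1) (hd : d.IsHomogeneous 1) : (a * b * (c * d)).IsHomogeneous 4 :=
    (ha.mul hb).mul (hc.mul hd)
  have hmixed (i j : Fin 4) := hmul (hx i) (hx j) (hp i) (hp j)
  refine .sub (.C_mul (.sub (.add ?_ (((hmixed 0 1).add (hmixed 1 2)).add (hmixed 2 0))) ?_) 4)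
    ((isHomogeneous_dotProduct hx hp).pow 2)
  · exact (hx 3).mul (((hp 0).mul (hp 1)).mul (hp 2))
  · exact (((hx 0).mul (hx 1)).mul (hx 2)).mul (hp 3)

theorem isHomogeneous_quartic : (quartic A).IsHomogeneous 4 :=
  isHomogeneous_quarticExpr (isHomogeneous_X R) A.toMvPolynomial_isHomogeneous

/-- The quadric of Cremona's family whose `i`-th plane is `x_i + t_i x_3 = 0`. Its matrix is
`A - productMatrix t`, so that `cubic A = 2 ∏ (x_i + t_i x_3) + x_3 (quadric A t)`. -/
noncomputable def quadric : MvPolynomial (Fin 4) R := shiftForm t ⬝ᵥ polarForm A t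

variable {A} (v u : Fin 4 → R)

theorem isHomogeneous_quadric : (quadric A t).IsHomogeneous 2 :=
  isHomogeneous_dotProduct (isHomogeneous_shiftForm t) (isHomogeneous_polarForm A t)

theorem eval_quadric : eval v (quadric A t) = shift t v ⬝ᵥ polar A t v := by
  simp [quadric, dotProduct, eval_shiftForm, eval_polarForm]

theorem eval_dirDeriv_quadric (hA : A.IsSymm) :
    eval v (dirDeriv u (quadric A t)) = 2 * (shift t u ⬝ᵥ polar A t v) := by
  have h : eval v (dirDeriv u (quadric A t)) =
      shift t v ⬝ᵥ polar A t u + polar A t v ⬝ᵥ shift t u := by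
    simp [quadric, dotProduct, Derivation.leibniz, dirDeriv_shiftForm, dirDeriv_polarForm,
      eval_shiftForm, eval_polarForm, Finset.sum_add_distrib]
  rw [h, shift_dotProduct_polar_comm t v u hA, dotProduct_comm (polar A t v), two_mul]

theorem cubic_eq_add_X_mul_quadric :
    cubic A = 2 * ∏ i : Fin 3, shiftForm t i.castSucc + X 3 * quadric A t :=
  cubic_eq_forms t

theorem eval_cubic_ones (A : Matrix (Fin 4) (Fin 4) R) : eval ![1, 1, 1, 0] (cubic A) = 2 := by
  simp [cubic, Fin.prod_univ_three, map_ofNat]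

end Quadric

section Steinerian

variable {A : Matrix (Fin 4) (Fin 4) k} {t : Fin 3 → k} {v : V4 k}

theorem isSingularAt_quadric_iff [NeZero (2 : k)] (hA : A.IsSymm) :
    IsSingularAt (quadric A t) v ↔ polar A t v = 0 := by
  refine ⟨fun h => polar_eq_of_forall t v hA fun u => ?_, fun h => ⟨?_, fun u => ?_⟩⟩
  · have hu := h.2 u
    rw [eval_dirDeriv_quadric t v u hA, mul_eq_zero_iff_left two_ne_zero] at hu
    rw [shift_dotProduct_polar_comm t v u hA, hu, dotProduct_zero]
  · rw [eval_quadric, h, dotProduct_zero]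
  · rw [eval_dirDeriv_quadric t v u hA, h, dotProduct_zero, mul_zero]

theorem isEquationOf_X_three : IsEquationOf (X 3) (basePlane k) :=
  isEquationOf_iff.2 ⟨isHomogeneous_X k 3, fun v => by rw [eval_X, mem_basePlane]⟩

theorem isEquationOf_shiftForm (t : Fin 3 → k) (i : Fin 3) :
    IsEquationOf (shiftForm t i.castSucc) (LinearMap.ker (pencilForm i (t i))) :=
  isEquationOf_iff.2 ⟨isHomogeneous_shiftForm t _, fun v => by
    rw [eval_shiftForm, shift_castSucc, LinearMap.mem_ker, pencilForm_apply]⟩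

theorem IsEquationOf.exists_eq_C_mul_X_three [Infinite k] {w : Form k}
    (h : IsEquationOf w (basePlane k)) : ∃ e, w = C e * X 3 := by
  obtain ⟨φ, hφ, hker⟩ := h.exists_dual
  obtain ⟨e, rfl⟩ := exists_eq_smul_proj_of_basePlane_le hker.ge
  exact ⟨e, MvPolynomial.funext fun v => by simp [hφ]⟩

theorem IsEquationOf.exists_eq_C_mul_shiftForm [Infinite k] {a : Fin 3 → Form k}
    {P : Fin 3 → Submodule k (V4 k)} (h : ∀ i, IsEquationOf (a i) (P i))
    (hP : ∀ i, Module.finrank k (P i) = 3 ∧ baseLine k i ≤ P i ∧ P i ≠ basePlane k) :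
    ∃ (c t : Fin 3 → k), (∀ i, c i ≠ 0) ∧ ∀ i, a i = C (c i) * shiftForm t i.castSucc := by
  have hi (i) : ∃ c s : k, c ≠ 0 ∧ ∀ v, eval v (a i) = c * (v i.castSucc + s * v 3) := by
    obtain ⟨φ, hφ, hker⟩ := (h i).exists_dual
    obtain ⟨hfin, hle, hne⟩ := hP i
    rw [← hker] at hfin hle hne
    have hφ0 : φ ≠ 0 := by
      rintro rfl
      rw [LinearMap.ker_zero, finrank_top, Module.finrank_fin_fun] at hfin
      lia
    obtain ⟨c, s, hc, rfl⟩ := exists_eq_smul_pencilForm hφ0 hle hne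
    exact ⟨c, s, hc, hφ⟩
  choose c t hc ht using hi
  exact ⟨c, t, hc, fun i => MvPolynomial.funext fun v => by
    rw [ht, map_mul, eval_C, eval_shiftForm, shift_castSucc]⟩

theorem cutsOutResidualConics_quadric [NeZero (2 : k)] (A : Matrix (Fin 4) (Fin 4) k)
    (t : Fin 3 → k) : CutsOutResidualConics (cubic A) (basePlane k) (baseLine k)
      (fun i => LinearMap.ker (pencilForm i (t i))) (quadric A t) := by
  refine ⟨fun i => ⟨finrank_ker_eq_three pencilForm_ne_zero, baseLine_le_ker_pencilForm,
    ker_pencilForm_ne_basePlane⟩, isHomogeneous_quadric t, X 3, fun i => shiftForm t i.castSucc,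
    isEquationOf_X_three, isEquationOf_shiftForm t, ?_⟩
  have hcubic := cubic_eq_add_X_mul_quadric (A := A) t
  have hinv : C 2⁻¹ * (2 : Form k) = 1 := by
    rw [← map_ofNat C 2, ← C_mul, inv_mul_cancel₀ two_ne_zero, C_1]
  refine le_antisymm (Ideal.span_le.2 ?_) (Ideal.span_le.2 ?_) <;>
    simp only [Set.insert_subset_iff, Set.singleton_subset_iff, SetLike.mem_coe]
  · refine ⟨Ideal.subset_span (by simp), Ideal.mem_span_pair.2 ⟨1, -2, ?_⟩⟩
    rw [hcubic]
    ring
  · refine ⟨Ideal.subset_span (by simp), Ideal.mem_span_pair.2 ⟨C 2⁻¹, -C 2⁻¹, ?_⟩⟩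
    rw [hcubic]
    linear_combination (∏ i : Fin 3, shiftForm t i.castSucc) * hinv

theorem CutsOutResidualConics.exists_quadric_eq [Infinite k] {P : Fin 3 → Submodule k (V4 k)}
    {Q : Form k} (h : CutsOutResidualConics (cubic A) (basePlane k) (baseLine k) P Q) :
    ∃ t c, quadric A t = C c * Q := by
  obtain ⟨hP, hQ, w, π, hw, hπ, hspan⟩ := h
  obtain ⟨e, rfl⟩ := hw.exists_eq_C_mul_X_three
  obtain ⟨c, t, hc, hct⟩ := IsEquationOf.exists_eq_C_mul_shiftForm hπ hP
  obtain ⟨a, b, hab⟩ := exists_C_mul_add_C_mul_eq (r := ∏ i, π i) (isHomogeneous_cubic A)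
    (hw.1.mul hQ) (IsHomogeneous.prod _ _ (fun _ => 1) fun i _ => (hπ i).1)
    (hspan ▸ Ideal.subset_span (by simp))
  simp only [hct, Finset.prod_mul_distrib] at hab
  have ha : 2 * a = ∏ i, c i := by
    have hv (i : Fin 3) : (![1, 1, 1, 0] : V4 k) i.castSucc = 1 := by fin_cases i <;> rfl
    simpa [eval_cubic_ones, eval_shiftForm, hv, mul_comm] using congrArg (eval ![1, 1, 1, 0]) hab
  have ha0 : a ≠ 0 := right_ne_zero_of_mul (ha ▸ Finset.prod_ne_zero_iff.2 fun i _ => hc i)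
  rw [← map_prod, ← ha, cubic_eq_add_X_mul_quadric t, C_mul, map_ofNat] at hab
  have hQ : C a * quadric A t = C (-(b * e)) * Q := by
    refine mul_left_cancel₀ (X_ne_zero 3) ?_
    rw [C_neg, C_mul]
    linear_combination hab
  refine ⟨t, a⁻¹ * -(b * e), ?_⟩
  rw [C_mul, mul_assoc, ← hQ, ← mul_assoc, ← C_mul, inv_mul_cancel₀ ha0, C_1, one_mul]

theorem IsSmoothMatrix.quartic_ne_zero [NeZero (2 : k)] (hA : IsSmoothMatrix A) :
    quartic A ≠ 0 := by
  intro h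
  have hf : eval ![1, 1, 1, 0] (cubic A) ≠ 0 := eval_cubic_ones A ▸ two_ne_zero
  obtain ⟨t, ht⟩ := exists_polar_eq_zero hf (by rw [h, map_zero])
  exact hA.not_isSingularAt_quartic hf ht (by simp [h, IsSingularAt])

theorem IsSmoothMatrix.irreducible_quartic [IsAlgClosed k] [NeZero (2 : k)]
    (hA : IsSmoothMatrix A) : Irreducible (quartic A) :=
  irreducible_of_isNodeAt (by simp) (isHomogeneous_quartic A) four_ne_zero hA.quartic_ne_zero
    fun v hv₀ hv => by
      obtain ⟨i, s, hv⟩ := hA.exists_mem_vertexSpace hv hv₀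
      exact hA.isNodeAt_quartic hv hv₀

theorem cubic_ne_zero [NeZero (2 : k)] (A : Matrix (Fin 4) (Fin 4) k) : cubic A ≠ 0 := fun h =>
  two_ne_zero (α := k) (by rw [← eval_cubic_ones A, h, map_zero])

theorem IsSmoothMatrix.quartic_dvd [IsAlgClosed k] [NeZero (2 : k)] (hA : IsSmoothMatrix A)
    {g : Form k} (hg : ∀ t v, v ≠ 0 → polar A t v = 0 → eval v g = 0) : quartic A ∣ g := by
  have hirr := hA.irreducible_quartic
  have hdvd : quartic A ∣ cubic A * g := dvd_of_forall_eval_eq_zero hirr fun v hv => by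
    rw [map_mul, mul_eq_zero, or_iff_not_imp_left]
    intro hf
    obtain ⟨t, ht⟩ := exists_polar_eq_zero hf hv
    refine hg t v (fun h0 => hf ?_) ht
    rw [h0, eval_zero, constantCoeff_eq]
    exact (isHomogeneous_cubic A).coeff_eq_zero (by simp)
  refine (hirr.prime.dvd_or_dvd hdvd).resolve_left fun h => ?_
  have hdeg := totalDegree_le_of_dvd_of_isDomain h (cubic_ne_zero A)
  rw [(isHomogeneous_quartic A).totalDegree hirr.ne_zero,
    (isHomogeneous_cubic A).totalDegree (cubic_ne_zero A)] at hdeg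
  lia

theorem IsSmoothMatrix.steinerian_eq [IsAlgClosed k] [NeZero (2 : k)] (hA : IsSmoothMatrix A) :
    steinerian (cubic A) (basePlane k) (baseLine k) = zeroLocus (quartic A) := by
  have hG := isHomogeneous_quartic A
  refine Set.Subset.antisymm (fun p hp => hp 4 _ hG ?_) fun p hp d g hg hsub => ?_
  · rintro q ⟨P, Q, hPQ, hq⟩
    induction q using Projectivization.ind with
    | h v hv =>
      obtain ⟨hQ₀, hQ⟩ := (mk_mem_singularPoints hPQ.2.1 hv).1 hq
      obtain ⟨t, c, htc⟩ := hPQ.exists_quadric_eq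
      have hpolar : polar A t v = 0 := (isSingularAt_quadric_iff hA.isSymm).1
        (htc ▸ ⟨by simp [hQ₀], fun u => by simp [Derivation.leibniz, hQ]⟩)
      rw [mk_mem_zeroLocus hG, eval_quartic t, hpolar]
      simp [quarticExpr]
  · obtain ⟨r, rfl⟩ := hA.quartic_dvd fun t v hv₀ hv => (mk_mem_zeroLocus hg hv₀).1 <|
      hsub ⟨_, _, cutsOutResidualConics_quadric A t,
        (mk_mem_singularPoints (isHomogeneous_quadric t) hv₀).2
          ((isSingularAt_quadric_iff hA.isSymm).2 hv)⟩
    rw [zeroLocus, Set.mem_ofPred_eq] at hp ⊢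
    rw [map_mul, hp, zero_mul]

end Steinerian

section Determinant

open Polynomial (derivative)

theorem derivative_det {n R : Type*} [Fintype n] [DecidableEq n] [CommRing R]
    (M : Matrix n n (Polynomial R)) :
    derivative M.det = (M.adjugate * M.map derivative).trace := by
  have hcol (i : n) : (M.adjugate * M.map derivative) i i =
      (M.updateCol i fun j => derivative (M j i)).det := by
    rw [← Matrix.cramer_apply, Matrix.cramer_eq_adjugate_mulVec]
    rfl
  simp only [Matrix.trace, Matrix.diag_apply, hcol, Matrix.det_apply]
  rw [Finset.sum_comm, map_sum]
  refine Finset.sum_congr rfl fun σ _ => ?_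
  rw [← Finset.smul_sum, Units.smul_def, Units.smul_def, map_zsmul,
    Polynomial.derivative_prod_finset]
  congr 1
  refine Finset.sum_congr rfl fun i _ => ?_
  rw [← Finset.prod_erase_mul _ _ (Finset.mem_univ i), Matrix.updateCol_self]
  congr 1
  exact Finset.prod_congr rfl fun j hj =>
    (Matrix.updateCol_ne (Finset.ne_of_mem_erase hj)).symm

variable {n : Type*} [Fintype n] [DecidableEq n] {v : n → k}

theorem adjugate_apply_self_ne_zero {M : Matrix n n k} (hM : M.IsSymm) (hv : M.mulVec v = 0)
    (hspan : ∀ u, M.mulVec u = 0 → u ∈ Submodule.span k {v}) {j : n} (hj : v j ≠ 0) :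
    M.adjugate j j ≠ 0 := by
  rw [Matrix.adjugate_apply]
  intro hdet
  obtain ⟨u, hu₀, hu⟩ := Matrix.exists_mulVec_eq_zero_iff.2 hdet
  have huj : u j = 0 := by
    simpa [Matrix.mulVec] using congrFun hu j
  have hne (i : n) (hi : i ≠ j) : M.mulVec u i = 0 := by
    simpa [Matrix.mulVec, hi] using congrFun hu i
  have hpair : v ⬝ᵥ M.mulVec u = 0 := by
    rw [Matrix.dotProduct_mulVec, ← Matrix.mulVec_transpose, hM.eq, hv, zero_dotProduct]
  rw [dotProduct, Finset.sum_eq_single j (fun i _ hi => by rw [hne i hi, mul_zero]) (by simp)]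
    at hpair
  have hMu : M.mulVec u = 0 := funext fun i => by
    rcases eq_or_ne i j with rfl | hi
    exacts [(mul_eq_zero_iff_left hj).1 hpair, hne i hi]
  obtain ⟨r, rfl⟩ := Submodule.mem_span_singleton.1 (hspan u hMu)
  have hr : r = 0 := by simpa [hj] using huj
  simp [hr] at hu₀

theorem exists_adjugate_eq_smul_vecMulVec {M : Matrix n n k} (hM : M.IsSymm)
    (hv : M.mulVec v = 0) (hv₀ : v ≠ 0)
    (hspan : ∀ u, M.mulVec u = 0 → u ∈ Submodule.span k {v}) :
    ∃ c : k, c ≠ 0 ∧ M.adjugate = c • Matrix.vecMulVec v v := by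
  obtain ⟨j, hj⟩ := Function.ne_iff.1 hv₀
  have hdet : M.det = 0 := Matrix.exists_mulVec_eq_zero_iff.1 ⟨v, hv₀, hv⟩
  have hcol (b : n) : ∃ r : k, r • v = fun a => M.adjugate a b :=
    Submodule.mem_span_singleton.1 (hspan _ (funext fun a => by
      simpa [hdet, Matrix.mul_apply] using! congrFun (congrFun M.mul_adjugate a) b))
  choose r hr using hcol
  have happly (a b : n) : M.adjugate a b = r b * v a := (congrFun (hr b) a).symm
  have hr_eq (b : n) : r b = r j / v j * v b := by
    have h : r b * v j = r j * v b := by rw [← happly, ← happly, hM.adjugate.apply]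
    rw [div_mul_eq_mul_div, eq_div_iff hj, h]
  have hc : r j ≠ 0 := left_ne_zero_of_mul (happly j j ▸ adjugate_apply_self_ne_zero hM hv hspan hj)
  refine ⟨r j / v j, div_ne_zero hc hj, ?_⟩
  ext a b
  rw [happly, hr_eq, Matrix.smul_apply, Matrix.vecMulVec_apply, smul_eq_mul]
  ring

theorem eval_derivative_det_ne_zero {M : Matrix n n (Polynomial k)} (hM : M.IsSymm) {s : k}
    (hv : (M.map (Polynomial.eval s)).mulVec v = 0)
    (hspan : ∀ u, (M.map (Polynomial.eval s)).mulVec u = 0 → u ∈ Submodule.span k {v})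
    (hne : v ⬝ᵥ ((M.map derivative).map (Polynomial.eval s)).mulVec v ≠ 0) :
    (derivative M.det).eval s ≠ 0 := by
  have hv₀ : v ≠ 0 := by
    rintro rfl
    simp at hne
  obtain ⟨c, hc, hadj⟩ := exists_adjugate_eq_smul_vecMulVec (hM.map _) hv hv₀ hspan
  have heval : (derivative M.det).eval s = ((M.map (Polynomial.eval s)).adjugate *
      (M.map derivative).map (Polynomial.eval s)).trace := by
    rw [derivative_det, ← Polynomial.coe_evalRingHom, ← RingHom.mapMatrix_apply,
      ← RingHom.mapMatrix_apply, ← RingHom.map_adjugate, ← map_mul, RingHom.mapMatrix_apply,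
      AddMonoidHom.map_trace]
  rw [heval, hadj, Matrix.smul_mul, Matrix.trace_smul, Matrix.vecMulVec_mul,
    Matrix.trace_vecMulVec, dotProduct_comm, ← Matrix.dotProduct_mulVec, smul_eq_mul]
  exact mul_ne_zero hc hne

end Determinant

section ConicMatrix

/-- The symmetric matrix, in the coordinates `x_{i+1}, x_{i+2}, x_3`, of the conic which, besides
a line of `x_3 = 0`, is cut out on `cubic A = 0` by the plane `x_i + s x_3 = 0`, as a polynomial
in `s`. -/
noncomputable def conicMatrix (A : Matrix (Fin 4) (Fin 4) k) (i : Fin 3) :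
    Matrix (Fin 3) (Fin 3) (Polynomial k) :=
  let e : Fin 4 → Fin 4 := ![i.castSucc, (i + 1).castSucc, (i + 2).castSucc, 3]
  let a j l : Polynomial k := .C (A (e j) (e l))
  let s : Polynomial k := .X
  !![a 1 1, a 1 2 - s, a 1 3 - s * a 0 1;
    a 1 2 - s, a 2 2, a 2 3 - s * a 0 2;
    a 1 3 - s * a 0 1, a 2 3 - s * a 0 2, a 3 3 - 2 * s * a 0 3 + s ^ 2 * a 0 0]

/-- The coordinates on the planes `x_i + s x_3 = 0` in which `conicMatrix` is written. -/
def planeCoord (i : Fin 3) : V4 k →ₗ[k] (Fin 3 → k) :=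
  LinearMap.funLeft k k ![(i + 1).castSucc, (i + 2).castSucc, 3]

theorem planeCoord_apply (i : Fin 3) (v : V4 k) :
    planeCoord i v = ![v (i + 1).castSucc, v (i + 2).castSucc, v 3] := by
  ext j
  fin_cases j <;> rfl

theorem exists_planeCoord_eq (i : Fin 3) (s : k) (u : Fin 3 → k) :
    ∃ v : V4 k, v i.castSucc + s * v 3 = 0 ∧ planeCoord i v = u := by
  simp only [planeCoord_apply]
  fin_cases i
  · exact ⟨![-(s * u 2), u 0, u 1, u 2], neg_add_cancel _, List.ofFn_inj.1 rfl⟩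
  · exact ⟨![u 1, -(s * u 2), u 0, u 2], neg_add_cancel _, List.ofFn_inj.1 rfl⟩
  · exact ⟨![u 0, u 1, -(s * u 2), u 2], neg_add_cancel _, List.ofFn_inj.1 rfl⟩

variable {A : Matrix (Fin 4) (Fin 4) k} {v : V4 k} {i : Fin 3} {s : k}

theorem eq_zero_of_planeCoord_eq_zero (h₀ : v i.castSucc + s * v 3 = 0)
    (h : planeCoord i v = 0) : v = 0 := by
  rw [planeCoord_apply] at h
  have h₁ : v (i + 1).castSucc = 0 := congrFun h 0
  have h₂ : v (i + 2).castSucc = 0 := congrFun h 1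
  have h₃ : v 3 = 0 := congrFun h 2
  exact eq_zero_of_castSucc (forall_of_rotate i (by simpa [h₃] using h₀) h₁ h₂) h₃

theorem isSymm_conicMatrix (A : Matrix (Fin 4) (Fin 4) k) (i : Fin 3) :
    (conicMatrix A i).IsSymm := by
  ext j l
  fin_cases j <;> fin_cases l <;> rfl

theorem natDegree_det_conicMatrix (h : A i.castSucc i.castSucc ≠ 0) :
    (conicMatrix A i).det.natDegree = 4 := by
  rw [Matrix.det_fin_three]
  simp only [conicMatrix, Matrix.of_apply, Matrix.cons_val]
  compute_degree
  · simpa using h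
  all_goals norm_num

theorem mulVec_apply_rotate (A : Matrix (Fin 4) (Fin 4) k) (v : V4 k) (i : Fin 3) (j : Fin 4) :
    A.mulVec v j = A j i.castSucc * v i.castSucc + A j (i + 1).castSucc * v (i + 1).castSucc +
      A j (i + 2).castSucc * v (i + 2).castSucc + A j 3 * v 3 :=
  dotProduct_rotate (A j) v i

theorem conicMatrix_mulVec (hA : A.IsSymm) (h₀ : v i.castSucc + s * v 3 = 0) :
    ((conicMatrix A i).map (Polynomial.eval s)).mulVec (planeCoord i v) =
      ![A.mulVec v (i + 1).castSucc - s * v (i + 2).castSucc,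
        A.mulVec v (i + 2).castSucc - s * v (i + 1).castSucc,
        A.mulVec v 3 - s * A.mulVec v i.castSucc] := by
  have hi (j : Fin 4) : A j i.castSucc = A i.castSucc j := hA.apply _ _
  have hv := eq_neg_of_add_eq_zero_left h₀
  rw [planeCoord_apply]
  ext j
  fin_cases j <;>
    simp [conicMatrix, mulVec_apply_rotate A v i, Matrix.mulVec_eq_sum, Fin.sum_univ_three, hv,
      hi, hA.apply 3 (i + 1).castSucc, hA.apply 3 (i + 2).castSucc,
      hA.apply (i + 2).castSucc (i + 1).castSucc] <;>
    ring

theorem mem_vertexSpace_iff_conicMatrix (hA : A.IsSymm) : v ∈ vertexSpace A i s ↔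
    v i.castSucc + s * v 3 = 0 ∧
      ((conicMatrix A i).map (Polynomial.eval s)).mulVec (planeCoord i v) = 0 := by
  refine and_congr_right fun h₀ => ?_
  simp [conicMatrix_mulVec hA h₀, funext_iff, Fin.forall_fin_succ, sub_eq_zero]

theorem vertexSpace_ne_bot_iff_isRoot (hA : A.IsSymm) :
    vertexSpace A i s ≠ ⊥ ↔ (conicMatrix A i).det.IsRoot s := by
  rw [Polynomial.IsRoot, ← Polynomial.coe_evalRingHom, RingHom.map_det,
    ← Matrix.exists_mulVec_eq_zero_iff, Submodule.ne_bot_iff]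
  constructor
  · rintro ⟨v, hv, hv₀⟩
    obtain ⟨h₀, hv⟩ := (mem_vertexSpace_iff_conicMatrix hA).1 hv
    exact ⟨planeCoord i v, fun h => hv₀ (eq_zero_of_planeCoord_eq_zero h₀ h), hv⟩
  · rintro ⟨u, hu₀, hu⟩
    obtain ⟨v, h₀, rfl⟩ := exists_planeCoord_eq i s u
    refine ⟨v, (mem_vertexSpace_iff_conicMatrix hA).2 ⟨h₀, hu⟩, ?_⟩
    rintro rfl
    simp at hu₀

theorem planeCoord_dotProduct_derivative_conicMatrix (h₀ : v i.castSucc + s * v 3 = 0) :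
    planeCoord i v ⬝ᵥ (((conicMatrix A i).map Polynomial.derivative).map
      (Polynomial.eval s)).mulVec (planeCoord i v) = -(2 * halfPartial A v i) := by
  have hv := eq_neg_of_add_eq_zero_left h₀
  simp [planeCoord_apply, conicMatrix, halfPartial, mulVec_apply_rotate A v i,
    Matrix.mulVec_eq_sum, dotProduct, Fin.sum_univ_three, hv]
  ring

section Smooth

variable [IsAlgClosed k] [NeZero (2 : k)] (hA : IsSmoothMatrix A)

include hA

theorem IsSmoothMatrix.eval_derivative_det_conicMatrix_ne_zero (h : vertexSpace A i s ≠ ⊥) :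
    (conicMatrix A i).det.derivative.eval s ≠ 0 := by
  obtain ⟨v, hv, hv₀⟩ := (Submodule.ne_bot_iff _).1 h
  obtain ⟨h₀, hker⟩ := (mem_vertexSpace_iff_conicMatrix hA.isSymm).1 hv
  refine eval_derivative_det_ne_zero (isSymm_conicMatrix A i) hker (fun u hu => ?_) ?_
  · obtain ⟨u, h₀', rfl⟩ := exists_planeCoord_eq i s u
    obtain ⟨r, rfl⟩ := Submodule.mem_span_singleton.1 (hA.mem_span_of_mem_vertexSpace
      ((mem_vertexSpace_iff_conicMatrix hA.isSymm).2 ⟨h₀', hu⟩) hv hv₀)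
    exact Submodule.mem_span_singleton.2 ⟨r, (map_smul _ _ _).symm⟩
  · rw [planeCoord_dotProduct_derivative_conicMatrix h₀]
    exact neg_ne_zero.2 (mul_ne_zero two_ne_zero (hA.halfPartial_ne_zero hv hv₀))

theorem IsSmoothMatrix.ncard_vertexSpace_ne_bot (i : Fin 3) :
    {s | vertexSpace A i s ≠ ⊥}.ncard = 4 := by
  classical
  have hdeg := natDegree_det_conicMatrix (hA.diag_ne_zero i)
  have h₀ : (conicMatrix A i).det ≠ 0 := Polynomial.ne_zero_of_natDegree_gt (hdeg ▸ four_pos)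
  have hroots : {s | vertexSpace A i s ≠ ⊥} = ((conicMatrix A i).det.roots.toFinset : Set k) := by
    ext s
    simp [vertexSpace_ne_bot_iff_isRoot hA.isSymm, h₀]
  have hnodup : (conicMatrix A i).det.roots.Nodup := by
    refine Multiset.nodup_iff_count_le_one.2 fun s => not_lt.1 fun hlt => ?_
    rw [Polynomial.count_roots, Polynomial.one_lt_rootMultiplicity_iff_isRoot h₀] at hlt
    exact hA.eval_derivative_det_conicMatrix_ne_zero
      ((vertexSpace_ne_bot_iff_isRoot hA.isSymm).2 hlt.1) hlt.2
  rw [hroots, Set.ncard_coe_finset, Multiset.toFinset_card_of_nodup hnodup,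
    IsAlgClosed.card_roots_eq_natDegree, hdeg]

end Smooth

end ConicMatrix

section Split

theorem exists_mul_eq_of_finrank_quotient_eq_two [IsAlgClosed k] [NeZero (2 : k)] {V : Type*}
    [AddCommGroup V] [Module k V] {B : LinearMap.BilinForm k V} (hB : B.IsSymm)
    {W : Submodule k V} (hW : W ≤ LinearMap.ker B) (h : Module.finrank k (V ⧸ W) = 2) :
    ∃ α β : Module.Dual k V, ∀ v, B v v = α v * β v := by
  have : Module.Finite k (V ⧸ W) := Module.finite_of_finrank_eq_succ h
  let b := Module.finBasisOfFinrankEq k (V ⧸ W) h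
  obtain ⟨e, he⟩ : ∃ e : Fin 2 → V, ∀ i, W.mkQ (e i) = b i :=
    ⟨fun i => (W.mkQ_surjective (b i)).choose, fun i => (W.mkQ_surjective (b i)).choose_spec⟩
  let x (i : Fin 2) : Module.Dual k V := b.coord i ∘ₗ W.mkQ
  have hker (v w : V) (hv : W.mkQ v = W.mkQ w) : B v v = B w w := by
    have hsub : B (v - w) = 0 := hW ((Submodule.Quotient.eq W).1 hv)
    have hvw : B v = B w := by rwa [map_sub, sub_eq_zero] at hsub
    rw [hvw, hB.eq w v, hvw]
  have hform (v : V) : B v v = B (e 0) (e 0) * (x 0 v * x 0 v) +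
      2 * B (e 0) (e 1) * (x 0 v * x 1 v) + B (e 1) (e 1) * (x 1 v * x 1 v) := by
    have hv : W.mkQ v = W.mkQ (x 0 v • e 0 + x 1 v • e 1) := by
      rw [map_add, map_smul, map_smul, he, he, ← Fin.sum_univ_two fun i => x i v • b i]
      exact (b.sum_repr _).symm
    have hsymm : B (e 1) (e 0) = B (e 0) (e 1) := hB.eq _ _
    rw [hker _ _ hv]
    simp only [map_add, map_smul, LinearMap.add_apply, LinearMap.smul_apply, smul_eq_mul, hsymm]
    ring
  by_cases h₀ : B (e 0) (e 0) = 0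
  · refine ⟨x 1, (2 * B (e 0) (e 1)) • x 0 + B (e 1) (e 1) • x 1, fun v => ?_⟩
    rw [hform]
    simp only [h₀, LinearMap.add_apply, LinearMap.smul_apply, smul_eq_mul]
    ring
  · obtain ⟨d, hd⟩ := IsAlgClosed.exists_eq_mul_self
      (discrim (B (e 0) (e 0)) (2 * B (e 0) (e 1)) (B (e 1) (e 1)))
    obtain ⟨r, hr⟩ := exists_quadratic_eq_zero h₀ ⟨d, hd⟩
    refine ⟨x 0 - r • x 1, B (e 0) (e 0) • (x 0 + r • x 1) + (2 * B (e 0) (e 1)) • x 1,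
      fun v => ?_⟩
    rw [hform]
    simp only [LinearMap.add_apply, LinearMap.sub_apply, LinearMap.smul_apply, smul_eq_mul]
    linear_combination x 1 v * x 1 v * hr

/-- The quadric with parameters `t` of Cremona's family is the pair of planes `α β = 0`. -/
def IsSplit (A : Matrix (Fin 4) (Fin 4) k) (t : Fin 3 → k) (α β : Module.Dual k (V4 k)) : Prop :=
  ∀ v, eval v (quadric A t) = α v * β v

variable {A : Matrix (Fin 4) (Fin 4) k} {t : Fin 3 → k} {α β : Module.Dual k (V4 k)} {v : V4 k}
  {i : Fin 3} {s : k}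

theorem eval_quadric_eq_dotProduct_mulVec (t : Fin 3 → k) (v : V4 k) :
    eval v (quadric A t) = v ⬝ᵥ (A - productMatrix t).mulVec v := by
  rw [eval_quadric, polar, shift_dotProduct_coshift]

theorem IsSplit.symm (h : IsSplit A t α β) : IsSplit A t β α := fun v => by
  rw [h, mul_comm]

theorem exists_ne_zero_forall_apply_eq_zero {V ι : Type*} [AddCommGroup V] [Module k V]
    [FiniteDimensional k V] [Fintype ι] (φ : ι → Module.Dual k V)
    (h : Fintype.card ι < Module.finrank k V) : ∃ v ≠ 0, ∀ i, φ i v = 0 := by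
  have hker := LinearMap.ker_ne_bot_of_finrank_lt (f := LinearMap.pi φ) (by simpa using h)
  obtain ⟨v, hv, hv₀⟩ := (Submodule.ne_bot_iff _).1 hker
  exact ⟨v, hv₀, congrFun hv⟩

theorem polar_eq_zero_of_mem_vertexSpace (hv : v ∈ vertexSpace A i (t i)) {j : Fin 3}
    (hj : j ≠ i) : polar A t v j.castSucc = 0 := by
  obtain ⟨-, h₁, h₂, -⟩ := mem_vertexSpace_iff.1 hv
  rcases eq_add_one_or_eq_add_two hj with rfl | rfl
  exacts [h₁, h₂]

theorem polar_eq_zero_iff_of_mem_vertexSpace (hv : v ∈ vertexSpace A i (t i)) :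
    polar A t v = 0 ↔ polar A t v i.castSucc = 0 := by
  refine ⟨fun h => by rw [h, Pi.zero_apply], fun h => funext fun j => ?_⟩
  refine Fin.lastCases (mem_vertexSpace_iff.1 hv).2.2.2 (fun j => ?_) j
  rcases eq_or_ne j i with rfl | hj
  exacts [h, polar_eq_zero_of_mem_vertexSpace hv hj]

theorem exists_rotate_eq {R : Type*} (i : Fin 3) (a b c : R) :
    ∃ t : Fin 3 → R, t i = a ∧ t (i + 1) = b ∧ t (i + 2) = c :=
  ⟨fun j => ![a, b, c] (j - i), by simp⟩

theorem exists_isSplit_of_polar_eq_zero [IsAlgClosed k] [NeZero (2 : k)] (hA : A.IsSymm)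
    {u : V4 k} (hv : polar A t v = 0) (hu : polar A t u = 0)
    (hind : LinearIndependent k ![v, u]) : ∃ α β, IsSplit A t α β := by
  have hM : (A - productMatrix t).IsSymm := hA.sub (isSymm_productMatrix t)
  have hB : (Matrix.toBilin' (A - productMatrix t)).IsSymm :=
    Matrix.isSymm_toBilin'_iff_isSymm.2 hM
  have hker {w : V4 k} (hw : polar A t w = 0) :
      w ∈ LinearMap.ker (Matrix.toBilin' (A - productMatrix t)) := LinearMap.ext fun x => by
    rw [← hB.eq x w, Matrix.toBilin'_apply', polar_eq_zero_iff.1 hw]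
    simp
  let W := Submodule.span k (Set.range ![v, u])
  have hW : W ≤ LinearMap.ker (Matrix.toBilin' (A - productMatrix t)) := by
    refine Submodule.span_le.2 ?_
    rintro _ ⟨j, rfl⟩
    fin_cases j
    exacts [hker hv, hker hu]
  have hquot : Module.finrank k (V4 k ⧸ W) = 2 := by
    have hadd := W.finrank_quotient_add_finrank
    rw [finrank_span_eq_card hind] at hadd
    simpa using hadd
  obtain ⟨α, β, h⟩ := exists_mul_eq_of_finrank_quotient_eq_two hB hW hquot
  exact ⟨α, β, fun w => by rw [eval_quadric_eq_dotProduct_mulVec, ← h, Matrix.toBilin'_apply']⟩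

section Smooth

variable [NeZero (2 : k)]

theorem IsSplit.polar_eq_zero (h : IsSplit A t α β) (hA : A.IsSymm) (hα : α v = 0)
    (hβ : β v = 0) : polar A t v = 0 := by
  refine polar_eq_zero_iff.2 (dotProduct_eq_zero _ fun u => ?_)
  have hsymm : v ⬝ᵥ (A - productMatrix t).mulVec u = (A - productMatrix t).mulVec v ⬝ᵥ u := by
    have hM : (A - productMatrix t).IsSymm := hA.sub (isSymm_productMatrix t)
    rw [Matrix.dotProduct_mulVec, ← Matrix.mulVec_transpose, hM.eq]
  have hu := h u
  have hv := h v
  have huv := h (v + u)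
  simp only [eval_quadric_eq_dotProduct_mulVec, Matrix.mulVec_add, dotProduct_add, add_dotProduct,
    map_add, hα, hβ] at hu hv huv
  refine (mul_eq_zero_iff_left (two_ne_zero (α := k))).1 ?_
  rw [dotProduct_comm u, hsymm] at huv
  linear_combination huv - hu - hv

theorem IsSplit.exists_mem_vertexSpace (h : IsSplit A t α β) (hA : A.IsSymm) (i : Fin 3) :
    ∃ n ∈ vertexSpace A i (t i), n ≠ 0 ∧ α n = 0 ∧ β n = 0 := by
  obtain ⟨n, hn₀, hn⟩ :=
    exists_ne_zero_forall_apply_eq_zero ![pencilForm i (t i), α, β] (by simp)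
  have hα : α n = 0 := hn 1
  have hβ : β n = 0 := hn 2
  have hX : pencilForm i (t i) n = 0 := hn 0
  rw [pencilForm_apply, ← shift_castSucc] at hX
  exact ⟨n, mem_vertexSpace_of_polar_eq_zero hX (h.polar_eq_zero hA hα hβ), hn₀, hα, hβ⟩

namespace IsSmoothMatrix

variable (hA : IsSmoothMatrix A)

include hA

theorem shift_ne_zero_of_polar_eq_zero (hv : v ∈ vertexSpace A i (t i)) (hv₀ : v ≠ 0)
    (hp : polar A t v = 0) {j : Fin 3} (hj : j ≠ i) : shift t v j.castSucc ≠ 0 := fun hX =>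
  hj (hA.eq_and_eq_of_mem_vertexSpace (mem_vertexSpace_of_polar_eq_zero hX hp) hv hv₀).1

theorem apply_eq_zero_and_iff_of_isSplit [IsAlgClosed k] (h : IsSplit A t α β)
    (hv : v ∈ vertexSpace A i s) (hv₀ : v ≠ 0) : α v = 0 ∧ β v = 0 ↔ t i = s := by
  constructor
  · rintro ⟨hα, hβ⟩
    have hp := h.polar_eq_zero hA.isSymm hα hβ
    have hf := eval_cubic_of_mem_vertexSpace hv
    rw [eval_cubic t, hp, dotProduct_zero, mul_zero, add_zero,
      mul_eq_zero_iff_left two_ne_zero, Finset.prod_eq_zero_iff] at hf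
    obtain ⟨j, -, hj⟩ := hf
    obtain ⟨rfl, hs⟩ :=
      hA.eq_and_eq_of_mem_vertexSpace (mem_vertexSpace_of_polar_eq_zero hj hp) hv hv₀
    exact hs
  · rintro rfl
    obtain ⟨n, hn, hn₀, hα, hβ⟩ := h.exists_mem_vertexSpace hA.isSymm i
    obtain ⟨c, rfl⟩ := Submodule.mem_span_singleton.1 (hA.mem_span_of_mem_vertexSpace hv hn hn₀)
    simp [hα, hβ]

theorem eq_of_isSplit_of_ker_inf_ker_le [IsAlgClosed k] {t' : Fin 3 → k}
    {α' β' : Module.Dual k (V4 k)} (h : IsSplit A t α β) (h' : IsSplit A t' α' β')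
    (hle : LinearMap.ker α ⊓ LinearMap.ker β ≤ LinearMap.ker α' ⊓ LinearMap.ker β') : t = t' := by
  funext i
  obtain ⟨n, hn, hn₀, hα, hβ⟩ := h.exists_mem_vertexSpace hA.isSymm i
  exact ((hA.apply_eq_zero_and_iff_of_isSplit h' hn hn₀).1 (hle ⟨hα, hβ⟩)).symm

theorem eq_of_isSplit [IsAlgClosed k] {t' : Fin 3 → k} {α' β' : Module.Dual k (V4 k)}
    (h : IsSplit A t α β) (h' : IsSplit A t' α' β') (h₀ : t i = t' i)
    (h₁ : t (i + 1) = t' (i + 1)) : t = t' := by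
  obtain ⟨n, hn, hn₀, hα, hβ⟩ := h.exists_mem_vertexSpace hA.isSymm i
  obtain ⟨hα', hβ'⟩ := (hA.apply_eq_zero_and_iff_of_isSplit h' hn hn₀).2 h₀.symm
  have hp := h.polar_eq_zero hA.isSymm hα hβ
  have hp' := h'.polar_eq_zero hA.isSymm hα' hβ'
  have hX' := hA.shift_ne_zero_of_polar_eq_zero hn hn₀ hp (j := i + 1) (by simp)
  have hpi := congrFun hp i.castSucc
  have hpi' := congrFun hp' i.castSucc
  rw [polar_castSucc, Pi.zero_apply] at hpi hpi'
  rw [← h₁] at hpi'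
  rw [shift_castSucc] at hX'
  refine funext (forall_of_rotate i h₀ h₁ (sub_eq_zero.1 ?_))
  refine (mul_eq_zero_iff_right hX').1 ?_
  linear_combination hpi' - hpi

theorem eq_zero_of_shift_eq_zero {l : Fin 3} (h : ∀ j ≠ l, shift t v j.castSucc = 0)
    (h₃ : v 3 = 0) (hp : polar A t v l.castSucc = 0) : v = 0 := by
  have hv (j) (hj : j ≠ l) : v j.castSucc = 0 := by simpa [h₃] using h j hj
  have h₁ := hv (l + 1) (by simp)
  have h₂ := hv (l + 2) (by simp)
  have hl : v l.castSucc = 0 := by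
    rw [polar_castSucc, mulVec_apply_rotate A v l, h₁, h₂, h₃] at hp
    exact (mul_eq_zero_iff_left (hA.diag_ne_zero l)).1 (by linear_combination hp)
  exact eq_zero_of_castSucc (forall_of_rotate l hl h₁ h₂) h₃

theorem shift_ne_zero_of_mem_vertexSpace {j : Fin 3} {u : V4 k} (hj : j ≠ i)
    (hv : v ∈ vertexSpace A i (t i)) (hv₀ : v ≠ 0) (hu : u ∈ vertexSpace A j (t j))
    (hu₀ : u ≠ 0) : shift t v j.castSucc ≠ 0 := by
  intro hX
  have hp : polar A t v i.castSucc ≠ 0 := fun h => hA.shift_ne_zero_of_polar_eq_zero hv hv₀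
    ((polar_eq_zero_iff_of_mem_vertexSpace hv).2 h) hj hX
  have hXu : shift t u i.castSucc = 0 := by
    have hcomm := shift_dotProduct_polar_comm t v u hA.isSymm
    rw [shift_dotProduct_polar_of_mem_vertexSpace hv,
      shift_dotProduct_polar_of_mem_vertexSpace hu, hX, zero_mul] at hcomm
    exact (mul_eq_zero_iff_right hp).1 hcomm.symm
  obtain ⟨l, hli, hlj, hl⟩ : ∃ l, l ≠ i ∧ l ≠ j ∧ ∀ m, m ≠ l → m = i ∨ m = j := by
    clear * - hj
    revert i j
    decide
  have hXv (m) (hm : m ≠ l) : shift t v m.castSucc = 0 := by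
    rcases hl m hm with rfl | rfl
    exacts [(mem_vertexSpace_iff.1 hv).1, hX]
  have hXu (m) (hm : m ≠ l) : shift t u m.castSucc = 0 := by
    rcases hl m hm with rfl | rfl
    exacts [hXu, (mem_vertexSpace_iff.1 hu).1]
  have hpv := polar_eq_zero_of_mem_vertexSpace hv hli
  have hpu := polar_eq_zero_of_mem_vertexSpace hu hlj
  have hv₃ : v 3 ≠ 0 := fun h => hv₀ (hA.eq_zero_of_shift_eq_zero hXv h hpv)
  have huv : u 3 • v - v 3 • u = 0 := by
    refine hA.eq_zero_of_shift_eq_zero (t := t) (l := l) (fun m hm => ?_) (by simp [mul_comm]) ?_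
    · have h₁ := hXv m hm
      have h₂ := hXu m hm
      rw [shift_castSucc] at h₁ h₂ ⊢
      simp only [Pi.sub_apply, Pi.smul_apply, smul_eq_mul]
      linear_combination u 3 * h₁ - v 3 * h₂
    · rw [polar_castSucc] at hpv hpu ⊢
      simp only [Matrix.mulVec_sub, Matrix.mulVec_smul, Pi.sub_apply, Pi.smul_apply, smul_eq_mul]
      linear_combination u 3 * hpv - v 3 * hpu
  have hu' : u ∈ vertexSpace A i (t i) := by
    rw [← (vertexSpace A i (t i)).smul_mem_iff hv₃, ← sub_eq_zero.1 huv]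
    exact Submodule.smul_mem _ _ hv
  exact hj (hA.eq_and_eq_of_mem_vertexSpace hu hu' hu₀).1

theorem exists_isSplit [IsAlgClosed k] {r : k} {u : V4 k} (hv : v ∈ vertexSpace A i s)
    (hv₀ : v ≠ 0) (hu : u ∈ vertexSpace A (i + 1) r) (hu₀ : u ≠ 0) :
    ∃ t α β, IsSplit A t α β ∧ t i = s ∧ t (i + 1) = r := by
  obtain ⟨t, rfl, rfl, hpv⟩ : ∃ t : Fin 3 → k, t i = s ∧ t (i + 1) = r ∧ polar A t v = 0 := by
    obtain ⟨t, rfl, rfl, -⟩ := exists_rotate_eq i s r 0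
    have hX := hA.shift_ne_zero_of_mem_vertexSpace (j := i + 1) (by simp) hv hv₀ hu hu₀
    obtain ⟨t', h₀, h₁, h₂⟩ := exists_rotate_eq i (t i) (t (i + 1))
      ((A.mulVec v i.castSucc - t (i + 1) * v (i + 2).castSucc) / shift t v (i + 1).castSucc)
    rw [← h₀] at hv
    refine ⟨t', h₀, h₁, (polar_eq_zero_iff_of_mem_vertexSpace hv).2 ?_⟩
    rw [eq_div_iff hX, shift_castSucc] at h₂
    rw [polar_castSucc, h₁]
    linear_combination -h₂
  have hX := hA.shift_ne_zero_of_mem_vertexSpace (j := i + 1) (by simp) hv hv₀ hu hu₀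
  have hpu : polar A t u = 0 := by
    have hcomm := shift_dotProduct_polar_comm t v u hA.isSymm
    rw [hpv, dotProduct_zero, shift_dotProduct_polar_of_mem_vertexSpace hu] at hcomm
    exact (polar_eq_zero_iff_of_mem_vertexSpace hu).2 ((mul_eq_zero_iff_left hX).1 hcomm)
  have hind : LinearIndependent k ![v, u] := (LinearIndependent.pair_iff' hv₀).2 fun c hc => by
    have hu' : u ∈ vertexSpace A i (t i) := hc ▸ Submodule.smul_mem _ c hv
    simpa using (hA.eq_and_eq_of_mem_vertexSpace hu hu' hu₀).1
  obtain ⟨α, β, h⟩ := exists_isSplit_of_polar_eq_zero hA.isSymm hpv hpu hind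
  exact ⟨t, α, β, h, rfl, rfl⟩

end IsSmoothMatrix

end Smooth

end Split

section Hyperplanes

theorem exists_ker_of_finrank_eq_three {W : Submodule k (V4 k)} (h : Module.finrank k W = 3) :
    ∃ φ : Module.Dual k (V4 k), φ ≠ 0 ∧ W = LinearMap.ker φ := by
  have hlt : W < ⊤ := lt_top_iff_ne_top.2 fun hW => by
    rw [hW, finrank_top, Module.finrank_fin_fun] at h
    lia
  obtain ⟨φ, hφ, hle⟩ := W.exists_le_ker_of_lt_top hlt
  exact ⟨φ, hφ, Submodule.eq_of_le_of_finrank_eq hle (by rw [h, finrank_ker_eq_three hφ])⟩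

theorem finrank_inf_eq_two {U W : Submodule k (V4 k)} (hU : Module.finrank k U = 3)
    (hW : Module.finrank k W = 3) (h : U ≠ W) :
    Module.finrank k (U ⊓ W : Submodule k (V4 k)) = 2 := by
  have hadd := Submodule.finrank_sup_add_finrank_inf_eq U W
  have hlt : U < U ⊔ W := left_lt_sup.2 fun hle =>
    h (Submodule.eq_of_le_of_finrank_eq hle (by rw [hU, hW])).symm
  have hlt' := Submodule.finrank_lt_finrank_of_lt hlt
  have hle := Submodule.finrank_le (U ⊔ W)
  rw [Module.finrank_fin_fun] at hle
  lia

theorem finrank_baseLine (i : Fin 3) : Module.finrank k (baseLine k i) = 2 :=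
  finrank_inf_eq_two
    (finrank_ker_eq_three fun h => by simpa using LinearMap.congr_fun h (Pi.single i.castSucc 1))
    finrank_basePlane fun h => by
      have hmem := mem_basePlane.2 (single_castSucc_three i (1 : k))
      rw [← h] at hmem
      simp at hmem

variable {V : Type*} [AddCommGroup V] [Module k V] {W : Submodule k V}

theorem exists_le_ker_of_prod_eq_zero [Infinite k] {ι : Type*} [Fintype ι]
    {φ : ι → Module.Dual k V} (h : ∀ v ∈ W, ∏ i, φ i v = 0) : ∃ i, W ≤ LinearMap.ker (φ i) := by
  obtain ⟨i, hi⟩ := Subspace.exists_eq_top_of_iUnion_eq_univ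
    (p := fun i => (LinearMap.ker (φ i)).comap W.subtype) <| Set.eq_univ_of_forall fun v => by
      obtain ⟨i, -, hi⟩ := Finset.prod_eq_zero_iff.1 (h v v.2)
      exact Set.mem_iUnion.2 ⟨i, hi⟩
  exact ⟨i, Submodule.comap_subtype_eq_top.1 hi⟩

theorem exists_eq_mul_of_eq_zero_of_eq_zero {Q : QuadraticForm k V} {φ ψ : Module.Dual k V}
    (hφ : ∀ v ∈ W, φ v = 0 → Q v = 0) (hψ : ∀ v ∈ W, ψ v = 0 → Q v = 0)
    (h₁ : ∃ u ∈ W, φ u = 0 ∧ ψ u ≠ 0) (h₂ : ∃ u ∈ W, ψ u = 0 ∧ φ u ≠ 0) :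
    ∃ c, ∀ v ∈ W, Q v = c * (φ v * ψ v) := by
  obtain ⟨u, hu, hφu, hψu⟩ := h₁
  obtain ⟨u', hu', hψu', hφu'⟩ := h₂
  refine ⟨QuadraticMap.polar Q u u' / (φ u' * ψ u), fun v hv => ?_⟩
  obtain ⟨r, hr⟩ : ∃ r, r = v - (φ v / φ u') • u' - (ψ v / ψ u) • u := ⟨_, rfl⟩
  have hrW : r ∈ W := hr ▸ W.sub_mem (W.sub_mem hv (W.smul_mem _ hu')) (W.smul_mem _ hu)
  have hφr : φ r = 0 := by simp [hr, hφu, hφu']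
  have hψr : ψ r = 0 := by simp [hr, hψu', hψu]
  have hpolar : QuadraticMap.polar Q r u' = 0 := by
    rw [QuadraticMap.polar, hψ _ (W.add_mem hrW hu') (by simp [hψr, hψu']), hψ _ hrW hψr,
      hψ _ hu' hψu', sub_zero, sub_zero]
  have hQ : Q (r + (ψ v / ψ u) • u) = 0 :=
    hφ _ (W.add_mem hrW (W.smul_mem _ hu)) (by simp [hφr, hφu])
  have hv' : v = (r + (ψ v / ψ u) • u) + (φ v / φ u') • u' := by rw [hr]; abel
  conv_lhs => rw [hv', QuadraticMap.map_add Q, hQ, QuadraticMap.map_smul, hψ _ hu' hψu',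
    QuadraticMap.polar_smul_right, QuadraticMap.polar_add_left, hpolar,
    QuadraticMap.polar_smul_left]
  simp only [smul_eq_mul]
  field_simp
  ring

theorem eq_zero_of_forall_eq_zero [Infinite k] {Q : QuadraticForm k V}
    {φ : Fin 3 → Module.Dual k V} (hφ : ∀ i, ∀ v ∈ W, φ i v = 0 → Q v = 0)
    (h : ∀ i j, i ≠ j → ∃ u ∈ W, φ i u = 0 ∧ φ j u ≠ 0) : ∀ v ∈ W, Q v = 0 := by
  obtain ⟨c, hc⟩ := exists_eq_mul_of_eq_zero_of_eq_zero (hφ 0) (hφ 1) (h 0 1 (by decide))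
    (h 1 0 (by decide))
  obtain ⟨u, hu, h₀⟩ : ∃ u ∈ W ⊓ LinearMap.ker (φ 2), φ 0 u * φ 1 u ≠ 0 := by
    by_contra! hne
    obtain ⟨i, hi⟩ := exists_le_ker_of_prod_eq_zero (φ := fun i : Fin 2 => φ i.castSucc)
      fun v hv => (Fin.prod_univ_two _).trans (hne v hv)
    obtain ⟨u, hu, h₂, hne⟩ := h 2 i.castSucc (Fin.castSucc_lt_last i).ne'
    exact hne (hi ⟨hu, h₂⟩)
  have hcu := hc u hu.1
  rw [hφ 2 u hu.1 hu.2, eq_comm, mul_eq_zero_iff_right h₀] at hcu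
  intro v hv
  rw [hc v hv, hcu, zero_mul]

end Hyperplanes

section TrihedralPairs

theorem isSingularAt_prod {σ R ι : Type*} [CommRing R] [Fintype ι] {g : ι → MvPolynomial σ R}
    {v : σ → R} {i j : ι} (hij : i ≠ j) (hi : eval v (g i) = 0) (hj : eval v (g j) = 0) :
    IsSingularAt (∏ i, g i) v := by
  classical
  rw [← Finset.mul_prod_erase _ g (Finset.mem_univ i),
    ← Finset.mul_prod_erase _ g (Finset.mem_erase.2 ⟨hij.symm, Finset.mem_univ j⟩)]
  exact ⟨by simp [hi], fun u => by simp [hi, hj]⟩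

theorem IsSmoothCubic.eq_zero_of_isSingularAt {f : Form k} (hf : IsSmoothCubic f) {v : V4 k}
    (h : IsSingularAt f v) : v = 0 := by
  by_contra hv
  have hmem := (mk_mem_singularPoints hf.1 hv).2 h
  rwa [hf.2] at hmem

theorem IsSmoothMatrix.isSmoothCubic {A : Matrix (Fin 4) (Fin 4) k} (hA : IsSmoothMatrix A) :
    IsSmoothCubic (cubic A) := by
  refine ⟨isHomogeneous_cubic A, Set.eq_empty_of_forall_notMem fun p hp => ?_⟩
  induction p using Projectivization.ind with
  | h v hv =>
    rw [mk_mem_singularPoints (isHomogeneous_cubic A)] at hp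
    exact hv (hA.eq_zero_of_isSingularAt v hp)

/-- The planes `Y i = 0` and `W j = 0` form a Steiner trihedral pair of the cubic surface `f = 0`:
its equation is a linear combination of `∏ i, Y i` and `∏ j, W j`. -/
def IsTrihedralPair (f : Form k) (Y W : Fin 3 → Module.Dual k (V4 k)) : Prop :=
  ∃ c d : k, c ≠ 0 ∧ d ≠ 0 ∧ ∀ v, eval v f = c * ∏ i, Y i v + d * ∏ j, W j v

namespace IsTrihedralPair

variable {f : Form k} {Y W : Fin 3 → Module.Dual k (V4 k)}

theorem symm (h : IsTrihedralPair f Y W) : IsTrihedralPair f W Y := by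
  obtain ⟨c, d, hc, hd, h⟩ := h
  exact ⟨d, c, hd, hc, fun v => by rw [h v, add_comm]⟩

theorem eval_eq_zero (h : IsTrihedralPair f Y W) {v : V4 k} {i j : Fin 3} (hi : Y i v = 0)
    (hj : W j v = 0) : eval v f = 0 := by
  obtain ⟨c, d, -, -, h⟩ := h
  rw [h, Finset.prod_eq_zero (Finset.mem_univ i) hi, Finset.prod_eq_zero (Finset.mem_univ j) hj,
    mul_zero, mul_zero, add_zero]

theorem exists_apply_eq_zero (h : IsTrihedralPair f Y W) {v : V4 k} {j : Fin 3}
    (hf : eval v f = 0) (hj : W j v = 0) : ∃ i, Y i v = 0 := by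
  obtain ⟨c, d, hc, -, h⟩ := h
  have hW : ∏ j, W j v = 0 := Finset.prod_eq_zero (Finset.mem_univ j) hj
  rw [h, hW, mul_zero, add_zero, mul_eq_zero_iff_left hc, Finset.prod_eq_zero_iff] at hf
  obtain ⟨i, -, hi⟩ := hf
  exact ⟨i, hi⟩

section Smooth

variable [Infinite k] (h : IsTrihedralPair f Y W) (hf : IsSmoothCubic f)

include h hf

theorem eq_zero {i i' j j' : Fin 3} (hi : i ≠ i') (hj : j ≠ j') {v : V4 k} (h₁ : Y i v = 0)
    (h₂ : Y i' v = 0) (h₃ : W j v = 0) (h₄ : W j' v = 0) : v = 0 := by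
  obtain ⟨c, d, -, -, h⟩ := h
  let M (Z : Fin 3 → Module.Dual k (V4 k)) (i : Fin 3) : Form k :=
    (LinearMap.toMatrix' (LinearMap.pi Z)).toMvPolynomial i
  have hM (Z : Fin 3 → Module.Dual k (V4 k)) (i : Fin 3) (v) : eval v (M Z i) = Z i v := by
    rw [Matrix.toMvPolynomial_eval_eq_apply, LinearMap.toMatrix'_mulVec, LinearMap.pi_apply]
  have hfM : f = C c * ∏ i, M Y i + C d * ∏ j, M W j := MvPolynomial.funext fun v => by
    simp only [h, map_add, map_mul, map_prod, eval_C, hM]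
  obtain ⟨hY, hY'⟩ := isSingularAt_prod hi ((hM Y i v).trans h₁) ((hM Y i' v).trans h₂)
  obtain ⟨hW, hW'⟩ := isSingularAt_prod hj ((hM W j v).trans h₃) ((hM W j' v).trans h₄)
  refine hf.eq_zero_of_isSingularAt ⟨?_, fun u => ?_⟩
  · rw [hfM, map_add, map_mul, map_mul, hY, hW, mul_zero, mul_zero, add_zero]
  · simp [hfM, hY', hW']

theorem ne_zero (j : Fin 3) : W j ≠ 0 := by
  intro hj
  obtain ⟨v, hv, hv₀⟩ := exists_ne_zero_forall_apply_eq_zero ![Y 0, Y 1, W (j + 1)] (by simp)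
  exact hv (h.eq_zero hf (i := 0) (i' := 1) (j := j) (j' := j + 1) (by decide) (by simp) (hv₀ 0)
    (hv₀ 1) (by rw [hj, LinearMap.zero_apply]) (hv₀ 2))

theorem finrank_ker (j : Fin 3) : Module.finrank k (LinearMap.ker (W j)) = 3 :=
  finrank_ker_eq_three (h.ne_zero hf j)

theorem ker_ne_ker (i j : Fin 3) : LinearMap.ker (Y i) ≠ LinearMap.ker (W j) := by
  intro he
  obtain ⟨v, hv, hv₀⟩ := exists_ne_zero_forall_apply_eq_zero ![Y i, Y (i + 1), W (j + 1)] (by simp)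
  have hj : v ∈ LinearMap.ker (W j) := he ▸ hv₀ 0
  exact hv (h.eq_zero hf (i := i) (i' := i + 1) (j := j) (j' := j + 1) (by simp) (by simp) (hv₀ 0)
    (hv₀ 1) hj (hv₀ 2))

theorem ker_injective : Function.Injective fun j => LinearMap.ker (W j) := by
  intro i j (he : LinearMap.ker (W i) = LinearMap.ker (W j))
  by_contra hij
  obtain ⟨v, hv, hv₀⟩ := exists_ne_zero_forall_apply_eq_zero ![Y 0, Y 1, W i] (by simp)
  have hj : v ∈ LinearMap.ker (W j) := he ▸ hv₀ 2
  exact hv (h.eq_zero hf (by decide : (0 : Fin 3) ≠ 1) hij (hv₀ 0) (hv₀ 1) (hv₀ 2) hj)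

theorem finrank_ker_inf_ker (i j : Fin 3) :
    Module.finrank k (LinearMap.ker (Y i) ⊓ LinearMap.ker (W j) : Submodule k (V4 k)) = 2 :=
  finrank_inf_eq_two (h.symm.finrank_ker hf i) (h.finrank_ker hf j) (h.ker_ne_ker hf i j)

theorem ker_inf_ker_injective : Function.Injective fun ij : Fin 3 × Fin 3 =>
    LinearMap.ker (Y ij.1) ⊓ LinearMap.ker (W ij.2) := by
  rintro ⟨i, j⟩ ⟨i', j'⟩ (he : LinearMap.ker (Y i) ⊓ LinearMap.ker (W j) =
    LinearMap.ker (Y i') ⊓ LinearMap.ker (W j'))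
  by_contra hne
  by_cases hi : i = i'
  · have hj : j ≠ j' := fun hj => hne (by rw [hi, hj])
    obtain ⟨v, hv, hv₀⟩ := exists_ne_zero_forall_apply_eq_zero ![Y i, W j, Y (i + 1)] (by simp)
    have hv' : v ∈ LinearMap.ker (Y i') ⊓ LinearMap.ker (W j') := he ▸ ⟨hv₀ 0, hv₀ 1⟩
    exact hv (h.eq_zero hf (i := i) (i' := i + 1) (by simp) hj (hv₀ 0) (hv₀ 2) (hv₀ 1) hv'.2)
  · obtain ⟨v, hv, hv₀⟩ := exists_ne_zero_forall_apply_eq_zero ![Y i, W j, W (j + 1)] (by simp)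
    have hv' : v ∈ LinearMap.ker (Y i') ⊓ LinearMap.ker (W j') := he ▸ ⟨hv₀ 0, hv₀ 1⟩
    exact hv (h.eq_zero hf (j := j) (j' := j + 1) hi (by simp) (hv₀ 0) hv'.1 (hv₀ 1) (hv₀ 2))

theorem isTritangentPlane (j : Fin 3) : IsTritangentPlane f (LinearMap.ker (W j)) := by
  refine ⟨fun i => LinearMap.ker (Y i) ⊓ LinearMap.ker (W j), h.finrank_ker hf j,
    fun i => h.finrank_ker_inf_ker hf i j, fun i i' he => ?_, Set.ext fun p => ?_⟩
  · exact congrArg Prod.fst (h.ker_inf_ker_injective hf (a₁ := (i, j)) (a₂ := (i', j)) he)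
  · induction p using Projectivization.ind with
    | h v hv =>
      simp only [Set.mem_inter_iff, mk_mem_zeroLocus hf.1, Set.mem_iUnion, mk_mem_pts,
        Submodule.mem_inf, LinearMap.mem_ker]
      constructor
      · rintro ⟨hj, hv⟩
        exact (h.exists_apply_eq_zero hv hj).imp fun i hi => ⟨hi, hj⟩
      · rintro ⟨i, hi, hj⟩
        exact ⟨hj, h.eval_eq_zero hi hj⟩

theorem isConjugateTriad : IsConjugateTriad f (Set.range fun j => LinearMap.ker (W j)) :=
  ⟨_, fun i => LinearMap.ker (Y i), rfl, h.isTritangentPlane hf, h.symm.isTritangentPlane hf,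
    fun i j => ⟨h.symm.finrank_ker_inf_ker hf i j, pts_subset_zeroLocus hf.1 fun _ hv =>
      h.eval_eq_zero hv.2 hv.1⟩, h.symm.ker_inf_ker_injective hf⟩

end Smooth

end IsTrihedralPair

section Split

variable {A : Matrix (Fin 4) (Fin 4) k} {t : Fin 3 → k} {α β α' β' : Module.Dual k (V4 k)}

theorem IsSplit.isTrihedralPair [NeZero (2 : k)] (h : IsSplit A t α β) :
    IsTrihedralPair (cubic A) (fun i => pencilForm i (t i)) ![LinearMap.proj 3, α, β] := by
  refine ⟨2, 1, two_ne_zero, one_ne_zero, fun v => ?_⟩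
  have hcubic := eval_cubic (A := A) t v
  rw [← eval_quadric, h v] at hcubic
  simp [hcubic, Fin.prod_univ_three, pencilForm_apply, mul_assoc]

theorem range_ker_eq (α β : Module.Dual k (V4 k)) :
    Set.range (fun j => LinearMap.ker (![LinearMap.proj 3, α, β] j : Module.Dual k (V4 k))) =
      {basePlane k, LinearMap.ker α, LinearMap.ker β} := by
  ext P
  simp [Fin.exists_fin_succ, basePlane, eq_comm]

theorem IsSplit.ker_eq_or_ker_eq [Infinite k] [NeZero (2 : k)] (h : IsSplit A t α β)
    (h' : IsSplit A t α' β') (hA : IsSmoothMatrix A) :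
    LinearMap.ker α' = LinearMap.ker α ∨ LinearMap.ker α' = LinearMap.ker β := by
  have hprod : ∀ v ∈ LinearMap.ker α', ∏ i, ![α, β] i v = 0 := fun v hv => by
    rw [Fin.prod_univ_two]
    change α v * β v = 0
    rw [← h v, h' v, LinearMap.mem_ker.1 hv, zero_mul]
  have hker := h.isTrihedralPair.finrank_ker hA.isSmoothCubic
  have hker' := h'.isTrihedralPair.finrank_ker hA.isSmoothCubic 1
  obtain ⟨i, hi⟩ := exists_le_ker_of_prod_eq_zero hprod
  fin_cases i
  · exact Or.inl (Submodule.eq_of_le_of_finrank_eq hi (hker'.trans (hker 1).symm))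
  · exact Or.inr (Submodule.eq_of_le_of_finrank_eq hi (hker'.trans (hker 2).symm))

end Split

end TrihedralPairs

section ConjugateTriads

variable {A : Matrix (Fin 4) (Fin 4) k} {t : Fin 3 → k} {L W : Submodule k (V4 k)} {v : V4 k}
  {i j : Fin 3}

theorem eval_eq_zero_of_pts_subset {g : Form k} {d : ℕ} (hg : g.IsHomogeneous d) (hd : d ≠ 0)
    (h : pts W ⊆ zeroLocus g) (hv : v ∈ W) : eval v g = 0 := by
  by_cases hv₀ : v = 0
  · rw [hv₀, ← zero_smul k v, eval_smul_of_isHomogeneous hg, zero_pow hd, zero_mul]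
  · exact (mk_mem_zeroLocus hg hv₀).1 (h ((mk_mem_pts hv₀).2 hv))

theorem exists_eq_baseLine [Infinite k] [NeZero (2 : k)] (h : pts L ⊆ zeroLocus (cubic A))
    (hL : Module.finrank k L = 2) (hle : L ≤ basePlane k) : ∃ i, L = baseLine k i := by
  have hprod : ∀ v ∈ L, ∏ i : Fin 3, (LinearMap.proj i.castSucc : Module.Dual k (V4 k)) v = 0 := by
    intro v hv
    have hf := eval_eq_zero_of_pts_subset (isHomogeneous_cubic A) three_ne_zero h hv
    rw [eval_cubic 0, mem_basePlane.1 (hle hv), zero_mul, add_zero,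
      mul_eq_zero_iff_left two_ne_zero] at hf
    simpa [-Fin.castSucc_zero] using hf
  obtain ⟨i, hi⟩ := exists_le_ker_of_prod_eq_zero hprod
  exact ⟨i, Submodule.eq_of_le_of_finrank_eq (le_inf hi hle) (by rw [hL, finrank_baseLine])⟩

theorem exists_eq_ker_pencilForm (hW : Module.finrank k W = 3)
    (h : basePlane k ⊓ W = baseLine k i) : ∃ s, W = LinearMap.ker (pencilForm i s) := by
  obtain ⟨φ, hφ, rfl⟩ := exists_ker_of_finrank_eq_three hW
  have hne : LinearMap.ker φ ≠ basePlane k := fun he => by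
    have hrank := finrank_baseLine (k := k) i
    rw [← h, he, inf_idem, finrank_basePlane] at hrank
    simp at hrank
  obtain ⟨c, s, hc, rfl⟩ := exists_eq_smul_pencilForm hφ (h ▸ inf_le_right) hne
  exact ⟨s, LinearMap.ker_smul _ _ hc⟩

theorem exists_quadraticForm_eq_eval_quadric (t : Fin 3 → k) :
    ∃ Q : QuadraticForm k (V4 k), ∀ v, Q v = eval v (quadric A t) :=
  ⟨(Matrix.toBilin' (A - productMatrix t)).toQuadraticMap, fun v => by
    rw [eval_quadric_eq_dotProduct_mulVec, LinearMap.BilinMap.toQuadraticMap_apply,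
      Matrix.toBilin'_apply']⟩

theorem eval_quadric_eq_zero_of_mem [NeZero (2 : k)] (h : pts L ⊆ zeroLocus (cubic A))
    (hL : L ≤ LinearMap.ker (pencilForm j (t j))) (hle : ¬ L ≤ basePlane k) (hv : v ∈ L) :
    eval v (quadric A t) = 0 := by
  obtain ⟨Q, hQ⟩ := exists_quadraticForm_eq_eval_quadric (A := A) t
  have key (u) (hu : u ∈ L) (hu₃ : u 3 ≠ 0) : Q u = 0 := by
    have hf := eval_eq_zero_of_pts_subset (isHomogeneous_cubic A) three_ne_zero h hu
    have hprod : ∏ i : Fin 3, shift t u i.castSucc = 0 :=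
      Finset.prod_eq_zero (Finset.mem_univ j) ((shift_castSucc t u j).trans (hL hu))
    rw [eval_cubic t, hprod, mul_zero, zero_add, mul_eq_zero_iff_left hu₃] at hf
    rw [hQ, eval_quadric, hf]
  rw [← hQ]
  by_cases hv₃ : v 3 = 0
  · obtain ⟨u, hu, hu₃⟩ := Set.not_subset.1 hle
    replace hu₃ : u 3 ≠ 0 := hu₃
    have hadd := key (v + u) (L.add_mem hv hu) (by simpa [hv₃] using hu₃)
    have hsub := key (v - u) (L.sub_mem hv hu) (by simpa [hv₃] using hu₃)
    rw [QuadraticMap.map_add Q, key u hu hu₃] at hadd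
    rw [sub_eq_add_neg, QuadraticMap.map_add Q, QuadraticMap.map_neg, key u hu hu₃,
      QuadraticMap.polar_neg_right] at hsub
    refine (mul_eq_zero_iff_left (two_ne_zero (α := k))).1 ?_
    linear_combination hadd + hsub
  · exact key v hv hv₃

theorem eval_quadric_eq_zero_of_mem_plane [Infinite k] [NeZero (2 : k)]
    (h : ∀ j, pts (W ⊓ LinearMap.ker (pencilForm j (t j))) ⊆ zeroLocus (cubic A))
    (hle : ∀ j, ¬ W ⊓ LinearMap.ker (pencilForm j (t j)) ≤ basePlane k)
    (hne : ∀ i j, i ≠ j → ¬ W ⊓ LinearMap.ker (pencilForm i (t i)) ≤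
      LinearMap.ker (pencilForm j (t j))) (hv : v ∈ W) : eval v (quadric A t) = 0 := by
  obtain ⟨Q, hQ⟩ := exists_quadraticForm_eq_eval_quadric (A := A) t
  rw [← hQ]
  refine eq_zero_of_forall_eq_zero (φ := fun j => pencilForm j (t j)) (fun j v hv hj => ?_)
    (fun i j hij => ?_) v hv
  · rw [hQ]
    exact eval_quadric_eq_zero_of_mem (h j) inf_le_right (hle j) ⟨hv, hj⟩
  · obtain ⟨u, hu, huj⟩ := Set.not_subset.1 (hne i j hij)
    exact ⟨u, hu.1, hu.2, huj⟩

theorem exists_isSplit_smul [Infinite k] {α β : Module.Dual k (V4 k)} (hQ : quadric A t ≠ 0)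
    (hα : ∀ v, α v = 0 → eval v (quadric A t) = 0)
    (hβ : ∀ v, β v = 0 → eval v (quadric A t) = 0)
    (hαβ : ¬ LinearMap.ker α ≤ LinearMap.ker β) (hβα : ¬ LinearMap.ker β ≤ LinearMap.ker α) :
    ∃ c : k, c ≠ 0 ∧ IsSplit A t (c • α) β := by
  obtain ⟨Q, hQ'⟩ := exists_quadraticForm_eq_eval_quadric (A := A) t
  simp only [← hQ'] at hα hβ
  obtain ⟨u, hu, hu'⟩ := Set.not_subset.1 hαβ
  obtain ⟨w, hw, hw'⟩ := Set.not_subset.1 hβα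
  obtain ⟨c, hc⟩ := exists_eq_mul_of_eq_zero_of_eq_zero (W := ⊤) (fun v _ => hα v)
    (fun v _ => hβ v) ⟨u, trivial, hu, hu'⟩ ⟨w, trivial, hw, hw'⟩
  refine ⟨c, ?_, fun v => by rw [← hQ', hc v trivial, LinearMap.smul_apply, smul_eq_mul, mul_assoc]⟩
  rintro rfl
  exact hQ (MvPolynomial.funext fun v => by rw [← hQ', hc v trivial, zero_mul, map_zero])

theorem IsSmoothMatrix.quadric_ne_zero [NeZero (2 : k)] (hA : IsSmoothMatrix A) (t : Fin 3 → k) :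
    quadric A t ≠ 0 := by
  intro h
  have heval := eval_quadric_eq_dotProduct_mulVec (A := A) t (Pi.single 0 1)
  rw [h] at heval
  exact hA.diag_ne_zero 0 (by simpa [productMatrix, eq_comm] using heval)

theorem IsSmoothMatrix.exists_isSplit_of_planes [Infinite k] [NeZero (2 : k)]
    (hA : IsSmoothMatrix A) {P B : Fin 3 → Submodule k (V4 k)}
    (hP : ∀ i, Module.finrank k (P i) = 3) (hB : ∀ j, Module.finrank k (B j) = 3)
    (hPB : ∀ i j, Module.finrank k (P i ⊓ B j : Submodule k (V4 k)) = 2 ∧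
      pts (P i ⊓ B j) ⊆ zeroLocus (cubic A))
    (hinj : Function.Injective fun ij : Fin 3 × Fin 3 => P ij.1 ⊓ B ij.2)
    (h₀ : P 0 = basePlane k) (hl : ∀ j, P 0 ⊓ B j = baseLine k j) :
    ∃ t α β, IsSplit A t α β ∧ P 1 = LinearMap.ker α ∧ P 2 = LinearMap.ker β := by
  have hne {i j i' j'} (hij : (i, j) ≠ (i', j')) : ¬ P i ⊓ B j ≤ P i' ⊓ B j' := fun hle =>
    hij (hinj (Submodule.eq_of_le_of_finrank_eq hle (by rw [(hPB _ _).1, (hPB _ _).1])))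
  choose t ht using fun j => exists_eq_ker_pencilForm (hB j) (h₀ ▸ hl j)
  obtain rfl : B = fun j => LinearMap.ker (pencilForm j (t j)) := _root_.funext ht
  have hQ (m) (hm : m ≠ 0) (v) (hv : v ∈ P m) : eval v (quadric A t) = 0 :=
    eval_quadric_eq_zero_of_mem_plane (fun j => (hPB m j).2)
      (fun j hle => hne (i' := 0) (by simp [hm]) (le_inf (h₀ ▸ hle) inf_le_right))
      (fun i j hij hle => hne (i' := m) (by simp [hij]) (le_inf inf_le_left hle)) hv
  have hP' (i j) (hij : i ≠ j) : ¬ P i ≤ P j := fun hle =>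
    hne (j := 0) (by simp [hij]) (inf_le_inf_right _ hle)
  obtain ⟨α, -, hα⟩ := exists_ker_of_finrank_eq_three (hP 1)
  obtain ⟨β, -, hβ⟩ := exists_ker_of_finrank_eq_three (hP 2)
  obtain ⟨c, hc, h⟩ := exists_isSplit_smul (hA.quadric_ne_zero t)
    (fun v hv => hQ 1 (by decide) v (hα ▸ hv)) (fun v hv => hQ 2 (by decide) v (hβ ▸ hv))
    (hα ▸ hβ ▸ hP' 1 2 (by decide)) (hα ▸ hβ ▸ hP' 2 1 (by decide))
  exact ⟨t, c • α, β, h, hα.trans (LinearMap.ker_smul _ _ hc).symm, hβ⟩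

theorem IsSmoothMatrix.exists_isSplit_of_isConjugateTriad [Infinite k] [NeZero (2 : k)]
    (hA : IsSmoothMatrix A) {τ : Set (Submodule k (V4 k))} (h : IsConjugateTriad (cubic A) τ)
    (hτ : basePlane k ∈ τ) :
    ∃ t α β, IsSplit A t α β ∧ τ = {basePlane k, LinearMap.ker α, LinearMap.ker β} := by
  obtain ⟨P, B, rfl, hP, hB, hPB, hinj⟩ := h
  obtain ⟨m, hm⟩ := hτ
  choose σ hσ using fun j => exists_eq_baseLine (hPB m j).2 (hPB m j).1 (hm ▸ inf_le_left)
  have hσ_inj : Function.Injective σ := fun i j hij =>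
    congrArg Prod.snd (@hinj (m, i) (m, j) ((hσ i).trans (hij ▸ (hσ j).symm)))
  let e := Equiv.ofBijective σ (Finite.injective_iff_bijective.1 hσ_inj)
  obtain ⟨t, α, β, hs, hα, hβ⟩ := hA.exists_isSplit_of_planes
    (P := P ∘ Equiv.swap 0 m) (B := B ∘ e.symm) (fun i => (hP _).choose_spec.1)
    (fun i => (hB _).choose_spec.1) (fun i j => hPB _ _)
    (hinj.comp ((Equiv.swap 0 m).injective.prodMap e.symm.injective)) (by simp [hm]) (fun j => by
      simp only [Function.comp_apply, Equiv.swap_apply_left, hσ]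
      exact congrArg _ (e.apply_symm_apply j))
  refine ⟨t, α, β, hs, ?_⟩
  rw [← EquivLike.range_comp P (Equiv.swap 0 m), ← hα, ← hβ, ← hm]
  ext W
  simp only [Set.mem_range, Fin.exists_fin_succ]
  simp [eq_comm]

end ConjugateTriads

section Configuration

theorem triadLine_insert {T U W : Submodule k (V4 k)} (hU : U ≠ T) (hW : W ≠ T) :
    triadLine T {T, U, W} = U ⊓ W := by
  rw [triadLine, Set.insert_sdiff_of_mem _ (Set.mem_singleton T),
    Set.sdiff_singleton_eq_self (by simp [hU.symm, hW.symm]), sInf_pair]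

variable (A : Matrix (Fin 4) (Fin 4) k)

/-- The parameters of the planes of the `i`-th pencil that contain a vertex. -/
def vertexParameters (i : Fin 3) : Set k := {s | vertexSpace A i s ≠ ⊥}

/-- The parameters of the quadrics of Cremona's family that are pairs of planes. -/
def splitParameters : Set (Fin 3 → k) := {t | ∃ α β, IsSplit A t α β}

variable {A} {i : Fin 3} {s : k} {t : Fin 3 → k} {α β : Module.Dual k (V4 k)}

theorem mem_vertexParameters_iff :
    s ∈ vertexParameters A i ↔ ∃ v ∈ vertexSpace A i s, v ≠ 0 :=
  Submodule.ne_bot_iff _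

variable [NeZero (2 : k)]

theorem IsSplit.mem_vertexParameters (h : IsSplit A t α β) (hA : A.IsSymm) (i : Fin 3) :
    t i ∈ vertexParameters A i := by
  obtain ⟨v, hv, hv₀, -⟩ := h.exists_mem_vertexSpace hA i
  exact mem_vertexParameters_iff.2 ⟨v, hv, hv₀⟩

namespace IsSmoothMatrix

variable [IsAlgClosed k] (hA : IsSmoothMatrix A)

include hA

theorem ncard_vertexParameters (i : Fin 3) : (vertexParameters A i).ncard = 4 :=
  hA.ncard_vertexSpace_ne_bot i

theorem injOn_splitParameters (i : Fin 3) :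
    Set.InjOn (fun t : Fin 3 → k => (t i, t (i + 1))) (splitParameters A) := by
  rintro t ⟨α, β, h⟩ t' ⟨α', β', h'⟩ he
  exact hA.eq_of_isSplit h h' (Prod.ext_iff.1 he).1 (Prod.ext_iff.1 he).2

theorem image_splitParameters (i : Fin 3) :
    (fun t : Fin 3 → k => (t i, t (i + 1))) '' splitParameters A =
      vertexParameters A i ×ˢ vertexParameters A (i + 1) := by
  refine Set.Subset.antisymm ?_ ?_
  · rintro _ ⟨t, ⟨α, β, h⟩, rfl⟩
    exact ⟨h.mem_vertexParameters hA.isSymm i, h.mem_vertexParameters hA.isSymm (i + 1)⟩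
  · rintro ⟨s, r⟩ ⟨hs, hr⟩
    obtain ⟨v, hv, hv₀⟩ := mem_vertexParameters_iff.1 hs
    obtain ⟨u, hu, hu₀⟩ := mem_vertexParameters_iff.1 hr
    obtain ⟨t, α, β, h, rfl, rfl⟩ := hA.exists_isSplit hv hv₀ hu hu₀
    exact ⟨t, ⟨α, β, h⟩, rfl⟩

theorem ncard_splitParameters : (splitParameters A).ncard = 16 := by
  rw [← (hA.injOn_splitParameters 0).ncard_image, hA.image_splitParameters, Set.ncard_prod,
    hA.ncard_vertexParameters, hA.ncard_vertexParameters]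

theorem ncard_sep_splitParameters (hs : s ∈ vertexParameters A i) :
    {t ∈ splitParameters A | t i = s}.ncard = 4 := by
  have himage : (fun t : Fin 3 → k => (t i, t (i + 1))) '' {t ∈ splitParameters A | t i = s} =
      {s} ×ˢ vertexParameters A (i + 1) := by
    have hsep : {t ∈ splitParameters A | t i = s} =
        splitParameters A ∩ (fun t => (t i, t (i + 1))) ⁻¹' ({s} ×ˢ Set.univ) := by
      ext t
      simp
    rw [hsep, Set.image_inter_preimage, hA.image_splitParameters, Set.prod_inter_prod,
      Set.inter_univ, Set.inter_singleton_of_mem hs]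
  rw [← ((hA.injOn_splitParameters i).mono (Set.sep_subset _ _)).ncard_image, himage,
    Set.ncard_prod, Set.ncard_singleton, hA.ncard_vertexParameters]

theorem ncard_setOf_mem_vertexParameters :
    {p : Fin 3 × k | p.2 ∈ vertexParameters A p.1}.ncard = 12 := by
  have hfin (i) : Finite (vertexParameters A i) :=
    Set.finite_of_ncard_ne_zero (by simp [hA.ncard_vertexParameters])
  rw [← Nat.card_coe_set_eq]
  refine (Nat.card_congr
    (Equiv.subtypeProdEquivSigmaSubtype fun i s => s ∈ vertexParameters A i)).trans ?_
  rw [Nat.card_sigma]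
  change ∑ i, (vertexParameters A i).ncard = 12
  simp [hA.ncard_vertexParameters]

theorem isConfiguration_parameters :
    IsConfiguration {p : Fin 3 × k | p.2 ∈ vertexParameters A p.1} (splitParameters A)
      (fun p t => t p.1 = p.2) 12 4 16 3 := by
  refine ⟨hA.ncard_setOf_mem_vertexParameters, hA.ncard_splitParameters,
    fun p hp => hA.ncard_sep_splitParameters hp, ?_⟩
  rintro t ⟨α, β, h⟩
  have hrange : {p ∈ {p : Fin 3 × k | p.2 ∈ vertexParameters A p.1} | t p.1 = p.2} =
      Set.range fun i => (i, t i) := by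
    ext ⟨i, s⟩
    simpa [eq_comm] using fun hs => hs ▸ h.mem_vertexParameters hA.isSymm i
  rw [hrange, Set.ncard_range_of_injective fun i j hij => (Prod.ext_iff.1 hij).1, Nat.card_fin]

end IsSmoothMatrix

end Configuration

section NodalSteinerian

variable {A : Matrix (Fin 4) (Fin 4) k} {t : Fin 3 → k}
  {α β α' β' : Module.Dual k (V4 k)} {i j : Fin 3} {s r : k} {x : P3 k}

theorem mem_vertexParameters_iff_nonempty :
    s ∈ vertexParameters A i ↔ (pts (vertexSpace A i s)).Nonempty := by
  rw [mem_vertexParameters_iff]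
  constructor
  · rintro ⟨v, hv, hv₀⟩
    exact ⟨_, (mk_mem_pts hv₀).2 hv⟩
  · rintro ⟨x, hx⟩
    induction x using Projectivization.ind with
    | h v hv => exact ⟨v, (mk_mem_pts hv).1 hx, hv⟩

variable [NeZero (2 : k)]

namespace IsSplit

theorem pts_subset_zeroLocus_quartic (h : IsSplit A t α β) (hA : A.IsSymm) :
    pts (LinearMap.ker α ⊓ LinearMap.ker β) ⊆ zeroLocus (quartic A) :=
  pts_subset_zeroLocus (isHomogeneous_quartic A) fun v hv => by
    rw [eval_quartic t, h.polar_eq_zero hA hv.1 hv.2]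
    simp [quarticExpr]

section Smooth

variable [Infinite k] (h : IsSplit A t α β) (hA : IsSmoothMatrix A)

include h hA

theorem triadLine_eq : triadLine (basePlane k) {basePlane k, LinearMap.ker α, LinearMap.ker β} =
    LinearMap.ker α ⊓ LinearMap.ker β :=
  have hinj := h.isTrihedralPair.ker_injective hA.isSmoothCubic
  triadLine_insert (hinj.ne (by decide : (1 : Fin 3) ≠ 0)) (hinj.ne (by decide : (2 : Fin 3) ≠ 0))

theorem finrank_ker_inf_ker :
    Module.finrank k (LinearMap.ker α ⊓ LinearMap.ker β : Submodule k (V4 k)) = 2 :=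
  have hpair := h.isTrihedralPair
  finrank_inf_eq_two (hpair.finrank_ker hA.isSmoothCubic 1) (hpair.finrank_ker hA.isSmoothCubic 2)
    ((hpair.ker_injective hA.isSmoothCubic).ne (by decide : (1 : Fin 3) ≠ 2))

theorem mem_triadsThrough :
    {basePlane k, LinearMap.ker α, LinearMap.ker β} ∈ triadsThrough (cubic A) (basePlane k) :=
  ⟨range_ker_eq α β ▸ h.isTrihedralPair.isConjugateTriad hA.isSmoothCubic, Set.mem_insert _ _⟩

theorem triad_eq (h' : IsSplit A t α' β') :
    ({basePlane k, LinearMap.ker α, LinearMap.ker β} : Set (Submodule k (V4 k))) =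
      {basePlane k, LinearMap.ker α', LinearMap.ker β'} := by
  refine Set.Subset.antisymm ?_ ?_
  · rintro P (hP | rfl | rfl)
    exacts [Or.inl hP, Or.inr (h'.ker_eq_or_ker_eq h hA), Or.inr (h'.ker_eq_or_ker_eq h.symm hA)]
  · rintro P (hP | rfl | rfl)
    exacts [Or.inl hP, Or.inr (h.ker_eq_or_ker_eq h' hA), Or.inr (h.ker_eq_or_ker_eq h'.symm hA)]

end Smooth

theorem mem_pts_ker_inf_ker_iff [IsAlgClosed k] (h : IsSplit A t α β) (hA : IsSmoothMatrix A)
    (hx : x ∈ pts (vertexSpace A i s)) :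
    x ∈ pts (LinearMap.ker α ⊓ LinearMap.ker β) ↔ t i = s := by
  induction x using Projectivization.ind with
  | h v hv =>
    rw [mk_mem_pts] at hx ⊢
    exact hA.apply_eq_zero_and_iff_of_isSplit h hx hv

end IsSplit

namespace IsSmoothMatrix

variable (hA : IsSmoothMatrix A)

include hA

theorem eq_and_eq_of_mem_pts_vertexSpace (hx : x ∈ pts (vertexSpace A i s))
    (hx' : x ∈ pts (vertexSpace A j r)) : i = j ∧ s = r := by
  induction x using Projectivization.ind with
  | h v hv =>
    rw [mk_mem_pts] at hx hx'
    exact hA.eq_and_eq_of_mem_vertexSpace hx hx' hv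

theorem mem_singularPoints_quartic_iff :
    x ∈ singularPoints (quartic A) ↔ ∃ i s, x ∈ pts (vertexSpace A i s) := by
  induction x using Projectivization.ind with
  | h v hv =>
    simp only [mk_mem_singularPoints (isHomogeneous_quartic A), mk_mem_pts]
    exact ⟨fun h => hA.exists_mem_vertexSpace h hv,
      fun ⟨_, _, h⟩ => isSingularAt_quartic_of_mem_vertexSpace h⟩

variable [IsAlgClosed k]

theorem subsingleton_pts_vertexSpace (i : Fin 3) (s : k) :
    (pts (vertexSpace A i s)).Subsingleton := by
  intro x hx y hy
  induction x using Projectivization.ind with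
  | h u hu =>
    induction y using Projectivization.ind with
    | h v hv =>
      rw [mk_mem_pts] at hx hy
      exact (Projectivization.mk_eq_mk_iff' ..).2
        (Submodule.mem_span_singleton.1 (hA.mem_span_of_mem_vertexSpace hx hy hv))

theorem isNode_of_mem_singularPoints (hx : x ∈ singularPoints (quartic A)) :
    IsNode (quartic A) x := by
  obtain ⟨i, s, hx⟩ := hA.mem_singularPoints_quartic_iff.1 hx
  induction x using Projectivization.ind with
  | h v hv =>
    rw [mk_mem_pts] at hx
    exact (isNode_mk (isHomogeneous_quartic A) hv).2 (hA.isNodeAt_quartic hx hv)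

theorem singularPoints_quartic_eq_image {ν : Fin 3 × k → P3 k}
    (hν : ∀ p : Fin 3 × k, p.2 ∈ vertexParameters A p.1 → ν p ∈ pts (vertexSpace A p.1 p.2)) :
    singularPoints (quartic A) = ν '' {p | p.2 ∈ vertexParameters A p.1} := by
  ext x
  rw [hA.mem_singularPoints_quartic_iff]
  constructor
  · rintro ⟨i, s, hx⟩
    have hs : s ∈ vertexParameters A i := mem_vertexParameters_iff_nonempty.2 ⟨x, hx⟩
    exact ⟨(i, s), hs, hA.subsingleton_pts_vertexSpace i s (hν (i, s) hs) hx⟩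
  · rintro ⟨p, hp, rfl⟩
    exact ⟨_, _, hν p hp⟩

section Choice

variable {α β : (Fin 3 → k) → Module.Dual k (V4 k)}
  (h : ∀ t ∈ splitParameters A, IsSplit A t (α t) (β t))

include h

theorem triadsThrough_cubic_eq_image : triadsThrough (cubic A) (basePlane k) =
    (fun t => {basePlane k, LinearMap.ker (α t), LinearMap.ker (β t)}) '' splitParameters A := by
  refine Set.Subset.antisymm ?_ ?_
  · rintro τ ⟨hτ, hmem⟩
    obtain ⟨t, α', β', h', rfl⟩ := hA.exists_isSplit_of_isConjugateTriad hτ hmem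
    have ht : t ∈ splitParameters A := ⟨α', β', h'⟩
    exact ⟨t, ht, (h t ht).triad_eq hA h'⟩
  · rintro _ ⟨t, ht, rfl⟩
    exact (h t ht).mem_triadsThrough hA

theorem injOn_ker_inf_ker :
    Set.InjOn (fun t => LinearMap.ker (α t) ⊓ LinearMap.ker (β t)) (splitParameters A) :=
  fun t ht t' ht' he => hA.eq_of_isSplit_of_ker_inf_ker_le (h t ht) (h t' ht') he.le

theorem injOn_triad : Set.InjOn (fun t =>
    ({basePlane k, LinearMap.ker (α t), LinearMap.ker (β t)} : Set (Submodule k (V4 k))))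
      (splitParameters A) := by
  intro t ht t' ht' he
  have hline := congrArg (triadLine (basePlane k)) he
  simp only [(h t ht).triadLine_eq hA, (h t' ht').triadLine_eq hA] at hline
  exact hA.injOn_ker_inf_ker h ht ht' hline

theorem image_triadLine_eq_image :
    triadLine (basePlane k) '' triadsThrough (cubic A) (basePlane k) =
      (fun t => LinearMap.ker (α t) ⊓ LinearMap.ker (β t)) '' splitParameters A := by
  rw [hA.triadsThrough_cubic_eq_image h, Set.image_image]
  exact Set.image_congr fun t ht => (h t ht).triadLine_eq hA

end Choice

theorem isNodalSteinerian :
    IsNodalSteinerian (cubic A) (basePlane k) (baseLine k) (quartic A) := by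
  choose! α β h using fun t (ht : t ∈ splitParameters A) => ht
  choose! ν hν using fun (p : Fin 3 × k) (hp : p.2 ∈ vertexParameters A p.1) =>
    mem_vertexParameters_iff_nonempty.1 hp
  refine ⟨isHomogeneous_quartic A, hA.irreducible_quartic, hA.steinerian_eq,
    fun p hp => hA.isNode_of_mem_singularPoints hp, ?_, ?_, ?_, ?_⟩
  · rw [hA.triadsThrough_cubic_eq_image h, (hA.injOn_triad h).ncard_image,
      hA.ncard_splitParameters]
  · rw [hA.triadsThrough_cubic_eq_image h]
    rintro _ ⟨t, ht, rfl⟩ _ ⟨t', ht', rfl⟩ he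
    rw [(h t ht).triadLine_eq hA, (h t' ht').triadLine_eq hA] at he
    rw [hA.injOn_ker_inf_ker h ht ht' he]
  · rw [hA.image_triadLine_eq_image h, hA.steinerian_eq]
    rintro _ ⟨t, ht, rfl⟩
    exact ⟨(h t ht).finrank_ker_inf_ker hA, (h t ht).pts_subset_zeroLocus_quartic hA.isSymm⟩
  · rw [hA.image_triadLine_eq_image h, hA.singularPoints_quartic_eq_image hν]
    refine hA.isConfiguration_parameters.image (fun p hp p' hp' he => ?_)
      (hA.injOn_ker_inf_ker h) fun p hp t ht => (h t ht).mem_pts_ker_inf_ker_iff hA (hν p hp)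
    exact Prod.ext_iff.2 (hA.eq_and_eq_of_mem_pts_vertexSpace (hν p hp) (he ▸ hν p' hp'))

end IsSmoothMatrix

end NodalSteinerian

section QuadraticForms

variable {σ R : Type*} [CommRing R]

theorem eval_eq_eval_zero_of_isHomogeneous_zero {g : MvPolynomial σ R} (hg : g.IsHomogeneous 0)
    (v : σ → R) : eval v g = eval 0 g := by
  have h := eval_smul_of_isHomogeneous hg 0 v
  rw [zero_smul, pow_zero, one_mul] at h
  exact h.symm

theorem eval_dirDeriv_dirDeriv_self [Finite σ] {g : MvPolynomial σ R} (hg : g.IsHomogeneous 2)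
    (v : σ → R) : eval 0 (dirDeriv v (dirDeriv v g)) = 2 * eval v g := by
  have hg' := isHomogeneous_dirDeriv hg v
  rw [← eval_eq_eval_zero_of_isHomogeneous_zero (isHomogeneous_dirDeriv hg' v) v,
    eval_dirDeriv_self hg', eval_dirDeriv_self hg, Nat.cast_one, one_mul, Nat.cast_ofNat]

theorem isSymm_hessian (g : Form k) (v : V4 k) : (hessian g v).IsSymm :=
  Matrix.IsSymm.ext fun i j => by
    simp only [hessian, Matrix.of_apply, ← dirDeriv_single]
    rw [dirDeriv_comm]

theorem eval_dirDeriv_dirDeriv (g : Form k) (v u : V4 k) :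
    eval v (dirDeriv u (dirDeriv u g)) = u ⬝ᵥ (hessian g v).mulVec u := by
  simp only [dirDeriv_apply, hessian, Matrix.mulVec, dotProduct, Matrix.of_apply, map_sum,
    smul_eval, Derivation.map_smul, Finset.mul_sum]
  rw [Finset.sum_comm]
  exact Finset.sum_congr rfl fun i _ => Finset.sum_congr rfl fun j _ => by ring

theorem exists_isSymm_eval_eq [NeZero (2 : k)] {g : Form k} (hg : g.IsHomogeneous 2) :
    ∃ A : Matrix (Fin 4) (Fin 4) k, A.IsSymm ∧ ∀ v, eval v g = v ⬝ᵥ A.mulVec v := by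
  refine ⟨(2 : k)⁻¹ • hessian g 0, (isSymm_hessian g 0).smul _, fun v => ?_⟩
  rw [Matrix.smul_mulVec, dotProduct_smul, ← eval_dirDeriv_dirDeriv,
    eval_dirDeriv_dirDeriv_self hg, smul_eq_mul, inv_mul_cancel_left₀ two_ne_zero]

end QuadraticForms

section NormalForm

theorem isHomogeneous_of_X_mul {σ R : Type*} [CommRing R] {i : σ} {g : MvPolynomial σ R} {n : ℕ}
    (h : (X i * g).IsHomogeneous (n + 1)) : g.IsHomogeneous n := by
  intro d hd
  have hdeg := h (d := Finsupp.single i 1 + d) (by rwa [coeff_X_mul])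
  rw [map_add, Finsupp.weight_single, Pi.one_apply, smul_eq_mul, mul_one] at hdeg
  lia

theorem eval_aeval_update {σ R : Type*} [CommRing R] [DecidableEq σ] (i : σ) (v : σ → R)
    (g : MvPolynomial σ R) :
    eval v (aeval (Function.update X i 0) g) = eval (Function.update v i 0) g := by
  have h : (aeval v).comp (aeval (Function.update X i (0 : MvPolynomial σ R))) =
      aeval (Function.update v i 0) := algHom_ext fun j => by
    by_cases hj : j = i <;> simp [hj]
  exact DFunLike.congr_fun h g

theorem prod_X_castSucc_dvd {n : ℕ} {g : MvPolynomial (Fin (n + 1)) k}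
    (h : ∀ i : Fin n, X i.castSucc ∣ g) : ∏ i : Fin n, X i.castSucc ∣ g := by
  refine Finset.prod_dvd_of_isRelPrime (fun i _ j _ hij => ?_) fun i _ => h i
  refine (Irreducible.isRelPrime_iff_not_dvd X_prime.irreducible).2 fun hdvd => hij ?_
  exact Fin.castSucc_injective n (X_dvd_X.1 hdvd)

theorem X_dvd_sub_aeval_update {σ R : Type*} [CommRing R] [DecidableEq σ] (i : σ)
    (g : MvPolynomial σ R) : X i ∣ g - aeval (Function.update X i 0) g := by
  rw [← Ideal.mem_span_singleton, ← Ideal.Quotient.eq]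
  have h : Ideal.Quotient.mkₐ R (Ideal.span {X i}) =
      (Ideal.Quotient.mkₐ R (Ideal.span {X i})).comp
        (aeval (Function.update X i (0 : MvPolynomial σ R))) := algHom_ext fun j => by
    by_cases hj : j = i
    · simp [hj]
    · simp [hj]
  exact DFunLike.congr_fun h g

theorem isHomogeneous_aeval_update {σ R : Type*} [CommRing R] [DecidableEq σ] (i : σ)
    {g : MvPolynomial σ R} {n : ℕ} (hg : g.IsHomogeneous n) :
    (aeval (Function.update X i (0 : MvPolynomial σ R)) g).IsHomogeneous n := by
  rw [← one_mul n]
  refine hg.aeval _ fun j => ?_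
  obtain rfl | hj := eq_or_ne j i
  · rw [Function.update_self]
    exact isHomogeneous_zero _ _ _
  · rw [Function.update_of_ne hj]
    exact isHomogeneous_X _ _

theorem exists_eq_prod_add_X_mul [IsAlgClosed k] {f : Form k} (hf : f.IsHomogeneous 3)
    (h : ∀ v, v 3 = 0 → (eval v f = 0 ↔ ∃ i : Fin 3, v i.castSucc = 0)) :
    ∃ c g, c ≠ 0 ∧ g.IsHomogeneous 2 ∧ f = C c * ∏ i : Fin 3, X i.castSucc + X 3 * g := by
  have hr := isHomogeneous_aeval_update 3 hf
  have hprod : (∏ i : Fin 3, X i.castSucc : Form k).IsHomogeneous 3 :=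
    IsHomogeneous.prod _ _ (fun _ => 1) fun i _ => isHomogeneous_X _ _
  obtain ⟨g, hg⟩ := X_dvd_sub_aeval_update 3 f
  obtain ⟨q, hq⟩ : ∏ i : Fin 3, X i.castSucc ∣ aeval (Function.update X 3 (0 : Form k)) f := by
    refine prod_X_castSucc_dvd fun i => dvd_of_forall_eval_eq_zero X_prime.irreducible ?_
    intro v hv
    rw [eval_X] at hv
    rw [eval_aeval_update, h _ (Function.update_self ..)]
    exact ⟨i, (Function.update_of_ne (Fin.castSucc_ne_last i) _ _).trans hv⟩
  have heq : f = C (coeff 0 q) * ∏ i : Fin 3, X i.castSucc + X 3 * g := by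
    rw [coeff_zero_mul_eq_homogeneousComponent hprod, mul_comm q, ← hq,
      homogeneousComponent_of_mem hr, if_pos rfl, ← hg, add_sub_cancel]
  refine ⟨coeff 0 q, g, fun hzero => ?_, isHomogeneous_of_X_mul (hg ▸ hf.sub hr), heq⟩
  obtain ⟨i, hi⟩ := (h ![1, 1, 1, 0] rfl).1 (by rw [heq, hzero]; simp)
  fin_cases i <;> simp at hi

theorem exists_pullback_eq_cubic [Infinite k] [NeZero (2 : k)] {c : k} (hc : c ≠ 0) {g : Form k}
    (hg : g.IsHomogeneous 2) : ∃ (δ : V4 k ≃ₗ[k] V4 k) (A : Matrix (Fin 4) (Fin 4) k),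
      A.IsSymm ∧ pullback δ (C c * ∏ i : Fin 3, X i.castSucc + X 3 * g) = cubic A ∧
        preimage δ (basePlane k) = basePlane k ∧
          ∀ i, preimage δ (baseLine k i) = baseLine k i := by
  let d : Fin 4 → k := ![2 / c, 1, 1, 1]
  have hd : ∀ i, d i ≠ 0 :=
    Fin.forall_fin_succ.2 ⟨div_ne_zero two_ne_zero hc, fun i => by fin_cases i <;> simp [d]⟩
  let δ : V4 k ≃ₗ[k] V4 k :=
    LinearEquiv.piCongrRight fun i => LinearEquiv.smulOfNeZero k k (d i) (hd i)
  have hδ (v i) : δ v i = d i * v i := rfl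
  have hzero (v i) : δ v i = 0 ↔ v i = 0 := by rw [hδ, mul_eq_zero_iff_left (hd i)]
  obtain ⟨A, hA, heval⟩ := exists_isSymm_eval_eq (isHomogeneous_pullback δ.toLinearMap hg)
  refine ⟨δ, A, hA, ?_, Submodule.ext fun v => hzero v 3,
    fun i => Submodule.ext fun v => and_congr (hzero v _) (hzero v _)⟩
  refine MvPolynomial.funext fun v => ?_
  have hg' : eval (δ v) g = v ⬝ᵥ A.mulVec v := by rw [← heval, eval_pullback, LinearEquiv.coe_coe]
  have hmatrix : eval v (X ⬝ᵥ A.toMvPolynomial) = v ⬝ᵥ A.mulVec v := by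
    simp [dotProduct, Matrix.toMvPolynomial_eval_eq_apply]
  rw [eval_pullback, LinearEquiv.coe_coe, cubic, map_add, map_mul _ (X 3), hg', map_add,
    map_mul _ (X 3), hmatrix]
  simp [Fin.prod_univ_three, hδ, d, map_ofNat]
  field_simp

end NormalForm

section Triangle

variable {T : Submodule k (V4 k)} {l : Fin 3 → Submodule k (V4 k)}

theorem smul_mem_iff_eq_zero {V : Type*} [AddCommGroup V] [Module k V] {W : Submodule k V} {w : V}
    (hw : w ∉ W) {c : k} : c • w ∈ W ↔ c = 0 := by
  refine ⟨fun h => ?_, fun h => by simp [h]⟩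
  by_contra hc
  exact hw ((W.smul_mem_iff hc).1 h)

theorem exists_vertices (hT : Module.finrank k T = 3) (hl : ∀ i, Module.finrank k (l i) = 2)
    (hlT : ∀ i, l i ≤ T) (h : ⋂ i, pts (l i) = ∅) :
    ∃ v : Fin 3 → V4 k, ∀ i j, v i ∈ l j ↔ j ≠ i := by
  have hinf (i : Fin 3) : l (i + 1) ⊓ l (i + 2) ≠ ⊥ := by
    intro hbot
    have hsum := Submodule.finrank_sup_add_finrank_inf_eq (l (i + 1)) (l (i + 2))
    have hle := Submodule.finrank_mono (sup_le (hlT (i + 1)) (hlT (i + 2)))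
    rw [hl, hl, hbot, finrank_bot] at hsum
    lia
  choose v hv hv₀ using fun i => (Submodule.ne_bot_iff _).1 (hinf i)
  have hmem (i j : Fin 3) (hij : j ≠ i) : v i ∈ l j := by
    rcases eq_add_one_or_eq_add_two hij with rfl | rfl
    exacts [(hv i).1, (hv i).2]
  refine ⟨v, fun i j => ⟨?_, hmem i j⟩⟩
  rintro hi rfl
  refine Set.notMem_empty (Projectivization.mk k (v j) (hv₀ j)) (h ▸ Set.mem_iInter.2 fun j' => ?_)
  rw [mk_mem_pts]
  by_cases hj : j' = j
  exacts [hj ▸ hi, hmem _ _ hj]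

theorem exists_preimage_eq_base (hT : Module.finrank k T = 3)
    (hl : ∀ i, Module.finrank k (l i) = 2) (hlT : ∀ i, l i ≤ T) (h : ⋂ i, pts (l i) = ∅) :
    ∃ φ : V4 k ≃ₗ[k] V4 k,
      preimage φ T = basePlane k ∧ ∀ i, preimage φ (l i) = baseLine k i := by
  obtain ⟨v, hv⟩ := exists_vertices hT hl hlT h
  have hvT (i : Fin 3) : v i ∈ T := hlT (i + 1) ((hv i _).2 (by simp))
  obtain ⟨w, hw⟩ : ∃ w, w ∉ T := by
    by_contra! hall
    rw [Submodule.eq_top_iff'.2 hall, finrank_top, Module.finrank_fin_fun] at hT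
    lia
  let ψ : V4 k →ₗ[k] V4 k := Fintype.linearCombination k (Fin.snoc v w : Fin 4 → V4 k)
  have hψ (u) : ψ u = (∑ i : Fin 3, u i.castSucc • v i) + u 3 • w := by
    simp [ψ, Fintype.linearCombination_apply, Fin.sum_univ_castSucc (n := 3)]
    rfl
  have hψT (u) : ψ u ∈ T ↔ u 3 = 0 := by
    rw [hψ, Submodule.add_mem_iff_right _ (T.sum_mem fun i _ => T.smul_mem _ (hvT i))]
    exact smul_mem_iff_eq_zero hw
  have hψl (i u) : ψ u ∈ l i ↔ u i.castSucc = 0 ∧ u 3 = 0 := by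
    rw [and_comm, ← and_iff_right_of_imp fun hu => (hψT u).1 (hlT i hu)]
    refine and_congr_right fun h3 => ?_
    rw [hψ, h3, zero_smul, add_zero, ← Finset.add_sum_erase _ _ (Finset.mem_univ i),
      Submodule.add_mem_iff_left _ (Submodule.sum_mem _ fun j hj =>
        Submodule.smul_mem _ _ ((hv j i).2 (Finset.ne_of_mem_erase hj).symm))]
    exact smul_mem_iff_eq_zero fun hi => (hv i i).1 hi rfl
  have hinj : Function.Injective ψ := by
    refine (injective_iff_map_eq_zero ψ).2 fun u hu => ?_
    have hzero (i : Fin 3) := (hψl i u).1 (hu ▸ (l i).zero_mem)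
    exact eq_zero_of_castSucc (fun i => (hzero i).1) (hzero 0).2
  exact ⟨LinearEquiv.ofInjectiveEndo ψ hinj, Submodule.ext hψT, fun i => Submodule.ext (hψl i)⟩

theorem IsTritangentWith.pts_subset {f : Form k} (h : IsTritangentWith f T l) (i : Fin 3) :
    pts (l i) ⊆ pts T ∩ zeroLocus f :=
  h.2.2.2 ▸ Set.subset_iUnion (fun i => pts (l i)) i

theorem IsTritangentWith.le {f : Form k} (h : IsTritangentWith f T l) (i : Fin 3) : l i ≤ T :=
  pts_subset_pts.1 ((h.pts_subset i).trans Set.inter_subset_left)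

theorem IsTritangentWith.eval_eq_zero_iff {f : Form k} (h : IsTritangentWith f T l) {d : ℕ}
    (hf : f.IsHomogeneous d) (hd : d ≠ 0) {v : V4 k} (hv : v ∈ T) :
    eval v f = 0 ↔ ∃ i, v ∈ l i := by
  refine ⟨fun hfv => ?_, fun ⟨i, hi⟩ =>
    eval_eq_zero_of_pts_subset hf hd ((h.pts_subset i).trans Set.inter_subset_right) hi⟩
  obtain rfl | hv₀ := eq_or_ne v 0
  · exact ⟨0, Submodule.zero_mem _⟩
  · have hmem : Projectivization.mk k v hv₀ ∈ pts T ∩ zeroLocus f :=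
      ⟨(mk_mem_pts hv₀).2 hv, (mk_mem_zeroLocus hf hv₀).2 hfv⟩
    rw [h.2.2.2] at hmem
    obtain ⟨i, hi⟩ := Set.mem_iUnion.1 hmem
    exact ⟨i, (mk_mem_pts hv₀).1 hi⟩

theorem exists_eq_pullback_cubic [IsAlgClosed k] [NeZero (2 : k)] {f : Form k}
    (hf : IsSmoothCubic f) (hT : IsTritangentWith f T l) (hl : ⋂ i, pts (l i) = ∅) :
    ∃ (φ : V4 k ≃ₗ[k] V4 k) (A : Matrix (Fin 4) (Fin 4) k), IsSmoothMatrix A ∧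
      f = pullback φ (cubic A) ∧ T = preimage φ (basePlane k) ∧
        l = fun i => preimage φ (baseLine k i) := by
  obtain ⟨ψ, hψT, hψl⟩ := exists_preimage_eq_base hT.1 hT.2.1 hT.le hl
  obtain ⟨c, g, hc, hg, heq⟩ := exists_eq_prod_add_X_mul (isHomogeneous_pullback ψ.toLinearMap hf.1)
    fun v hv => by
      have hvT : ψ v ∈ T := (SetLike.ext_iff.1 hψT v).2 hv
      rw [eval_pullback, LinearEquiv.coe_coe, hT.eval_eq_zero_iff hf.1 three_ne_zero hvT]
      exact exists_congr fun i =>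
        (SetLike.ext_iff.1 (hψl i) v).trans (mem_baseLine.trans (and_iff_left hv))
  obtain ⟨δ, A, hA, hcubic, hδT, hδl⟩ := exists_pullback_eq_cubic hc hg
  let χ := δ.trans ψ
  have hχT : preimage χ T = basePlane k := by
    rw [← hδT, ← hψT]
    rfl
  have hχl (i) : preimage χ (l i) = baseLine k i := by
    rw [← hδl, ← hψl]
    rfl
  have hχf : pullback χ.toLinearMap f = cubic A := by
    rw [← hcubic, ← heq, pullback_pullback]
    rfl
  refine ⟨χ.symm, A, ⟨hA, fun v hv => ?_⟩, ?_, ?_, ?_⟩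
  · exact (hf.pullback χ).eq_zero_of_isSingularAt (hχf ▸ hv)
  · rw [← hχf, pullback_symm_pullback]
  · rw [← hχT, preimage_symm_preimage]
  · simp only [← hχl, preimage_symm_preimage]

end Triangle

end CremonaQuartic

theorem mainTheorem8 {k : Type*} [Field k] [IsAlgClosed k] (h2 : (2 : k) ≠ 0)
    (f : CremonaQuartic.Form k) (hf : CremonaQuartic.IsSmoothCubic f)
    (T : Submodule k (CremonaQuartic.V4 k)) (l : Fin 3 → Submodule k (CremonaQuartic.V4 k))
    (hT : CremonaQuartic.IsTritangentWith f T l)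
    (hl : ⋂ i, CremonaQuartic.pts (l i) = ∅) :
    ∃ G : CremonaQuartic.Form k,
      G.IsHomogeneous 4 ∧ Irreducible G ∧
      CremonaQuartic.steinerian f T l = CremonaQuartic.zeroLocus G ∧
      (∀ p ∈ CremonaQuartic.singularPoints G, CremonaQuartic.IsNode G p) ∧
      (CremonaQuartic.triadsThrough f T).ncard = 16 ∧
      Set.InjOn (CremonaQuartic.triadLine T) (CremonaQuartic.triadsThrough f T) ∧
      (∀ L ∈ CremonaQuartic.triadLine T '' CremonaQuartic.triadsThrough f T,
        Module.finrank k L = 2 ∧ CremonaQuartic.pts L ⊆ CremonaQuartic.steinerian f T l) ∧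
      CremonaQuartic.IsConfiguration
        (CremonaQuartic.singularPoints G)
        (CremonaQuartic.triadLine T '' CremonaQuartic.triadsThrough f T)
        (fun p L => p ∈ CremonaQuartic.pts L) 12 4 16 3 := by
  have : NeZero (2 : k) := ⟨h2⟩
  obtain ⟨φ, A, hA, rfl, rfl, rfl⟩ := CremonaQuartic.exists_eq_pullback_cubic hf hT hl
  have h := hA.isNodalSteinerian.pullback φ (CremonaQuartic.isHomogeneous_cubic A)
  exact ⟨_, h.isHomogeneous, h.irreducible, h.steinerian_eq, h.isNode, h.ncard_triads,
    h.injOn_triadLine, h.triadLine_subset, h.isConfiguration⟩
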